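/- Set $X_1(t)=\frac1{1-\ln t}$ and $X_{k+1}(t)=X_k(X_1(t))$ for $t\in(0,1]$, $k\ge1$, and let $\kappa$ be the unique number $\kappa>1$ with $\sum_{i=1}^{\infty}X_1(1/\kappa)\cdots X_i(1/\kappa)=\frac14$. Let $n\ge3$. There exist positive constants $\sigma_n$ and $C_n$, depending only on $n$, with the following property. Let $\Omega\subset\mathbb R^n$ be a bounded domain with $0\in\partial\Omega$, put $D=\sup_{x\in\Omega}|x|$, and suppose that $\Omega$ satisfies an exterior ball condition at $0$ with radius $\rho\ge D/\sigma_n$, that is, $B_\rho(-\rho\nu)\subset\mathbb R^n\setminus\overline\Omega$ for some unit vector $\nu$. Write $X_i=X_i(|x|/(3\kappa D))$. Then for every $m\in\mathbb N=\{0,1,2,\dots\}$ and every $u\in C_c^\infty(\Omega)$ $$\int_\Omega|\nabla u|^2dx\ \ge\ \frac{n^2}4\int_\Omega\frac{u^2}{|x|^2}dx+\frac14\sum_{i=1}^m\int_\Omega\frac{u^2}{|x|^2}X_1^2\cdots X_i^2\,dx+C_n\Big(\int_\Omega(X_1\cdots X_{m+1})^{\frac{2n-2}{n-2}}|u|^{\frac{2n}{n-2}}dx\Big)^{\frac{n-2}n}.$$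 If in addition $\Omega$ satisfies an interior ball condition at $0$, that is, $B_r(r\nu')\subset\Omega$ for some $r>0$ and some unit vector $\nu'$, then the exponents $\frac{2n-2}{n-2}$ of $X_1,\dots,X_{m+1}$ are sharp: for every $m\in\mathbb N$, if $p_1,\dots,p_{m+1}\in\mathbb R$ satisfy $p_i\le\frac{2n-2}{n-2}$ for all $i$, with strict inequality for at least one $i$, then there is no constant $c>0$ such that $$\int_\Omega|\nabla u|^2dx\ \ge\ \frac{n^2}4\int_\Omega\frac{u^2}{|x|^2}dx+\frac14\sum_{i=1}^m\int_\Omega\frac{u^2}{|x|^2}X_1^2\cdots X_i^2\,dx+c\Big(\int_\Omega X_1^{p_1}\cdots X_{m+1}^{p_{m+1}}|u|^{\frac{2n}{n-2}}dx\Big)^{\frac{n-2}n}$$ holds for all $u\in C_c^\infty(\Omega)$. -/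

import Mathlib

open MeasureTheory Set Metric
open scoped ContDiff Gradient

/-- The function `X₁(t) = 1 / (1 - ln t)`. -/
noncomputable def logX (t : ℝ) : ℝ := 1 / (1 - Real.log t)

/-- The iterated logarithms `X₁ = logX` and `X_{k+1}(t) = X_k(X₁(t))`, with the convention
`X₀(t) = t`. -/
noncomputable def iterLog : ℕ → ℝ → ℝ
  | 0, t => t
  | k + 1, t => iterLog k (logX t)

/-- The product `X₁(t) X₂(t) ⋯ X_k(t)`. -/
noncomputable def logProd (k : ℕ) (t : ℝ) : ℝ := ∏ i ∈ Finset.range k, iterLog (i + 1) t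

theorem iterLog_one : iterLog 1 = logX := rfl

theorem iterLog_succ (k : ℕ) (t : ℝ) : iterLog (k + 1) t = iterLog k (logX t) := rfl

theorem logX_mem {t : ℝ} (ht : t ∈ Ioo (0 : ℝ) 1) : logX t ∈ Ioo (0 : ℝ) 1 := by
  have h := Real.log_neg ht.1 ht.2
  unfold logX
  refine ⟨by apply one_div_pos.2; linarith, ?_⟩
  rw [div_lt_one (by linarith)]
  linarith

theorem logX_lt {s t : ℝ} (hs : 0 < s) (hst : s < t) (ht : t < 1) : logX s < logX t := by
  have h := Real.log_neg (hs.trans hst) ht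
  have h' := Real.log_lt_log hs hst
  exact one_div_lt_one_div_of_lt (by linarith) (by linarith)

theorem logX_continuousOn : ContinuousOn logX (Ioo (0 : ℝ) 1) := by
  unfold logX
  refine continuousOn_const.div (continuousOn_const.sub
    (Real.continuousOn_log.mono fun x hx => hx.1.ne')) fun x hx => ?_
  have := Real.log_neg hx.1 hx.2
  linarith

theorem iterLog_mem (k : ℕ) : ∀ {t : ℝ}, t ∈ Ioo (0 : ℝ) 1 → iterLog k t ∈ Ioo (0 : ℝ) 1 := by
  induction k with
  | zero => exact fun h => h
  | succ k ih => exact fun h => ih (logX_mem h)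

theorem iterLog_lt (k : ℕ) :
    ∀ {s t : ℝ}, 0 < s → s < t → t < 1 → iterLog k s < iterLog k t := by
  induction k with
  | zero => exact fun _ h _ => h
  | succ k ih =>
    intro s t h0 h1 h2
    exact ih (logX_mem ⟨h0, h1.trans h2⟩).1 (logX_lt h0 h1 h2) (logX_mem ⟨h0.trans h1, h2⟩).2

theorem iterLog_continuousOn (k : ℕ) : ContinuousOn (iterLog k) (Ioo (0 : ℝ) 1) := by
  induction k with
  | zero => exact continuousOn_id
  | succ k ih => exact ih.comp logX_continuousOn fun _ h => logX_mem h

theorem logProd_pos (k : ℕ) {t : ℝ} (ht : t ∈ Ioo (0 : ℝ) 1) : 0 < logProd k t :=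
  Finset.prod_pos fun _ _ => (iterLog_mem _ ht).1

theorem logProd_le (k : ℕ) {s t : ℝ} (hs : 0 < s) (hst : s ≤ t) (ht : t < 1) :
    logProd k s ≤ logProd k t := by
  rcases hst.eq_or_lt with rfl | h
  · exact le_rfl
  · exact Finset.prod_le_prod (fun i _ => (iterLog_mem _ ⟨hs, h.trans ht⟩).1.le)
      fun i _ => (iterLog_lt _ hs h ht).le

theorem logProd_succ (k : ℕ) (t : ℝ) : logProd (k + 1) t = logX t * logProd k (logX t) := by
  unfold logProd
  rw [Finset.prod_range_succ', mul_comm]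
  rfl

theorem logProd_continuousOn (k : ℕ) : ContinuousOn (logProd k) (Ioo (0 : ℝ) 1) :=
  continuousOn_finsetProd _ fun _ _ => iterLog_continuousOn _

theorem logProd_sum_le (N : ℕ) : ∀ {t : ℝ}, t ∈ Ioo (0 : ℝ) 1 →
    ∑ i ∈ Finset.range N, logProd (i + 1) t ≤ 2 / (-Real.log t) := by
  induction N with
  | zero =>
    intro t ht
    have := Real.log_neg ht.1 ht.2
    simp only [Finset.range_zero, Finset.sum_empty]
    exact div_nonneg (by norm_num) (by linarith)
  | succ N ih =>
    intro t ht
    have hL : 0 < -Real.log t := by linarith [Real.log_neg ht.1 ht.2]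
    have h1 := ih (logX_mem ht)
    have e : ∑ i ∈ Finset.range (N + 1), logProd (i + 1) t =
        logX t * (1 + ∑ i ∈ Finset.range N, logProd (i + 1) (logX t)) := by
      simp only [logProd_succ _ t]
      rw [← Finset.mul_sum, Finset.sum_range_succ', add_comm]
      simp [logProd]
    rw [e]
    have hlog : Real.log (logX t) = -Real.log (1 + -Real.log t) := by
      unfold logX
      rw [one_div, Real.log_inv, sub_eq_add_neg]
    have hX : logX t = 1 / (1 + -Real.log t) := by unfold logX; rw [sub_eq_add_neg]
    rw [hlog, neg_neg] at h1
    rw [hX] at h1 ⊢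
    generalize -Real.log t = L at *
    have h2 := Real.le_log_one_add_of_nonneg hL.le
    have h3 : 2 / Real.log (1 + L) ≤ (L + 2) / L := by
      calc 2 / Real.log (1 + L) ≤ 2 / (2 * L / (L + 2)) := by gcongr
        _ = (L + 2) / L := by field_simp
    calc 1 / (1 + L) * (1 + ∑ i ∈ Finset.range N, logProd (i + 1) (1 / (1 + L)))
        ≤ 1 / (1 + L) * (1 + (L + 2) / L) := by gcongr; exact h1.trans h3
      _ = 2 / L := by field_simp; ring

theorem logProd_summable {t : ℝ} (ht : t ∈ Ioo (0 : ℝ) 1) :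
    Summable fun i : ℕ => logProd (i + 1) t :=
  summable_of_sum_range_le (fun _ => (logProd_pos _ ht).le) fun N => logProd_sum_le N ht

/-- There is exactly one `κ > 1` with `∑_{i ≥ 1} X₁(1/κ) ⋯ X_i(1/κ) = 1/4`. -/
theorem existsUnique_kappa :
    ∃! κ : ℝ, 1 < κ ∧ HasSum (fun i : ℕ => logProd (i + 1) (1 / κ)) (1 / 4) := by
  have mono : ∀ s t : ℝ, 0 < s → s < t → t < 1 →
      ∑' i : ℕ, logProd (i + 1) s < ∑' i : ℕ, logProd (i + 1) t := by
    intro s t h0 h1 h2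
    refine Summable.tsum_lt_tsum (i := 0) (fun i => logProd_le _ h0 h1.le h2) ?_
      (logProd_summable ⟨h0, h1.trans h2⟩) (logProd_summable ⟨h0.trans h1, h2⟩)
    simpa [logProd, iterLog] using logX_lt h0 h1 h2
  have hb : Real.exp (-2) < 1 := by simp
  have hab : Real.exp (-8) ≤ Real.exp (-2) := Real.exp_le_exp.2 (by norm_num)
  have hsub : Icc (Real.exp (-8)) (Real.exp (-2)) ⊆ Ioo (0 : ℝ) 1 := fun x hx =>
    ⟨(Real.exp_pos _).trans_le hx.1, hx.2.trans_lt hb⟩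
  have hcont : ContinuousOn (fun t : ℝ => ∑' i : ℕ, logProd (i + 1) t)
      (Icc (Real.exp (-8)) (Real.exp (-2))) := by
    refine continuousOn_tsum (fun i => (logProd_continuousOn _).mono hsub)
      (logProd_summable (hsub ⟨hab, le_rfl⟩)) fun i x hx => ?_
    rw [Real.norm_of_nonneg (logProd_pos _ (hsub hx)).le]
    exact logProd_le _ (hsub hx).1 hx.2 hb
  have hlo : ∑' i : ℕ, logProd (i + 1) (Real.exp (-8)) ≤ 1 / 4 := by
    have hm := hsub ⟨le_rfl, hab⟩
    refine Real.tsum_le_of_sum_range_le (fun _ => (logProd_pos _ hm).le) fun N => ?_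
    refine (logProd_sum_le N hm).trans ?_
    rw [Real.log_exp]
    norm_num
  have hhi : 1 / 4 ≤ ∑' i : ℕ, logProd (i + 1) (Real.exp (-2)) := by
    have hm := hsub ⟨hab, le_rfl⟩
    have h := (logProd_summable hm).le_tsum 0 fun j _ => (logProd_pos _ hm).le
    refine le_trans ?_ h
    simp only [logProd, iterLog, logX, zero_add, Finset.range_one, Finset.prod_singleton,
      Real.log_exp]
    norm_num
  obtain ⟨t, ht, hts⟩ := intermediate_value_Icc hab hcont ⟨hlo, hhi⟩
  have htm := hsub ht
  refine ⟨1 / t, ⟨(one_lt_div htm.1).2 htm.2, ?_⟩, ?_⟩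
  · rw [one_div_one_div]
    have h := (logProd_summable htm).hasSum
    rwa [show ∑' i : ℕ, logProd (i + 1) t = 1 / 4 from hts] at h
  · rintro κ ⟨hκ, hs⟩
    have h0 : 0 < 1 / κ := by positivity
    have h1 : 1 / κ < 1 := (div_lt_one (by linarith)).2 hκ
    have h2 : ∑' i : ℕ, logProd (i + 1) t = 1 / 4 := hts
    have e : 1 / κ = t := by
      rcases lt_trichotomy (1 / κ) t with h | h | h
      · have := mono _ _ h0 h htm.2
        rw [hs.tsum_eq, h2] at this
        exact absurd this (lt_irrefl _)
      · exact h
      · have := mono _ _ htm.1 h h1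
        rw [hs.tsum_eq, h2] at this
        exact absurd this (lt_irrefl _)
    rw [← e, one_div_one_div]

/-- The unique `κ > 1` with `∑_{i ≥ 1} X₁(1/κ) ⋯ X_i(1/κ) = 1/4`. -/
noncomputable def kappa : ℝ := existsUnique_kappa.choose

theorem kappa_spec :
    1 < kappa ∧ HasSum (fun i : ℕ => logProd (i + 1) (1 / kappa)) (1 / 4) :=
  existsUnique_kappa.choose_spec.1

/-- `D = sup_{x ∈ Ω} |x|`. -/
noncomputable def supNorm {n : ℕ} (Ω : Set (EuclideanSpace ℝ (Fin n))) : ℝ :=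
  sSup ((fun x => ‖x‖) '' Ω)

/-- `u ∈ C_c^∞(Ω)`. -/
def IsTestFunction {n : ℕ} (Ω : Set (EuclideanSpace ℝ (Fin n)))
    (u : EuclideanSpace ℝ (Fin n) → ℝ) : Prop :=
  ContDiff ℝ ∞ u ∧ HasCompactSupport u ∧ tsupport u ⊆ Ω

/-- Exterior ball condition at `0` with radius `ρ`: some ball of radius `ρ` whose boundary sphere
passes through `0`, written as `B_ρ(-ρ ν)` with `ν` a unit vector, lies in the complement of the
closure of `Ω`. -/
def ExteriorBallAtZero {n : ℕ} (Ω : Set (EuclideanSpace ℝ (Fin n))) (ρ : ℝ) : Prop :=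
  0 < ρ ∧ ∃ ν : EuclideanSpace ℝ (Fin n), ‖ν‖ = 1 ∧ ball (-(ρ • ν)) ρ ⊆ (closure Ω)ᶜ

/-- Interior ball condition at `0`: some ball whose boundary sphere passes through `0` is contained
in `Ω`. -/
def InteriorBallAtZero {n : ℕ} (Ω : Set (EuclideanSpace ℝ (Fin n))) : Prop :=
  ∃ r > 0, ∃ ν : EuclideanSpace ℝ (Fin n), ‖ν‖ = 1 ∧ ball (r • ν) r ⊆ Ω

/-! The inequality comes from a ground state. Take `φ = (⟨ν, x⟩ + ε|x|²) |ν + εx|^{-n} h(|x|)` with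
`h(r) = r^{-n/2} (X₁⋯X_m)^{-1/2}(r/M) e^{-δr}`, `ε = 1/(2ρ)`, `δ = 1/(2D)` and `M = 3κD`. The first
two factors form a harmonic function, up to a constant the Poisson kernel of the exterior of the
ball with pole antipodal to the origin; it is positive on `Ω` and vanishes linearly at `0`.
Integrating by parts, `∫|∇u|² = ∫|∇u - u∇φ/φ|² + ∫ u² (-Δφ/φ)` (`ground_state_identity`). The
logarithms in `h` produce the Hardy series in `-Δφ/φ`. The factor `e^{-δr}` produces a positive term
of order `r/D` (relative to `|x|^{-2}`), which pays for the curvature of the sphere once `ρ/D` is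
large (`le_groundPotential`); the constant `κ` keeps `X₁ + X₁X₂ + ⋯` below `1/4`.

It remains to bound the weighted critical integral by the energy `E = ∫|∇u - u∇φ/φ|²`. Put `η =
X₁⋯X_{m+1}`, `α = (n-1)/(n-2)` and `G = ∫ η^α |u|^{2α-1} |∇u - u∇φ/φ|`. Cauchy–Schwarz gives `G² ≤ A
E`, where `A` is the critical integral (`gradMass_sq_le`), so `A ≤ C G^{n/(n-1)}` suffices
(`exists_critMass_le_gradMass`). For that bound the `L¹` Sobolev inequality is applied to `|u|^{2α}`
cut off to the scales `|x| ~ D/16^j`. The gradient of such a function is controlled by a local mass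
`e_j`, the term in `1/dist` being absorbed by a Hardy inequality in direction `ν` (`normal_hardy`).
A radial Hardy inequality in which the powers of `r` cancel exactly (`radial_hardy`) shows that
`η(s_j)^α e_j` is bounded by `G` for each `j` and that `η(s_j)^{α+1} e_j` is summable with sum
bounded by `G`. The weight `η^{2α}` is exactly what these two estimates yield together.

For sharpness the half space ground state `⟨ν, x⟩ h(|x|)` (`ε = δ = 0`) is cut off to the interior
ball and to the scale `1/X_{m+1} ∈ [λ, 4λ]`. In that case the identity has no error, and the energy
is `O(1/λ)` (`integral_groundGrad_sq_le`), because `1/X_{m+1}` is a primitive of `-X₁⋯X_m/r`. The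
last term of the inequality is at least `c λ^{s-1}` with `s > 0` as soon as one exponent is lowered
(`exists_mass_ge`), so `λ → ∞` gives a contradiction. -/

/-! ### Calculus of the iterated logarithms -/

/-- The partial sums `X₁ + X₁X₂ + ⋯ + X₁⋯X_m`. -/
noncomputable def logSum (m : ℕ) (t : ℝ) : ℝ := ∑ i ∈ Finset.range m, logProd (i + 1) t

theorem logProd_zero (t : ℝ) : logProd 0 t = 1 := by simp [logProd]

theorem logProd_succ_last (m : ℕ) (t : ℝ) :
    logProd (m + 1) t = logProd m t * iterLog (m + 1) t := Finset.prod_range_succ _ _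

theorem logSum_succ (m : ℕ) (t : ℝ) : logSum (m + 1) t = logSum m t + logProd (m + 1) t :=
  Finset.sum_range_succ _ _

theorem logProd_le_one (k : ℕ) {t : ℝ} (ht : t ∈ Ioo (0 : ℝ) 1) : logProd k t ≤ 1 :=
  Finset.prod_le_one (fun _ _ => (iterLog_mem _ ht).1.le) fun _ _ => (iterLog_mem _ ht).2.le

theorem one_sub_log_pos {t : ℝ} (ht : t ∈ Ioo (0 : ℝ) 1) : 0 < 1 - Real.log t := by
  linarith [Real.log_neg ht.1 ht.2]

theorem hasDerivAt_logX {t : ℝ} (ht : t ∈ Ioo (0 : ℝ) 1) :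
    HasDerivAt logX (logX t ^ 2 / t) t := by
  have h0 := one_sub_log_pos ht
  have h := ((Real.hasDerivAt_log ht.1.ne').const_sub 1).inv h0.ne'
  have e : logX = (fun s => (1 - Real.log s))⁻¹ := by
    ext s; simp [logX]
  rw [show logX t = (1 - Real.log t)⁻¹ by simp [logX], e]
  refine h.congr_deriv ?_
  have := ht.1.ne'
  field_simp

/-- The chain rule telescopes: the derivative of `ln X_k` with respect to `ln t` is `X₁⋯X_k`. The
convention `iterLog 0 t = t` fits the empty product. -/
theorem hasDerivAt_iterLog (k : ℕ) : ∀ {t : ℝ}, t ∈ Ioo (0 : ℝ) 1 →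
    HasDerivAt (iterLog k) (iterLog k t * logProd k t / t) t := by
  induction k with
  | zero =>
    intro t ht
    have := ht.1.ne'
    have e : iterLog 0 t * logProd 0 t / t = 1 := by
      simp [logProd_zero, iterLog, this]
    rw [e]
    exact hasDerivAt_id t
  | succ k ih =>
    intro t ht
    have h := (ih (logX_mem ht)).comp t (hasDerivAt_logX ht)
    have h1 := (logX_mem ht).1.ne'
    have h2 := ht.1.ne'
    refine h.congr_deriv ?_
    rw [iterLog_succ, logProd_succ]
    field_simp

theorem hasDerivAt_logProd (m : ℕ) {t : ℝ} (ht : t ∈ Ioo (0 : ℝ) 1) :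
    HasDerivAt (logProd m) (logProd m t * logSum m t / t) t := by
  induction m with
  | zero =>
    have e : logProd 0 = fun _ => 1 := by ext s; exact logProd_zero s
    simp only [e, logSum, Finset.range_zero, Finset.sum_empty, mul_zero, zero_div]
    exact hasDerivAt_const t (1 : ℝ)
  | succ m ih =>
    have h := ih.mul (hasDerivAt_iterLog (m + 1) ht)
    have e : logProd (m + 1) = logProd m * iterLog (m + 1) := by
      ext s; exact logProd_succ_last m s
    rw [e]
    refine h.congr_deriv ?_
    rw [logSum_succ, Pi.mul_apply, logProd_succ_last]
    ring

/-- Differentiating termwise gives a sum of products `X₁⋯X_i` times the partial sum up to `i`, which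
symmetrizes to half of square plus sum of squares. This is how the squares `X₁²⋯X_i²` of the Hardy
series arise from the ground state. -/
theorem hasDerivAt_logSum (m : ℕ) {t : ℝ} (ht : t ∈ Ioo (0 : ℝ) 1) :
    HasDerivAt (logSum m)
      ((logSum m t ^ 2 + ∑ i ∈ Finset.range m, logProd (i + 1) t ^ 2) / 2 / t) t := by
  induction m with
  | zero =>
    have e : logSum 0 = fun _ => 0 := by ext s; simp [logSum]
    simp only [e, Finset.range_zero, Finset.sum_empty]
    exact (hasDerivAt_const t (0 : ℝ)).congr_deriv (by simp)
  | succ m ih =>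
    have h := ih.add (hasDerivAt_logProd (m + 1) ht)
    have e : logSum (m + 1) = logSum m + logProd (m + 1) := by
      ext s; exact logSum_succ m s
    rw [e]
    refine h.congr_deriv ?_
    rw [Pi.add_apply, Finset.sum_range_succ, logSum_succ]
    ring

theorem logX_contDiffOn : ContDiffOn ℝ ∞ logX (Ioo (0 : ℝ) 1) := by
  unfold logX
  refine contDiffOn_const.div (contDiffOn_const.sub
    (Real.contDiffOn_log.mono fun x hx => hx.1.ne')) fun x hx => (one_sub_log_pos hx).ne'

theorem iterLog_contDiffOn (k : ℕ) : ContDiffOn ℝ ∞ (iterLog k) (Ioo (0 : ℝ) 1) := by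
  induction k with
  | zero => exact contDiffOn_id
  | succ k ih => exact ih.comp logX_contDiffOn fun _ h => logX_mem h

theorem logProd_contDiffOn (k : ℕ) : ContDiffOn ℝ ∞ (logProd k) (Ioo (0 : ℝ) 1) :=
  contDiffOn_prod fun _ _ => iterLog_contDiffOn _

theorem logSum_continuousOn (m : ℕ) : ContinuousOn (logSum m) (Ioo (0 : ℝ) 1) :=
  continuousOn_finsetSum _ fun _ _ => logProd_continuousOn _

theorem logSum_nonneg (m : ℕ) {t : ℝ} (ht : t ∈ Ioo (0 : ℝ) 1) : 0 ≤ logSum m t :=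
  Finset.sum_nonneg fun _ _ => (logProd_pos _ ht).le

theorem one_div_kappa_mem : 1 / kappa ∈ Ioo (0 : ℝ) 1 := by
  have h := kappa_spec.1
  exact ⟨by positivity, (div_lt_one (by linarith)).2 h⟩

/-- The sums increase with `t` and stay below the full series at `1/κ`; this is where the series
defining `κ` enters. -/
theorem logSum_le_quarter (m : ℕ) {t : ℝ} (h0 : 0 < t) (ht : t ≤ 1 / kappa) :
    logSum m t ≤ 1 / 4 := by
  have hk := one_div_kappa_mem
  calc logSum m t ≤ logSum m (1 / kappa) :=
        Finset.sum_le_sum fun i _ => logProd_le _ h0 ht hk.2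
    _ ≤ 1 / 4 := sum_le_hasSum _ (fun i _ => (logProd_pos _ hk).le) kappa_spec.2

/-- Slow variation: the logarithmic derivative of `logProd m` in `ln t` is `logSum m ≤ 1/4`, so
dividing by `t^{1/4}` leaves a decreasing function. The bound is uniform in `m`, which makes the
final constant depend on `n` only. -/
theorem logProd_le_mul_rpow (m : ℕ) {s t : ℝ} (hs : 0 < s) (hst : s ≤ t) (ht : t ≤ 1 / kappa) :
    logProd m t ≤ logProd m s * (t / s) ^ (1 / 4 : ℝ) := by
  have hk := one_div_kappa_mem
  have hI : ∀ x ∈ Icc s t, x ∈ Ioo (0 : ℝ) 1 := fun x hx =>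
    ⟨hs.trans_le hx.1, (hx.2.trans ht).trans_lt hk.2⟩
  have hd : ∀ x ∈ Icc s t, HasDerivAt (fun y => logProd m y * y ^ (-(1 / 4) : ℝ))
      (logProd m x * x ^ (-(1 / 4) : ℝ) / x * (logSum m x - 1 / 4)) x := by
    intro x hx
    have hx0 := (hI x hx).1
    refine ((hasDerivAt_logProd m (hI x hx)).mul
      (Real.hasDerivAt_rpow_const (p := -(1 / 4)) (Or.inl hx0.ne'))).congr_deriv ?_
    rw [Real.rpow_sub_one hx0.ne']
    ring
  have hanti : AntitoneOn (fun y => logProd m y * y ^ (-(1 / 4) : ℝ)) (Icc s t) := by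
    refine antitoneOn_of_deriv_nonpos (convex_Icc s t)
      (fun x hx => (hd x hx).continuousAt.continuousWithinAt)
      (fun x hx => (hd x (interior_subset hx)).differentiableAt.differentiableWithinAt) ?_
    intro x hx
    have hx' := interior_subset hx
    rw [(hd x hx').deriv]
    have hx0 := (hI x hx').1
    have := logSum_le_quarter m hx0 (hx'.2.trans ht)
    have := logProd_pos m (hI x hx')
    refine mul_nonpos_of_nonneg_of_nonpos (by positivity) (by linarith)
  have h := hanti ⟨le_rfl, hst⟩ ⟨hst, le_rfl⟩ hst
  have ht0 : 0 < t := hs.trans_le hst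
  simp only [Real.rpow_neg ht0.le, Real.rpow_neg hs.le] at h
  rw [Real.div_rpow ht0.le hs.le]
  have h1 : 0 < t ^ (1 / 4 : ℝ) := by positivity
  have h2 : 0 < s ^ (1 / 4 : ℝ) := by positivity
  rw [← div_eq_mul_inv, ← div_eq_mul_inv, div_le_div_iff₀ h1 h2] at h
  rw [← mul_div_assoc, le_div_iff₀ h2]
  exact h

theorem le_logX {t : ℝ} (ht : t ∈ Ioo (0 : ℝ) 1) : t ≤ logX t := by
  have h0 := one_sub_log_pos ht
  have h1 := Real.log_le_sub_one_of_pos (inv_pos.2 ht.1)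
  rw [Real.log_inv] at h1
  unfold logX
  rw [le_div_iff₀ h0]
  calc t * (1 - Real.log t) ≤ t * t⁻¹ := by gcongr; exact ht.1.le; linarith
    _ = 1 := mul_inv_cancel₀ ht.1.ne'

theorem iterLog_eq_logX_iterLog (k : ℕ) : ∀ t, iterLog (k + 1) t = logX (iterLog k t) := by
  induction k with
  | zero => exact fun t => rfl
  | succ k ih => exact fun t => ih (logX t)

/-- Iterating `t ≤ X₁(t)`: later logarithms tend to zero more slowly. Sharpness uses this to compare
a lowered exponent at any index with one at the last index. -/
theorem iterLog_mono_index {j k : ℕ} (h : j ≤ k) {t : ℝ} (ht : t ∈ Ioo (0 : ℝ) 1) :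
    iterLog j t ≤ iterLog k t := by
  induction k, h using Nat.le_induction with
  | base => exact le_rfl
  | succ k _ ih =>
    rw [iterLog_eq_logX_iterLog]
    exact ih.trans (le_logX (iterLog_mem k ht))


/-! ### Integration by parts with coefficients singular off the support -/

section IntegrationByParts

/-- Suited to integrands whose singular coefficients are controlled only on a compact set, while a
factor such as the test function kills them elsewhere. -/
theorem integrable_of_continuousOn_compact {X : Type*} [TopologicalSpace X] [T2Space X]
    [MeasurableSpace X]
    [OpensMeasurableSpace X] {μ : Measure X} [IsFiniteMeasureOnCompacts μ] {K : Set X}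
    (hK : IsCompact K) {f : X → ℝ} (hf : ContinuousOn f K) (h0 : ∀ x ∉ K, f x = 0) :
    Integrable f μ :=
  (integrableOn_iff_integrable_of_support_subset fun x hx => by
    by_contra h; exact hx (h0 x h)).1 (hf.integrableOn_compact hK)

variable {n : ℕ}

/-- Divergence theorem for `F • (a x + b v)`, where `F` is `C¹` with compact support and `a`, `b`
are `C¹` on the support of `F`. -/
theorem integral_divergence_eq_zero {F a b : EuclideanSpace ℝ (Fin n) → ℝ}
    {a' b' : EuclideanSpace ℝ (Fin n) → EuclideanSpace ℝ (Fin n) →L[ℝ] ℝ}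
    (v : EuclideanSpace ℝ (Fin n))
    (hF : ContDiff ℝ 1 F) (hc : HasCompactSupport F)
    (ha : ∀ x ∈ tsupport F, HasFDerivAt a (a' x) x) (ha' : ContinuousOn a' (tsupport F))
    (hb : ∀ x ∈ tsupport F, HasFDerivAt b (b' x) x) (hb' : ContinuousOn b' (tsupport F)) :
    ∫ x, (F x * (n * a x + a' x x + b' x v) + (a x * fderiv ℝ F x x + b x * fderiv ℝ F x v)) = 0 := by
  have hdF : ∀ x ∉ tsupport F, fderiv ℝ F x = 0 := fun x hx => by
    by_contra h
    exact hx (support_fderiv_subset ℝ h)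
  have hF0 : ∀ x ∉ tsupport F, F x = 0 := fun x hx => image_eq_zero_of_notMem_tsupport hx
  have hFc : ContinuousOn F (tsupport F) := hF.continuous.continuousOn
  have hdc : ContinuousOn (fderiv ℝ F) (tsupport F) :=
    (hF.continuous_fderiv one_ne_zero).continuousOn
  have hac : ContinuousOn a (tsupport F) := fun x hx =>
    (ha x hx).continuousAt.continuousWithinAt
  have hbc : ContinuousOn b (tsupport F) := fun x hx =>
    (hb x hx).continuousAt.continuousWithinAt
  -- Integration by parts of `f F` in one constant direction; the theorem follows by applying it to
  -- the components `a x_i` of the radial field and to `b` in direction `v`.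
  have key : ∀ (f : EuclideanSpace ℝ (Fin n) → ℝ)
      (f' : EuclideanSpace ℝ (Fin n) → EuclideanSpace ℝ (Fin n) →L[ℝ] ℝ)
      (w : EuclideanSpace ℝ (Fin n)), (∀ x ∈ tsupport F, HasFDerivAt f (f' x) x) →
      ContinuousOn f' (tsupport F) →
      Integrable (fun x => f' x w * F x + f x * fderiv ℝ F x w) ∧
      ∫ x, (f' x w * F x + f x * fderiv ℝ F x w) = 0 := by
    intro f f' w hf hf'
    have hfc : ContinuousOn f (tsupport F) := fun x hx =>
      (hf x hx).continuousAt.continuousWithinAt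
    have i1 : Integrable (fun x => f' x w * F x) :=
      integrable_of_continuousOn_compact hc ((hf'.clm_apply continuousOn_const).mul hFc)
        fun x hx => by rw [hF0 x hx, mul_zero]
    have i2 : Integrable (fun x => f x * fderiv ℝ F x w) :=
      integrable_of_continuousOn_compact hc (hfc.mul (hdc.clm_apply continuousOn_const))
        fun x hx => by rw [hdF x hx]; simp
    have i3 : Integrable (fun x => f x * F x) :=
      integrable_of_continuousOn_compact hc (hfc.mul hFc)
        fun x hx => by rw [hF0 x hx, mul_zero]
    refine ⟨i1.add i2, ?_⟩
    have := integral_bilinear_hasFDerivAt_right_eq_neg_left_of_integrable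
      (B := ContinuousLinearMap.mul ℝ ℝ) (g' := fderiv ℝ F) (v := w) i1 i2 i3 hf
      (fun x _ => (hF.differentiable one_ne_zero x).hasFDerivAt)
    simp only [ContinuousLinearMap.mul_apply'] at this
    rw [integral_add i1 i2, this, add_neg_cancel]
  let e := EuclideanSpace.basisFun (Fin n) ℝ
  have hx : ∀ i, _ := fun i => key (fun x => a x * x i)
    (fun x => a x • EuclideanSpace.proj i + x i • a' x) (e i)
    (fun x hx => (ha x hx).mul (EuclideanSpace.proj (𝕜 := ℝ) i).hasFDerivAt)
    ((hac.smul continuousOn_const).add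
      ((EuclideanSpace.proj (𝕜 := ℝ) i).continuous.continuousOn.smul ha'))
  have hv := key b b' v hb hb'
  have hsum : ∀ (φ : EuclideanSpace ℝ (Fin n) →L[ℝ] ℝ) (x : EuclideanSpace ℝ (Fin n)),
      ∑ i, x i * φ (e i) = φ x := by
    intro φ x
    conv_rhs => rw [← e.sum_repr x]
    simp [e]
  have e1 : (fun x => F x * (n * a x + a' x x + b' x v)
      + (a x * fderiv ℝ F x x + b x * fderiv ℝ F x v)) = fun x =>
      (∑ i, ((a x • EuclideanSpace.proj i + x i • a' x : EuclideanSpace ℝ (Fin n) →L[ℝ] ℝ) (e i)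
        * F x + a x * x i * fderiv ℝ F x (e i)))
      + (b' x v * F x + b x * fderiv ℝ F x v) := by
    ext x
    have h1 : ∀ i, ((a x • EuclideanSpace.proj i + x i • a' x :
        EuclideanSpace ℝ (Fin n) →L[ℝ] ℝ) (e i) * F x + a x * x i * fderiv ℝ F x (e i)) =
        a x * F x + (x i * a' x (e i)) * F x + a x * (x i * fderiv ℝ F x (e i)) := by
      intro i
      simp [e]
      ring
    simp only [h1, Finset.sum_add_distrib, ← Finset.sum_mul, ← Finset.mul_sum, hsum]
    simp
    ring
  rw [e1, integral_add (integrable_finsetSum _ fun i _ => (hx i).1) hv.1,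
    integral_finsetSum _ fun i _ => (hx i).1, hv.2]
  rw [Finset.sum_eq_zero fun i _ => (hx i).2, add_zero]

end IntegrationByParts


/-! ### The logarithmic gradient of the ground state -/

section GroundState

variable {n : ℕ}

theorem hasFDerivAt_norm_of_ne_zero {x : EuclideanSpace ℝ (Fin n)} (hx : x ≠ 0) :
    HasFDerivAt (fun x : EuclideanSpace ℝ (Fin n) => ‖x‖) (‖x‖⁻¹ • innerSL ℝ x) x := by
  have h := ((hasStrictFDerivAt_norm_sq x).hasFDerivAt).sqrt (by simpa using hx)
  simp only [Real.sqrt_sq (norm_nonneg _)] at h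
  refine h.congr_fderiv ?_
  ext v
  have := norm_ne_zero_iff.2 hx
  simp
  field_simp

theorem hasFDerivAt_comp_norm {g : ℝ → ℝ} {g' : ℝ} {x : EuclideanSpace ℝ (Fin n)} (hx : x ≠ 0)
    (hg : HasDerivAt g g' ‖x‖) :
    HasFDerivAt (fun x : EuclideanSpace ℝ (Fin n) => g ‖x‖) ((g' / ‖x‖) • innerSL ℝ x) x := by
  have h := hg.comp_hasFDerivAt x (hasFDerivAt_norm_of_ne_zero hx)
  refine h.congr_fderiv ?_
  rw [smul_smul, div_eq_mul_inv]

/-- Defining function of the hyperplane (`ε = 0`) or of a sphere touching it at the origin. -/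
noncomputable def sphFun (ε : ℝ) (ν x : EuclideanSpace ℝ (Fin n)) : ℝ :=
  inner ℝ ν x + ε * ‖x‖ ^ 2

/-- The squared norm of `ν + ε x`. -/
noncomputable def sphDen (ε : ℝ) (ν x : EuclideanSpace ℝ (Fin n)) : ℝ :=
  1 + 2 * ε * inner ℝ ν x + ε ^ 2 * ‖x‖ ^ 2

/-- The logarithmic derivative `r (ln h)'` of the radial factor
`h(r) = r^{-n/2} (X₁⋯X_m)^{-1/2}(r/M) e^{-δ r}`. -/
noncomputable def radLog (n m : ℕ) (M δ r : ℝ) : ℝ := -(n : ℝ) / 2 - logSum m (r / M) / 2 - δ * r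

/-- The coefficient of `x` in the logarithmic gradient of the ground state. -/
noncomputable def coefX (n m : ℕ) (M δ ε : ℝ) (ν x : EuclideanSpace ℝ (Fin n)) : ℝ :=
  2 * ε / sphFun ε ν x - n * ε ^ 2 / sphDen ε ν x + radLog n m M δ ‖x‖ / ‖x‖ ^ 2

/-- The coefficient of `ν` in the logarithmic gradient of the ground state. -/
noncomputable def coefNu (ε : ℝ) (ν x : EuclideanSpace ℝ (Fin n)) : ℝ :=
  1 / sphFun ε ν x - n * ε / sphDen ε ν x

/-- The logarithmic gradient of the ground state
`(⟨ν, x⟩ + ε |x|²) |ν + ε x|^{-n} h(|x|)`. -/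
noncomputable def logGrad (m : ℕ) (M δ ε : ℝ) (ν x : EuclideanSpace ℝ (Fin n)) :
    EuclideanSpace ℝ (Fin n) :=
  coefX n m M δ ε ν x • x + coefNu ε ν x • ν

/-- The region where the ground state is smooth and positive. -/
def goodSet (M ε : ℝ) (ν : EuclideanSpace ℝ (Fin n)) : Set (EuclideanSpace ℝ (Fin n)) :=
  {x | x ≠ 0 ∧ ‖x‖ < M ∧ 0 < sphFun ε ν x ∧ 0 < sphDen ε ν x}

/-- The potential `-Δφ/φ` of the ground state `φ`. -/
noncomputable def groundPotential (m : ℕ) (M δ ε : ℝ) (ν x : EuclideanSpace ℝ (Fin n)) : ℝ :=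
  ((n : ℝ) ^ 2 / 4 + 1 / 4 * ∑ i ∈ Finset.range m, logProd (i + 1) (‖x‖ / M) ^ 2
    + δ * ‖x‖ * (1 - logSum m (‖x‖ / M) - δ * ‖x‖)
    - 2 * radLog n m M δ ‖x‖
      * (ε * ‖x‖ ^ 2 / sphFun ε ν x - n * ε * sphFun ε ν x / sphDen ε ν x)) / ‖x‖ ^ 2

theorem goodSet_div_mem {M ε : ℝ} {ν x : EuclideanSpace ℝ (Fin n)} (hx : x ∈ goodSet M ε ν) :
    ‖x‖ / M ∈ Ioo (0 : ℝ) 1 := by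
  have h0 := norm_pos_iff.2 hx.1
  have hM : 0 < M := h0.trans hx.2.1
  exact ⟨div_pos h0 hM, (div_lt_one hM).2 hx.2.1⟩

theorem hasFDerivAt_sphFun (ε : ℝ) (ν x : EuclideanSpace ℝ (Fin n)) :
    HasFDerivAt (sphFun ε ν) (innerSL ℝ ν + (2 * ε) • innerSL ℝ x) x := by
  have h := ((innerSL ℝ ν).hasFDerivAt (x := x)).add
    ((hasStrictFDerivAt_norm_sq x).hasFDerivAt.const_mul ε)
  refine h.congr_fderiv ?_
  ext v
  simp
  ring

theorem hasFDerivAt_sphDen (ε : ℝ) (ν x : EuclideanSpace ℝ (Fin n)) :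
    HasFDerivAt (sphDen ε ν) ((2 * ε) • innerSL ℝ ν + (2 * ε ^ 2) • innerSL ℝ x) x := by
  have h := (((innerSL ℝ ν).hasFDerivAt (x := x)).const_mul (2 * ε)).const_add 1 |>.add
    ((hasStrictFDerivAt_norm_sq x).hasFDerivAt.const_mul (ε ^ 2))
  refine h.congr_fderiv ?_
  ext v
  simp
  ring

theorem hasDerivAt_radLog (m : ℕ) {M δ r : ℝ} (hr : r / M ∈ Ioo (0 : ℝ) 1) :
    HasDerivAt (radLog n m M δ) ((-(logSum m (r / M) ^ 2
      + ∑ i ∈ Finset.range m, logProd (i + 1) (r / M) ^ 2) / 4 - δ * r) / r) r := by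
  have hr0 : r ≠ 0 := by rintro rfl; simp at hr
  have hM0 : M ≠ 0 := by rintro rfl; simp at hr
  have h := (((hasDerivAt_logSum m hr).comp r ((hasDerivAt_id r).div_const M)).div_const 2).const_sub
    (-(n : ℝ) / 2) |>.sub ((hasDerivAt_id r).const_mul δ)
  refine h.congr_deriv ?_
  field_simp
  ring

/-- The derivative of `coefX`. -/
noncomputable def coefXDeriv (n m : ℕ) (M δ ε : ℝ) (ν x : EuclideanSpace ℝ (Fin n)) :
    EuclideanSpace ℝ (Fin n) →L[ℝ] ℝ :=
  (-(2 * ε) / sphFun ε ν x ^ 2) • (innerSL ℝ ν + (2 * ε) • innerSL ℝ x)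
    + (n * ε ^ 2 / sphDen ε ν x ^ 2) • ((2 * ε) • innerSL ℝ ν + (2 * ε ^ 2) • innerSL ℝ x)
    + ((-(logSum m (‖x‖ / M) ^ 2 + ∑ i ∈ Finset.range m, logProd (i + 1) (‖x‖ / M) ^ 2) / 4
        - δ * ‖x‖ - 2 * radLog n m M δ ‖x‖) / ‖x‖ ^ 4) • innerSL ℝ x

/-- The derivative of `coefNu`. -/
noncomputable def coefNuDeriv (ε : ℝ) (ν x : EuclideanSpace ℝ (Fin n)) :
    EuclideanSpace ℝ (Fin n) →L[ℝ] ℝ :=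
  (-1 / sphFun ε ν x ^ 2) • (innerSL ℝ ν + (2 * ε) • innerSL ℝ x)
    + (n * ε / sphDen ε ν x ^ 2) • ((2 * ε) • innerSL ℝ ν + (2 * ε ^ 2) • innerSL ℝ x)

theorem hasFDerivAt_const_div {c : ℝ} {f : EuclideanSpace ℝ (Fin n) → ℝ}
    {f' : EuclideanSpace ℝ (Fin n) →L[ℝ] ℝ} {x : EuclideanSpace ℝ (Fin n)}
    (hf : HasFDerivAt f f' x) (h0 : f x ≠ 0) :
    HasFDerivAt (fun x => c / f x) ((-c / f x ^ 2) • f') x := by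
  have h := ((hasDerivAt_inv h0).const_mul c).comp_hasFDerivAt x hf
  simp only [div_eq_mul_inv]
  refine h.congr_fderiv ?_
  congr 1
  ring

theorem hasFDerivAt_coefX (m : ℕ) {M δ ε : ℝ} {ν x : EuclideanSpace ℝ (Fin n)}
    (hx : x ∈ goodSet M ε ν) :
    HasFDerivAt (coefX n m M δ ε ν) (coefXDeriv n m M δ ε ν x) x := by
  have hr := norm_pos_iff.2 hx.1
  have h3 : HasDerivAt (fun r => radLog n m M δ r / r ^ 2) _ ‖x‖ :=
    (hasDerivAt_radLog m (goodSet_div_mem hx)).div (hasDerivAt_pow 2 ‖x‖) (by positivity)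
  have h := ((hasFDerivAt_const_div (c := 2 * ε) (hasFDerivAt_sphFun ε ν x) hx.2.2.1.ne').sub
    (hasFDerivAt_const_div (c := n * ε ^ 2) (hasFDerivAt_sphDen ε ν x) hx.2.2.2.ne')).add
    (hasFDerivAt_comp_norm hx.1 h3)
  refine h.congr_fderiv ?_
  unfold coefXDeriv
  rw [sub_eq_add_neg, ← neg_smul]
  congr 2
  · congr 1
    ring
  · field_simp
    ring

theorem hasFDerivAt_coefNu {M ε : ℝ} {ν x : EuclideanSpace ℝ (Fin n)}
    (hx : x ∈ goodSet M ε ν) :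
    HasFDerivAt (coefNu ε ν) (coefNuDeriv ε ν x) x := by
  have h := ((hasFDerivAt_const_div (c := 1) (hasFDerivAt_sphFun ε ν x) hx.2.2.1.ne').sub
    (hasFDerivAt_const_div (c := n * ε) (hasFDerivAt_sphDen ε ν x) hx.2.2.2.ne'))
  refine h.congr_fderiv ?_
  unfold coefNuDeriv
  rw [sub_eq_add_neg, ← neg_smul]
  congr 2
  ring

theorem continuous_sphFun (ε : ℝ) (ν : EuclideanSpace ℝ (Fin n)) : Continuous (sphFun ε ν) := by
  unfold sphFun; fun_prop

theorem continuous_sphDen (ε : ℝ) (ν : EuclideanSpace ℝ (Fin n)) : Continuous (sphDen ε ν) := by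
  unfold sphDen; fun_prop

theorem continuousOn_comp_norm_div {g : ℝ → ℝ} (hg : ContinuousOn g (Ioo 0 1)) (M ε : ℝ)
    (ν : EuclideanSpace ℝ (Fin n)) : ContinuousOn (fun x => g (‖x‖ / M)) (goodSet M ε ν) :=
  hg.comp (by fun_prop) fun _ hx => goodSet_div_mem hx

theorem continuousOn_radLog (m : ℕ) (M δ ε : ℝ) (ν : EuclideanSpace ℝ (Fin n)) :
    ContinuousOn (fun x => radLog n m M δ ‖x‖) (goodSet M ε ν) := by
  have := continuousOn_comp_norm_div (logSum_continuousOn m) M ε ν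
  unfold radLog
  fun_prop

theorem continuousOn_coefXDeriv (m : ℕ) (M δ ε : ℝ) (ν : EuclideanSpace ℝ (Fin n)) :
    ContinuousOn (coefXDeriv n m M δ ε ν) (goodSet M ε ν) := by
  have h1 := continuousOn_comp_norm_div (logSum_continuousOn m) M ε ν
  have h2 := fun i => continuousOn_comp_norm_div (logProd_continuousOn i) M ε ν
  have h3 := continuousOn_radLog m M δ ε ν
  have h4 := (continuous_sphFun ε ν).continuousOn (s := goodSet M ε ν)
  have h5 := (continuous_sphDen ε ν).continuousOn (s := goodSet M ε ν)
  have h6 : ContinuousOn (fun x : EuclideanSpace ℝ (Fin n) => innerSL ℝ x) (goodSet M ε ν) :=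
    (innerSL ℝ).continuous.continuousOn
  unfold coefXDeriv
  refine ((ContinuousOn.smul (continuousOn_const.div (h4.pow 2) fun x hx => ?_) (by fun_prop)).add
    (ContinuousOn.smul (continuousOn_const.div (h5.pow 2) fun x hx => ?_) (by fun_prop))).add
    (ContinuousOn.smul (ContinuousOn.div ?_ (continuous_norm.continuousOn.pow 4) fun x hx => ?_) h6)
  · exact pow_ne_zero _ hx.2.2.1.ne'
  · exact pow_ne_zero _ hx.2.2.2.ne'
  · fun_prop
  · exact pow_ne_zero _ (norm_ne_zero_iff.2 hx.1)

theorem continuousOn_coefNuDeriv (M ε : ℝ) (ν : EuclideanSpace ℝ (Fin n)) :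
    ContinuousOn (coefNuDeriv ε ν) (goodSet M ε ν) := by
  have h4 := (continuous_sphFun ε ν).continuousOn (s := goodSet M ε ν)
  have h5 := (continuous_sphDen ε ν).continuousOn (s := goodSet M ε ν)
  have h6 : ContinuousOn (fun x : EuclideanSpace ℝ (Fin n) => innerSL ℝ x) (goodSet M ε ν) :=
    (innerSL ℝ).continuous.continuousOn
  unfold coefNuDeriv
  refine ((ContinuousOn.smul (continuousOn_const.div (h4.pow 2) fun x hx => ?_) (by fun_prop)).add
    (ContinuousOn.smul (continuousOn_const.div (h5.pow 2) fun x hx => ?_) (by fun_prop)))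
  · exact pow_ne_zero _ hx.2.2.1.ne'
  · exact pow_ne_zero _ hx.2.2.2.ne'

theorem continuousOn_coefX (m : ℕ) (M δ ε : ℝ) (ν : EuclideanSpace ℝ (Fin n)) :
    ContinuousOn (coefX n m M δ ε ν) (goodSet M ε ν) := fun _ hx =>
  (hasFDerivAt_coefX m hx).continuousAt.continuousWithinAt

theorem continuousOn_coefNu (M ε : ℝ) (ν : EuclideanSpace ℝ (Fin n)) :
    ContinuousOn (coefNu ε ν) (goodSet M ε ν) := fun _ hx =>
  (hasFDerivAt_coefNu hx).continuousAt.continuousWithinAt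

theorem continuousOn_logGrad (m : ℕ) (M δ ε : ℝ) (ν : EuclideanSpace ℝ (Fin n)) :
    ContinuousOn (logGrad m M δ ε ν) (goodSet M ε ν) :=
  ((continuousOn_coefX m M δ ε ν).smul continuousOn_id).add
    ((continuousOn_coefNu M ε ν).smul continuousOn_const)

theorem norm_add_smul_sq {a b : ℝ} {ν x : EuclideanSpace ℝ (Fin n)} (hν : ‖ν‖ = 1) :
    ‖a • x + b • ν‖ ^ 2 = a ^ 2 * ‖x‖ ^ 2 + 2 * a * b * inner ℝ ν x + b ^ 2 := by
  rw [norm_add_sq_real, norm_smul, norm_smul, mul_pow, mul_pow, hν, Real.norm_eq_abs,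
    Real.norm_eq_abs, sq_abs, sq_abs, inner_smul_left, inner_smul_right, real_inner_comm]
  simp
  ring

/-- The Riccati form of the equation `-Δφ = (groundPotential) φ`. -/
theorem divergence_logGrad (m : ℕ) {M δ ε : ℝ} {ν x : EuclideanSpace ℝ (Fin n)} (hν : ‖ν‖ = 1)
    (hx : x ∈ goodSet M ε ν) :
    n * coefX n m M δ ε ν x + coefXDeriv n m M δ ε ν x x + coefNuDeriv ε ν x ν
      + ‖logGrad m M δ ε ν x‖ ^ 2 = -groundPotential m M δ ε ν x := by
  have hr := norm_ne_zero_iff.2 hx.1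
  have hP := hx.2.2.1.ne'
  have hN := hx.2.2.2.ne'
  unfold logGrad
  rw [norm_add_smul_sq hν]
  simp only [coefXDeriv, coefNuDeriv, groundPotential, coefX, coefNu, add_apply,
    smul_apply, innerSL_apply_apply, real_inner_self_eq_norm_sq, hν, smul_eq_mul]
  rw [real_inner_comm ν x]
  have e1 : sphFun ε ν x = inner ℝ ν x + ε * ‖x‖ ^ 2 := rfl
  have e2 : sphDen ε ν x = 1 + 2 * ε * inner ℝ ν x + ε ^ 2 * ‖x‖ ^ 2 := rfl
  have e3 : radLog n m M δ ‖x‖ = -(n : ℝ) / 2 - logSum m (‖x‖ / M) / 2 - δ * ‖x‖ := rfl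
  generalize sphFun ε ν x = P at *
  generalize sphDen ε ν x = N at *
  generalize radLog n m M δ ‖x‖ = l at *
  generalize logSum m (‖x‖ / M) = S at *
  generalize ∑ i ∈ Finset.range m, logProd (i + 1) (‖x‖ / M) ^ 2 = Q at *
  generalize (inner ℝ ν x : ℝ) = y at *
  generalize ‖x‖ = r at *
  -- Of the quantities involved only `P`, `l`, `Q`, `r` are independent: `S`, `y`, `N` are
  -- eliminated through their definitions, after which the claim is an identity of rational
  -- functions.
  have e4 : S = -2 * l - n - 2 * δ * r := by rw [e3]; ring
  have e5 : y = P - ε * r ^ 2 := by rw [e1]; ring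
  have e6 : N = 1 + 2 * ε * P - ε ^ 2 * r ^ 2 := by rw [e2, e5]; ring
  clear e1 e2 e3
  subst e4 e5 e6
  field_simp
  ring

end GroundState


/-! ### The ground state representation of the Dirichlet integral -/

section GroundStateIdentity

variable {n : ℕ}

/-- `φ ∇(u/φ) = ∇u - u ∇φ/φ` for the ground state `φ`. -/
noncomputable def groundGrad (m : ℕ) (M δ ε : ℝ) (ν : EuclideanSpace ℝ (Fin n))
    (u : EuclideanSpace ℝ (Fin n) → ℝ) (x : EuclideanSpace ℝ (Fin n)) :
    EuclideanSpace ℝ (Fin n) :=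
  ∇ u x - u x • logGrad m M δ ε ν x

theorem inner_gradient (u : EuclideanSpace ℝ (Fin n) → ℝ) (x v : EuclideanSpace ℝ (Fin n)) :
    inner ℝ (∇ u x) v = fderiv ℝ u x v := by
  rw [gradient, InnerProductSpace.toDual_symm_apply]

theorem gradient_eq_zero_of_notMem_tsupport {u : EuclideanSpace ℝ (Fin n) → ℝ}
    {x : EuclideanSpace ℝ (Fin n)} (hx : x ∉ tsupport u) : ∇ u x = 0 := by
  have : fderiv ℝ u x = 0 := by
    by_contra h
    exact hx (support_fderiv_subset ℝ h)
  rw [gradient, this, map_zero]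

theorem continuous_gradient {u : EuclideanSpace ℝ (Fin n) → ℝ} (hu : ContDiff ℝ 1 u) :
    Continuous (∇ u) :=
  (InnerProductSpace.toDual ℝ _).symm.continuous.comp (hu.continuous_fderiv one_ne_zero)

theorem groundGrad_eq_zero (m : ℕ) (M δ ε : ℝ) (ν : EuclideanSpace ℝ (Fin n))
    {u : EuclideanSpace ℝ (Fin n) → ℝ}
    {x : EuclideanSpace ℝ (Fin n)} (hx : x ∉ tsupport u) : groundGrad m M δ ε ν u x = 0 := by
  rw [groundGrad, gradient_eq_zero_of_notMem_tsupport hx, image_eq_zero_of_notMem_tsupport hx,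
    zero_smul, sub_zero]

theorem continuousOn_groundGrad (m : ℕ) (M δ ε : ℝ) (ν : EuclideanSpace ℝ (Fin n))
    {u : EuclideanSpace ℝ (Fin n) → ℝ} (hu : ContDiff ℝ 1 u) :
    ContinuousOn (groundGrad m M δ ε ν u) (goodSet M ε ν) :=
  (continuous_gradient hu).continuousOn.sub
    (hu.continuous.continuousOn.smul (continuousOn_logGrad m M δ ε ν))

theorem continuousOn_groundPotential (m : ℕ) (M δ ε : ℝ) (ν : EuclideanSpace ℝ (Fin n)) :
    ContinuousOn (groundPotential m M δ ε ν) (goodSet M ε ν) := by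
  have h1 := continuousOn_comp_norm_div (logSum_continuousOn m) M ε ν
  have h2 := fun i => continuousOn_comp_norm_div (logProd_continuousOn i) M ε ν
  have h3 := continuousOn_radLog m M δ ε ν
  have h4 := (continuous_sphFun ε ν).continuousOn (s := goodSet M ε ν)
  have h5 := (continuous_sphDen ε ν).continuousOn (s := goodSet M ε ν)
  unfold groundPotential
  refine ContinuousOn.div (ContinuousOn.sub (by fun_prop) (ContinuousOn.mul (by fun_prop)
    (ContinuousOn.sub (ContinuousOn.div (by fun_prop) h4 fun x hx => ?_)
    (ContinuousOn.div (by fun_prop) h5 fun x hx => ?_)))) (by fun_prop) fun x hx => ?_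
  · exact hx.2.2.1.ne'
  · exact hx.2.2.2.ne'
  · exact pow_ne_zero _ (norm_ne_zero_iff.2 hx.1)

/-- With `L = ∇φ/φ`, expanding `|∇u - uL|²` leaves the cross term `-⟨∇(u²), L⟩`. Integrating it by
parts turns it into `u² div L`, and `div L + |L|²` is minus the potential by `divergence_logGrad`.
No positivity of the potential is needed. -/
theorem ground_state_identity (m : ℕ) {M δ ε : ℝ} {ν : EuclideanSpace ℝ (Fin n)} (hν : ‖ν‖ = 1)
    {u : EuclideanSpace ℝ (Fin n) → ℝ} (hu : ContDiff ℝ 1 u) (hc : HasCompactSupport u)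
    (hs : tsupport u ⊆ goodSet M ε ν) :
    Integrable (fun x => ‖groundGrad m M δ ε ν u x‖ ^ 2) ∧
    Integrable (fun x => u x ^ 2 * groundPotential m M δ ε ν x) ∧
    ∫ x, ‖∇ u x‖ ^ 2 = (∫ x, ‖groundGrad m M δ ε ν u x‖ ^ 2)
      + ∫ x, u x ^ 2 * groundPotential m M δ ε ν x := by
  have hu0 : ∀ x ∉ tsupport u, u x = 0 := fun x hx => image_eq_zero_of_notMem_tsupport hx
  have i1 : Integrable (fun x => ‖groundGrad m M δ ε ν u x‖ ^ 2) :=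
    integrable_of_continuousOn_compact hc
      (((continuousOn_groundGrad m M δ ε ν hu).mono hs).norm.pow 2)
      fun x hx => by simp [groundGrad_eq_zero m M δ ε ν hx]
  have i2 : Integrable (fun x => u x ^ 2 * groundPotential m M δ ε ν x) :=
    integrable_of_continuousOn_compact hc
      ((hu.continuous.continuousOn.pow 2).mul
        ((continuousOn_groundPotential m M δ ε ν).mono hs))
      fun x hx => by simp [hu0 x hx]
  refine ⟨i1, i2, ?_⟩
  have hsq : ∀ x, HasFDerivAt (fun x => u x ^ 2) ((2 * u x) • fderiv ℝ u x) x := fun x => by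
    have := (hu.differentiable one_ne_zero x).hasFDerivAt.pow 2
    simpa using this
  have hsub : tsupport (fun x => u x ^ 2) ⊆ tsupport u :=
    closure_mono fun x hx => by
      intro h; exact hx (by simp [h])
  -- The divergence theorem for `u² L`, with `L` split into its `x` and `ν` components.
  have hdiv := integral_divergence_eq_zero ν (hu.pow 2)
    (hc.of_isClosed_subset (isClosed_tsupport _) hsub)
    (fun x hx => hasFDerivAt_coefX (δ := δ) m (hs (hsub hx)))
    ((continuousOn_coefXDeriv m M δ ε ν).mono (hsub.trans hs))
    (fun x hx => hasFDerivAt_coefNu (hs (hsub hx)))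
    ((continuousOn_coefNuDeriv M ε ν).mono (hsub.trans hs))
  have i0 : Integrable (fun x => ‖∇ u x‖ ^ 2) :=
    integrable_of_continuousOn_compact hc ((continuous_gradient hu).norm.pow 2).continuousOn
      fun x hx => by simp [gradient_eq_zero_of_notMem_tsupport hx]
  have i3 : Integrable (fun x => ‖groundGrad m M δ ε ν u x‖ ^ 2
      + u x ^ 2 * groundPotential m M δ ε ν x) := i1.add i2
  rw [← integral_add i1 i2, ← sub_eq_zero, ← integral_sub i0 i3, ← hdiv]
  congr 1
  ext x
  rw [(hsq x).fderiv]
  simp only [smul_apply, smul_eq_mul]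
  by_cases hx : x ∈ tsupport u
  · have h := divergence_logGrad (δ := δ) m hν (hs hx)
    have h1 : ‖groundGrad m M δ ε ν u x‖ ^ 2 = ‖∇ u x‖ ^ 2
        - 2 * (u x * (coefX n m M δ ε ν x * fderiv ℝ u x x + coefNu ε ν x * fderiv ℝ u x ν))
        + u x ^ 2 * ‖logGrad m M δ ε ν x‖ ^ 2 := by
      rw [groundGrad, norm_sub_sq_real, inner_smul_right, inner_gradient, norm_smul, mul_pow,
        Real.norm_eq_abs, sq_abs]
      simp [logGrad]
    rw [h1]
    linear_combination (-u x ^ 2) * h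
  · rw [groundGrad_eq_zero m M δ ε ν hx, gradient_eq_zero_of_notMem_tsupport hx, hu0 x hx]
    simp

end GroundStateIdentity


/-! ### Pointwise bounds for the potential and the logarithmic gradient -/

section PointwiseBounds

variable {n : ℕ}

/-- The part of the ball of radius `D` on the positive side of `sphFun ε ν`, without the origin. -/
def capSet (D ε : ℝ) (ν : EuclideanSpace ℝ (Fin n)) : Set (EuclideanSpace ℝ (Fin n)) :=
  {x | x ≠ 0 ∧ ‖x‖ ≤ D ∧ 0 < sphFun ε ν x}

variable {D M ε : ℝ} {ν x : EuclideanSpace ℝ (Fin n)}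

theorem abs_inner_le_norm_of_unit (hν : ‖ν‖ = 1) (x : EuclideanSpace ℝ (Fin n)) :
    |inner ℝ ν x| ≤ ‖x‖ := by
  simpa [hν] using abs_real_inner_le_norm ν x

/-- The scale-invariant smallness of the curvature of the touching sphere, from which the comparison
of `sphFun` and `sphDen` with the flat case follows. -/
theorem mul_norm_le_of_mem_capSet (hn : 3 ≤ n) (hε : 0 ≤ ε) (hεD : 128 * n ^ 2 * D * ε ≤ 1)
    (hx : x ∈ capSet D ε ν) : ε * ‖x‖ ≤ 1 / 8 := by
  have hn' : (3 : ℝ) ≤ n := by exact_mod_cast hn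
  have h1 : ε * ‖x‖ ≤ ε * D := mul_le_mul_of_nonneg_left hx.2.1 hε
  have hD : 0 ≤ D := (norm_nonneg x).trans hx.2.1
  have h2 : 9 * (D * ε) ≤ (n : ℝ) ^ 2 * (D * ε) := by
    apply mul_le_mul_of_nonneg_right _ (by positivity)
    nlinarith
  nlinarith

theorem half_le_sphDen (hn : 3 ≤ n) (hν : ‖ν‖ = 1) (hε : 0 ≤ ε)
    (hεD : 128 * n ^ 2 * D * ε ≤ 1) (hx : x ∈ capSet D ε ν) : 1 / 2 ≤ sphDen ε ν x := by
  have h1 := mul_norm_le_of_mem_capSet hn hε hεD hx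
  have h2 := (abs_le.1 (abs_inner_le_norm_of_unit hν x)).1
  have h3 : ε * -‖x‖ ≤ ε * inner ℝ ν x := mul_le_mul_of_nonneg_left h2 hε
  unfold sphDen
  nlinarith [sq_nonneg (ε * ‖x‖)]

theorem sphFun_le (hn : 3 ≤ n) (hν : ‖ν‖ = 1) (hε : 0 ≤ ε)
    (hεD : 128 * n ^ 2 * D * ε ≤ 1) (hx : x ∈ capSet D ε ν) : sphFun ε ν x ≤ 2 * ‖x‖ := by
  have h1 := mul_norm_le_of_mem_capSet hn hε hεD hx
  have h2 := (abs_le.1 (abs_inner_le_norm_of_unit hν x)).2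
  unfold sphFun
  nlinarith [norm_nonneg x]

theorem div_mem_of_mem_capSet (hM : kappa * D ≤ M) (hx : x ∈ capSet D ε ν) :
    0 < ‖x‖ / M ∧ ‖x‖ / M ≤ 1 / kappa := by
  have hk := kappa_spec.1
  have h0 := norm_pos_iff.2 hx.1
  have hD : 0 < D := h0.trans_le hx.2.1
  have hM0 : 0 < M := lt_of_lt_of_le (by positivity) hM
  refine ⟨by positivity, ?_⟩
  rw [div_le_div_iff₀ hM0 (by linarith)]
  calc ‖x‖ * kappa ≤ D * kappa := by gcongr; exact hx.2.1
    _ ≤ 1 * M := by linarith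

theorem capSet_subset_goodSet (hn : 3 ≤ n) (hν : ‖ν‖ = 1) (hε : 0 ≤ ε)
    (hεD : 128 * n ^ 2 * D * ε ≤ 1) (hM : kappa * D ≤ M) : capSet D ε ν ⊆ goodSet M ε ν := by
  intro x hx
  have hk := kappa_spec.1
  have h0 := norm_pos_iff.2 hx.1
  refine ⟨hx.1, ?_, hx.2.2, by linarith [half_le_sphDen hn hν hε hεD hx]⟩
  have := hx.2.1
  nlinarith

theorem radLog_bounds (hn : 3 ≤ n) (m : ℕ) (hM : kappa * D ≤ M) (hx : x ∈ capSet D ε ν) :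
    -(n : ℝ) ≤ radLog n m M (1 / (2 * D)) ‖x‖ ∧ radLog n m M (1 / (2 * D)) ‖x‖ ≤ 0 := by
  have hn' : (3 : ℝ) ≤ n := by exact_mod_cast hn
  obtain ⟨h1, h2⟩ := div_mem_of_mem_capSet hM hx
  have h3 := logSum_le_quarter m h1 h2
  have h4 := logSum_nonneg m ⟨h1, h2.trans_lt one_div_kappa_mem.2⟩
  have h0 := norm_pos_iff.2 hx.1
  have hD : 0 < D := h0.trans_le hx.2.1
  have h5 : 1 / (2 * D) * ‖x‖ ≤ 1 / 2 := by
    rw [div_mul_eq_mul_div, div_le_div_iff₀ (by positivity) (by norm_num)]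
    linarith [hx.2.1]
  have h6 : 0 ≤ 1 / (2 * D) * ‖x‖ := by positivity
  unfold radLog
  constructor <;> linarith

theorem sphFun_div_sphDen_le (hn : 3 ≤ n) (hν : ‖ν‖ = 1) (hε : 0 ≤ ε)
    (hεD : 128 * n ^ 2 * D * ε ≤ 1) (hx : x ∈ capSet D ε ν) :
    n * ε * sphFun ε ν x / sphDen ε ν x ≤ 1 / (32 * n * D) * ‖x‖ := by
  have hn' : (3 : ℝ) ≤ n := by exact_mod_cast hn
  have h0 := norm_pos_iff.2 hx.1
  have hD : 0 < D := h0.trans_le hx.2.1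
  have h1 := half_le_sphDen hn hν hε hεD hx
  have h2 := sphFun_le hn hν hε hεD hx
  calc n * ε * sphFun ε ν x / sphDen ε ν x ≤ n * ε * (2 * ‖x‖) / (1 / 2) := by gcongr
    _ = (4 * n * ε) * ‖x‖ := by ring
    _ ≤ 1 / (32 * n * D) * ‖x‖ := by
      gcongr
      rw [le_div_iff₀ (by positivity)]
      nlinarith

/-- With `δ = 1/(2D)` the exponential factor gains `δr(1 - S - δr) ≥ δr/4`, since `S ≤ 1/4` and `δr
≤ 1/2`. Of the two curvature terms, one has a favourable sign because `radLog ≤ 0`; the other costs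
at most `2n · nεP/N ≤ δr/8`. -/
theorem le_groundPotential (hn : 3 ≤ n) (m : ℕ) (hν : ‖ν‖ = 1) (hε : 0 ≤ ε)
    (hεD : 128 * n ^ 2 * D * ε ≤ 1) (hM : kappa * D ≤ M) (hx : x ∈ capSet D ε ν) :
    ((n : ℝ) ^ 2 / 4 + 1 / 4 * ∑ i ∈ Finset.range m, logProd (i + 1) (‖x‖ / M) ^ 2) / ‖x‖ ^ 2
      ≤ groundPotential m M (1 / (2 * D)) ε ν x := by
  have hn' : (3 : ℝ) ≤ n := by exact_mod_cast hn
  have h0 := norm_pos_iff.2 hx.1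
  have hD : 0 < D := h0.trans_le hx.2.1
  obtain ⟨h1, h2⟩ := div_mem_of_mem_capSet hM hx
  have h3 := logSum_le_quarter m h1 h2
  obtain ⟨h4, h5⟩ := radLog_bounds hn m hM hx
  have h6 := sphFun_div_sphDen_le hn hν hε hεD hx
  have h7 : 0 ≤ ε * ‖x‖ ^ 2 / sphFun ε ν x := div_nonneg (by positivity) hx.2.2.le
  have h8 : 0 ≤ n * ε * sphFun ε ν x / sphDen ε ν x :=
    div_nonneg (mul_nonneg (by positivity) hx.2.2.le)
      (by linarith [half_le_sphDen hn hν hε hεD hx])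
  have h9 : 1 / (2 * D) * ‖x‖ ≤ 1 / 2 := by
    rw [div_mul_eq_mul_div, div_le_div_iff₀ (by positivity) (by norm_num)]
    linarith [hx.2.1]
  have h10 : 1 / (32 * n * D) * ‖x‖ * (2 * n) = 1 / 8 * (1 / (2 * D) * ‖x‖) := by
    field_simp; norm_num
  have h11 : 0 ≤ 1 / (2 * D) * ‖x‖ := by positivity
  unfold groundPotential
  gcongr
  generalize 1 / (2 * D) * ‖x‖ = w at *
  generalize n * ε * sphFun ε ν x / sphDen ε ν x = q at *
  generalize ε * ‖x‖ ^ 2 / sphFun ε ν x = q' at *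
  generalize radLog n m M (1 / (2 * D)) ‖x‖ = l at *
  nlinarith [mul_nonneg (neg_nonneg.2 h5) h7, mul_le_mul_of_nonneg_right (neg_le.1 h4) h8]

theorem inner_logGrad (m : ℕ) (M δ ε : ℝ) (ν x v : EuclideanSpace ℝ (Fin n)) :
    inner ℝ (logGrad m M δ ε ν x) v
      = coefX n m M δ ε ν x * inner ℝ x v + coefNu ε ν x * inner ℝ ν v := by
  simp [logGrad, inner_add_left, inner_smul_left]

/-- The Euler derivative of `ln φ` is `1 + εr²/P - nεP/N + r(ln h)'`: a linear zero, curvature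
corrections, and the radial factor. The loss `r/D` is half from the curvature bound and half from
`e^{-δr}`. -/
theorem le_inner_logGrad_self (hn : 3 ≤ n) (m : ℕ) (hν : ‖ν‖ = 1) (hε : 0 ≤ ε)
    (hεD : 128 * n ^ 2 * D * ε ≤ 1) (hx : x ∈ capSet D ε ν) :
    1 - (n : ℝ) / 2 - logSum m (‖x‖ / M) / 2 - ‖x‖ / D
      ≤ inner ℝ (logGrad m M (1 / (2 * D)) ε ν x) x := by
  have hn' : (3 : ℝ) ≤ n := by exact_mod_cast hn
  have h0 := norm_pos_iff.2 hx.1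
  have hD : 0 < D := h0.trans_le hx.2.1
  have hN : 0 < sphDen ε ν x := by linarith [half_le_sphDen hn hν hε hεD hx]
  have h6 := sphFun_div_sphDen_le hn hν hε hεD hx
  have h7 : 0 ≤ ε * ‖x‖ ^ 2 / sphFun ε ν x := div_nonneg (by positivity) hx.2.2.le
  have h8 : 1 / (32 * n * D) * ‖x‖ ≤ 1 / (2 * D) * ‖x‖ := by
    gcongr
    linarith
  have h9 : 1 / (2 * D) * ‖x‖ + 1 / (2 * D) * ‖x‖ = ‖x‖ / D := by field_simp; norm_num
  have key : inner ℝ (logGrad m M (1 / (2 * D)) ε ν x) x = 1 + ε * ‖x‖ ^ 2 / sphFun ε ν x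
      - n * ε * sphFun ε ν x / sphDen ε ν x + radLog n m M (1 / (2 * D)) ‖x‖ := by
    rw [inner_logGrad, real_inner_self_eq_norm_sq]
    unfold coefX coefNu
    have e1 : (inner ℝ ν x : ℝ) = sphFun ε ν x - ε * ‖x‖ ^ 2 := by unfold sphFun; ring
    rw [e1]
    have := hx.2.2.ne'
    field_simp
    ring
  rw [key]
  unfold radLog
  linarith

theorem div_sphDen_le (hn : 3 ≤ n) (hν : ‖ν‖ = 1) (hε : 0 ≤ ε)
    (hεD : 128 * n ^ 2 * D * ε ≤ 1) (hx : x ∈ capSet D ε ν) :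
    n * (ε ^ 2 * ‖x‖ + ε) / sphDen ε ν x ≤ 1 / ‖x‖ := by
  have hn' : (3 : ℝ) ≤ n := by exact_mod_cast hn
  have h0 := norm_pos_iff.2 hx.1
  have h1 := half_le_sphDen hn hν hε hεD hx
  have h2 := mul_norm_le_of_mem_capSet hn hε hεD hx
  have h3 : (n : ℝ) ^ 2 * ‖x‖ * ε ≤ (n : ℝ) ^ 2 * D * ε := by
    gcongr; exact hx.2.1
  have h4 : (n : ℝ) * (‖x‖ * ε) ≤ (n : ℝ) ^ 2 * (‖x‖ * ε) := by
    apply mul_le_mul_of_nonneg_right _ (by positivity)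
    nlinarith
  rw [div_le_div_iff₀ (by linarith) h0]
  have h5 : n * (ε ^ 2 * ‖x‖ + ε) * ‖x‖ = n * (‖x‖ * ε) * (ε * ‖x‖ + 1) := by ring
  rw [h5]
  have h6 : n * (‖x‖ * ε) ≤ 1 / 8 := by nlinarith
  nlinarith [mul_nonneg hε h0.le]

/-- Moving in direction `ν` leaves the touching sphere, so `ln φ` increases at rate about `1/P`;
everything else is `O(1/|x|)`. This is the positivity behind the Hardy inequality in direction `ν`.
-/
theorem le_inner_logGrad_nu (hn : 3 ≤ n) (m : ℕ) (hν : ‖ν‖ = 1) (hε : 0 ≤ ε)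
    (hεD : 128 * n ^ 2 * D * ε ≤ 1) (hM : kappa * D ≤ M) (hx : x ∈ capSet D ε ν) :
    1 / (2 * sphFun ε ν x) - (n + 1) / ‖x‖ ≤ inner ℝ (logGrad m M (1 / (2 * D)) ε ν x) ν := by
  have hn' : (3 : ℝ) ≤ n := by exact_mod_cast hn
  have h0 := norm_pos_iff.2 hx.1
  have hP := hx.2.2
  have hN : 0 < sphDen ε ν x := by linarith [half_le_sphDen hn hν hε hεD hx]
  have h1 := div_sphDen_le hn hν hε hεD hx
  have h2 := mul_norm_le_of_mem_capSet hn hε hεD hx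
  obtain ⟨h3, h3'⟩ := abs_le.1 (abs_inner_le_norm_of_unit hν x)
  obtain ⟨h4, h5⟩ := radLog_bounds hn m hM hx
  have key : inner ℝ (logGrad m M (1 / (2 * D)) ε ν x) ν = (1 + 2 * (ε * inner ℝ ν x)) / sphFun ε ν x
      - n * (ε ^ 2 * inner ℝ ν x + ε) / sphDen ε ν x
      + radLog n m M (1 / (2 * D)) ‖x‖ * inner ℝ ν x / ‖x‖ ^ 2 := by
    rw [inner_logGrad, real_inner_self_eq_norm_sq, hν, real_inner_comm]
    unfold coefX coefNu
    ring
  have e1 : 1 / (2 * sphFun ε ν x) ≤ (1 + 2 * (ε * inner ℝ ν x)) / sphFun ε ν x := by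
    rw [div_le_div_iff₀ (by positivity) hP]
    have : ε * -‖x‖ ≤ ε * inner ℝ ν x := mul_le_mul_of_nonneg_left h3 hε
    nlinarith
  have e2 : n * (ε ^ 2 * inner ℝ ν x + ε) / sphDen ε ν x ≤ 1 / ‖x‖ := le_trans (by gcongr) h1
  have e3 : -(n : ℝ) / ‖x‖ ≤ radLog n m M (1 / (2 * D)) ‖x‖ * inner ℝ ν x / ‖x‖ ^ 2 := by
    rw [div_le_div_iff₀ h0 (by positivity)]
    have : -(n : ℝ) * ‖x‖ ≤ radLog n m M (1 / (2 * D)) ‖x‖ * inner ℝ ν x := by nlinarith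
    nlinarith
  have e4 : ((n : ℝ) + 1) / ‖x‖ = 1 / ‖x‖ - -(n : ℝ) / ‖x‖ := by ring
  rw [key, e4]
  linarith

/-- Complements the two lower bounds: the singularities of `∇φ/φ` are no worse than `1/P` and
`1/|x|`, and each of these is handled by its own Hardy inequality. -/
theorem norm_logGrad_le (hn : 3 ≤ n) (m : ℕ) (hν : ‖ν‖ = 1) (hε : 0 ≤ ε)
    (hεD : 128 * n ^ 2 * D * ε ≤ 1) (hM : kappa * D ≤ M) (hx : x ∈ capSet D ε ν) :
    ‖logGrad m M (1 / (2 * D)) ε ν x‖ ≤ 2 / sphFun ε ν x + (n + 1) / ‖x‖ := by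
  have hn' : (3 : ℝ) ≤ n := by exact_mod_cast hn
  have h0 := norm_pos_iff.2 hx.1
  have hP := hx.2.2
  have hN : 0 < sphDen ε ν x := by linarith [half_le_sphDen hn hν hε hεD hx]
  have h1 := div_sphDen_le hn hν hε hεD hx
  have h2 := mul_norm_le_of_mem_capSet hn hε hεD hx
  obtain ⟨h4, h5⟩ := radLog_bounds hn m hM hx
  have key : logGrad m M (1 / (2 * D)) ε ν x = (1 / sphFun ε ν x) • (ν + (2 * ε) • x)
      - (n / sphDen ε ν x) • (ε ^ 2 • x + ε • ν)
      + (radLog n m M (1 / (2 * D)) ‖x‖ / ‖x‖ ^ 2) • x := by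
    unfold logGrad coefX coefNu
    module
  have e1 : ‖(1 / sphFun ε ν x) • (ν + (2 * ε) • x)‖ ≤ 2 / sphFun ε ν x := by
    rw [norm_smul, Real.norm_of_nonneg (by positivity), div_mul_eq_mul_div, one_mul]
    gcongr
    refine (norm_add_le _ _).trans ?_
    rw [norm_smul, Real.norm_of_nonneg (by positivity), hν]
    linarith
  have e2 : ‖(n / sphDen ε ν x) • (ε ^ 2 • x + ε • ν)‖ ≤ 1 / ‖x‖ := by
    refine le_trans ?_ h1
    rw [norm_smul, Real.norm_of_nonneg (by positivity), div_mul_eq_mul_div]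
    gcongr
    refine (norm_add_le _ _).trans ?_
    rw [norm_smul, norm_smul, Real.norm_of_nonneg (by positivity), Real.norm_of_nonneg hε, hν,
      mul_one]
  have e3 : ‖(radLog n m M (1 / (2 * D)) ‖x‖ / ‖x‖ ^ 2) • x‖ ≤ n / ‖x‖ := by
    rw [norm_smul, norm_div, Real.norm_eq_abs, abs_of_nonpos h5, norm_pow, norm_norm,
      div_mul_eq_mul_div, div_le_div_iff₀ (by positivity) h0]
    nlinarith [mul_pos h0 h0]
  rw [key]
  refine (norm_add_le _ _).trans ?_
  have := norm_sub_le ((1 / sphFun ε ν x) • (ν + (2 * ε) • x))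
    ((n / sphDen ε ν x) • (ε ^ 2 • x + ε • ν))
  have e4 : ((n : ℝ) + 1) / ‖x‖ = 1 / ‖x‖ + n / ‖x‖ := by ring
  linarith

end PointwiseBounds


/-! ### Weighted L¹ Hardy inequalities relative to the ground state -/

section WeightedHardy

variable {n : ℕ}

theorem hasFDerivAt_abs_rpow {u : EuclideanSpace ℝ (Fin n) → ℝ} (hu : ContDiff ℝ 1 u) {θ : ℝ}
    (hθ : 1 < θ) (x : EuclideanSpace ℝ (Fin n)) :
    HasFDerivAt (fun x => |u x| ^ θ) ((θ * |u x| ^ (θ - 2) * u x) • fderiv ℝ u x) x :=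
  (hasDerivAt_abs_rpow (u x) hθ).comp_hasFDerivAt x (hu.differentiable one_ne_zero x).hasFDerivAt

theorem contDiff_abs_rpow {u : EuclideanSpace ℝ (Fin n) → ℝ} (hu : ContDiff ℝ 1 u) {θ : ℝ}
    (hθ : 1 < θ) : ContDiff ℝ 1 (fun x => |u x| ^ θ) := hu.norm_rpow hθ

theorem tsupport_abs_rpow_subset {u : EuclideanSpace ℝ (Fin n) → ℝ} {θ : ℝ} (hθ : θ ≠ 0) :
    tsupport (fun x => |u x| ^ θ) ⊆ tsupport u :=
  closure_mono fun x hx h => hx (by simp [h, hθ])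

/-- Writing `∇u = u∇φ/φ + (∇u - u∇φ/φ)` splits `∇|u|^θ` into `θ|u|^θ ∇φ/φ` and a remainder carried
by `groundGrad`. The condition `θ > 1` makes both sides vanish at zeros of `u`. -/
theorem abs_fderiv_abs_rpow_sub_le {u : EuclideanSpace ℝ (Fin n) → ℝ} (hu : ContDiff ℝ 1 u) {θ : ℝ}
    (hθ : 1 < θ) (m : ℕ) (M δ ε : ℝ) (ν x v : EuclideanSpace ℝ (Fin n)) :
    |fderiv ℝ (fun x => |u x| ^ θ) x v - θ * |u x| ^ θ * inner ℝ (logGrad m M δ ε ν x) v|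
      ≤ θ * (|u x| ^ (θ - 1) * ‖groundGrad m M δ ε ν u x‖) * ‖v‖ := by
  rw [(hasFDerivAt_abs_rpow hu hθ x).fderiv]
  simp only [smul_apply, smul_eq_mul]
  rcases eq_or_ne (u x) 0 with h0 | h0
  · have h1 : θ ≠ 0 := by linarith
    have h2 : θ - 1 ≠ 0 := by linarith
    simp [h0, h1, h2]
  · have hp : 0 < |u x| := abs_pos.2 h0
    have e1 : |u x| ^ θ = |u x| ^ (θ - 2) * u x * u x := by
      rw [mul_assoc, ← abs_mul_abs_self (u x), ← pow_two, ← Real.rpow_natCast,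
        ← Real.rpow_add hp]
      norm_num
    have e2 : |u x| ^ (θ - 1) = |u x| ^ (θ - 2) * |u x| := by
      rw [← Real.rpow_add_one hp.ne']
      ring_nf
    have e3 : inner ℝ (groundGrad m M δ ε ν u x) v
        = fderiv ℝ u x v - u x * inner ℝ (logGrad m M δ ε ν x) v := by
      rw [groundGrad, inner_sub_left, inner_gradient, inner_smul_left]
      simp
    have e4 : θ * |u x| ^ (θ - 2) * u x * fderiv ℝ u x v
        - θ * |u x| ^ θ * inner ℝ (logGrad m M δ ε ν x) v
        = θ * |u x| ^ (θ - 2) * u x * inner ℝ (groundGrad m M δ ε ν u x) v := by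
      rw [e1, e3]; ring
    rw [e4, abs_mul, abs_mul, abs_of_nonneg (show 0 ≤ θ * |u x| ^ (θ - 2) by positivity), e2]
    calc θ * |u x| ^ (θ - 2) * |u x| * |inner ℝ (groundGrad m M δ ε ν u x) v|
        ≤ θ * |u x| ^ (θ - 2) * |u x| * (‖groundGrad m M δ ε ν u x‖ * ‖v‖) := by
          gcongr; exact abs_real_inner_le_norm _ _
      _ = _ := by ring

theorem integrable_mul_of_continuousOn {u : EuclideanSpace ℝ (Fin n) → ℝ} (hu : ContDiff ℝ 1 u)
    (hc : HasCompactSupport u) {θ : ℝ} (hθ : 0 < θ) {g : EuclideanSpace ℝ (Fin n) → ℝ}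
    (hg : ContinuousOn g (tsupport u)) : Integrable (fun x => |u x| ^ θ * g x) :=
  integrable_of_continuousOn_compact hc
    ((hu.continuous.continuousOn.abs.rpow_const fun _ _ => Or.inr hθ.le).mul hg)
    fun x hx => by simp [image_eq_zero_of_notMem_tsupport hx, hθ.ne']

theorem integrable_groundGrad_mul (m : ℕ) {M δ ε : ℝ} {ν : EuclideanSpace ℝ (Fin n)}
    {u : EuclideanSpace ℝ (Fin n) → ℝ} (hu : ContDiff ℝ 1 u)
    (hc : HasCompactSupport u) (hs : tsupport u ⊆ goodSet M ε ν) {θ : ℝ} (hθ : 1 < θ)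
    {g : EuclideanSpace ℝ (Fin n) → ℝ} (hg : ContinuousOn g (tsupport u)) :
    Integrable (fun x => |u x| ^ (θ - 1) * ‖groundGrad m M δ ε ν u x‖ * g x) := by
  have h : 0 < θ - 1 := by linarith
  simp only [mul_assoc]
  exact integrable_mul_of_continuousOn hu hc h
    (((continuousOn_groundGrad m M δ ε ν hu).mono hs).norm.mul hg)

/-- The divergence theorem for `|u|^θ (a x + b ν)`, in terms of `∇u - u ∇φ/φ`. -/
theorem integral_divergence_le (m : ℕ) {M δ ε : ℝ} {ν : EuclideanSpace ℝ (Fin n)}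
    {u : EuclideanSpace ℝ (Fin n) → ℝ} (hu : ContDiff ℝ 1 u)
    (hc : HasCompactSupport u) (hs : tsupport u ⊆ goodSet M ε ν) {θ : ℝ} (hθ : 1 < θ)
    {a b : EuclideanSpace ℝ (Fin n) → ℝ}
    {a' b' : EuclideanSpace ℝ (Fin n) → EuclideanSpace ℝ (Fin n) →L[ℝ] ℝ}
    (ha : ∀ x ∈ tsupport u, HasFDerivAt a (a' x) x) (ha' : ContinuousOn a' (tsupport u))
    (hb : ∀ x ∈ tsupport u, HasFDerivAt b (b' x) x) (hb' : ContinuousOn b' (tsupport u)) :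
    ∫ x, |u x| ^ θ * (n * a x + a' x x + b' x ν
        + θ * inner ℝ (logGrad m M δ ε ν x) (a x • x + b x • ν))
      ≤ θ * ∫ x, |u x| ^ (θ - 1) * ‖groundGrad m M δ ε ν u x‖ * ‖a x • x + b x • ν‖ := by
  have hsub := tsupport_abs_rpow_subset (u := u) (θ := θ) (by linarith)
  have hac : ContinuousOn a (tsupport u) := fun x hx => (ha x hx).continuousAt.continuousWithinAt
  have hbc : ContinuousOn b (tsupport u) := fun x hx => (hb x hx).continuousAt.continuousWithinAt
  have hY : ContinuousOn (fun x => a x • x + b x • ν) (tsupport u) :=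
    (hac.smul continuousOn_id).add (hbc.smul continuousOn_const)
  have hF := contDiff_abs_rpow hu hθ
  have hdiv := integral_divergence_eq_zero ν hF
    (hc.of_isClosed_subset (isClosed_tsupport _) hsub)
    (fun x hx => ha x (hsub hx)) (ha'.mono hsub) (fun x hx => hb x (hsub hx)) (hb'.mono hsub)
  have i1 : Integrable (fun x => |u x| ^ θ * (n * a x + a' x x + b' x ν
        + θ * inner ℝ (logGrad m M δ ε ν x) (a x • x + b x • ν))) := by
    refine integrable_mul_of_continuousOn hu hc (by linarith) ?_
    exact (((continuousOn_const.mul hac).add (ha'.clm_apply continuousOn_id)).add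
      (hb'.clm_apply continuousOn_const)).add
      (continuousOn_const.mul (((continuousOn_logGrad m M δ ε ν).mono hs).inner hY))
  have i2 := integrable_groundGrad_mul (δ := δ) m hu hc hs hθ hY.norm
  have i3 : Integrable (fun x => |u x| ^ θ * (n * a x + a' x x + b' x ν)
      + (a x * fderiv ℝ (fun x => |u x| ^ θ) x x + b x * fderiv ℝ (fun x => |u x| ^ θ) x ν)) := by
    refine (integrable_mul_of_continuousOn hu hc (by linarith) ?_).add
      (integrable_of_continuousOn_compact hc ?_ fun x hx => ?_)
    · exact (((continuousOn_const.mul hac).add (ha'.clm_apply continuousOn_id)).add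
        (hb'.clm_apply continuousOn_const))
    · have hd := (hF.continuous_fderiv one_ne_zero).continuousOn (s := tsupport u)
      exact (hac.mul (hd.clm_apply continuousOn_id)).add (hbc.mul (hd.clm_apply continuousOn_const))
    · have : fderiv ℝ (fun x => |u x| ^ θ) x = 0 := by
        by_contra h
        exact hx (hsub (support_fderiv_subset ℝ h))
      simp [this]
  rw [← integral_const_mul, ← sub_nonneg, ← integral_sub (i2.const_mul θ) i1,
    ← neg_eq_zero.2 hdiv, ← integral_neg]
  refine integral_mono i3.neg ((i2.const_mul θ).sub i1) fun x => ?_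
  have h := (abs_le.1 (abs_fderiv_abs_rpow_sub_le hu hθ m M δ ε ν x (a x • x + b x • ν))).1
  simp only [map_add, map_smul, smul_eq_mul] at h
  beta_reduce
  linarith

/-- A test function in the half ball or in the exterior of a large ball touching the origin. -/
structure CapTest (D M ε : ℝ) (ν : EuclideanSpace ℝ (Fin n))
    (u : EuclideanSpace ℝ (Fin n) → ℝ) : Prop where
  hn : 3 ≤ n
  hν : ‖ν‖ = 1
  hε : 0 ≤ ε
  hεD : 128 * n ^ 2 * D * ε ≤ 1
  hD : 0 < D
  hM : kappa * D ≤ M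
  hu : ContDiff ℝ 1 u
  hc : HasCompactSupport u
  hs : tsupport u ⊆ capSet D ε ν

/-- Half of the exponent of the logarithmic weights. -/
noncomputable def logExp (n : ℕ) : ℝ := ((n : ℝ) - 1) / (n - 2)

/-- The upper bound is the case `n = 3`. It ensures that the slow variation exponent `1/4`, raised
to the powers `α` and `α + 1`, stays below what the cutoffs can absorb. -/
theorem logExp_bounds {n : ℕ} (hn : 3 ≤ n) : 1 < logExp n ∧ logExp n ≤ 2 := by
  have hn' : (3 : ℝ) ≤ n := by exact_mod_cast hn
  unfold logExp
  rw [lt_div_iff₀ (by linarith), div_le_iff₀ (by linarith)]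
  constructor <;> linarith

namespace CapTest

variable {D M ε : ℝ} {ν : EuclideanSpace ℝ (Fin n)} {u : EuclideanSpace ℝ (Fin n) → ℝ}

theorem subset_goodSet (h : CapTest D M ε ν u) : tsupport u ⊆ goodSet M ε ν :=
  h.hs.trans (capSet_subset_goodSet h.hn h.hν h.hε h.hεD h.hM)

theorem div_mem (h : CapTest D M ε ν u) {r : ℝ} (hr : r ∈ Ioc 0 D) :
    0 < r / M ∧ r / M ≤ 1 / kappa := by
  have hk := kappa_spec.1
  have hM0 : 0 < M := lt_of_lt_of_le (mul_pos (by linarith) h.hD) h.hM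
  refine ⟨div_pos hr.1 hM0, ?_⟩
  rw [div_le_div_iff₀ hM0 (by linarith)]
  nlinarith [hr.2, h.hM]

theorem div_mem_Ioo (h : CapTest D M ε ν u) {r : ℝ} (hr : r ∈ Ioc 0 D) :
    r / M ∈ Ioo (0 : ℝ) 1 :=
  ⟨(h.div_mem hr).1, (h.div_mem hr).2.trans_lt one_div_kappa_mem.2⟩

theorem norm_mem (h : CapTest D M ε ν u) {x : EuclideanSpace ℝ (Fin n)} (hx : x ∈ tsupport u) :
    ‖x‖ ∈ Ioc 0 D := ⟨norm_pos_iff.2 (h.hs hx).1, (h.hs hx).2.1⟩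

theorem continuousOn_comp_norm (h : CapTest D M ε ν u) {g : ℝ → ℝ}
    (hg : ContinuousOn g (Ioc 0 D)) : ContinuousOn (fun x => g ‖x‖) (tsupport u) :=
  hg.comp continuous_norm.continuousOn fun _ hx => h.norm_mem hx

theorem continuousOn_logProd (h : CapTest D M ε ν u) (k : ℕ) :
    ContinuousOn (fun r => logProd k (r / M)) (Ioc 0 D) :=
  (logProd_continuousOn k).comp (by fun_prop) fun _ hr => h.div_mem_Ioo hr

theorem continuousOn_logSum (h : CapTest D M ε ν u) (k : ℕ) :
    ContinuousOn (fun r => logSum k (r / M)) (Ioc 0 D) :=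
  (logSum_continuousOn k).comp (by fun_prop) fun _ hr => h.div_mem_Ioo hr

theorem continuousOn_logProd_rpow (h : CapTest D M ε ν u) (k : ℕ) (p : ℝ) :
    ContinuousOn (fun r => logProd k (r / M) ^ p) (Ioc 0 D) :=
  (h.continuousOn_logProd k).rpow_const fun _ hr =>
    Or.inl (logProd_pos k (h.div_mem_Ioo hr)).ne'

theorem logProd_pos' (h : CapTest D M ε ν u) (k : ℕ) {r : ℝ} (hr : r ∈ Ioc 0 D) :
    0 < logProd k (r / M) := logProd_pos k (h.div_mem_Ioo hr)

/-- A weighted radial `L¹` Hardy inequality. -/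
theorem radial_hardy (h : CapTest D M ε ν u) (m : ℕ) {ξ ξ' : ℝ → ℝ}
    (hξ : ∀ r ∈ Ioc 0 D, HasDerivAt ξ (ξ' r) r) (hξ' : ContinuousOn ξ' (Ioc 0 D))
    (h0 : ∀ r ∈ Ioc 0 D, 0 ≤ ξ r) (h0' : ∀ r ∈ Ioc 0 D, 0 ≤ ξ' r) :
    ∫ x, |u x| ^ (2 * logExp n) * (logProd (m + 1) (‖x‖ / M) ^ logExp n *
        (logExp n * logProd (m + 1) (‖x‖ / M) * ξ ‖x‖ / ‖x‖ + ξ' ‖x‖)) ≤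
      2 * logExp n * Real.exp 4 * ∫ x, |u x| ^ (2 * logExp n - 1)
        * ‖groundGrad m M (1 / (2 * D)) ε ν u x‖ * (logProd (m + 1) (‖x‖ / M) ^ logExp n * ξ ‖x‖) := by
  have hn' : (3 : ℝ) ≤ n := by exact_mod_cast h.hn
  obtain ⟨hα1, hα2⟩ := logExp_bounds h.hn
  have hαn : logExp n * ((n : ℝ) - 2) = n - 1 := by
    unfold logExp; field_simp [show (n : ℝ) - 2 ≠ 0 by linarith]
  set α := logExp n with hα
  have hD := h.hD
  have hξc : ContinuousOn ξ (Ioc 0 D) := fun r hr => (hξ r hr).continuousAt.continuousWithinAt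
  let η : ℝ → ℝ := fun r => logProd (m + 1) (r / M)
  let S : ℝ → ℝ := fun r => logSum (m + 1) (r / M)
  -- Its logarithmic derivative `4r/D` outweighs the loss `2α r/D` of `le_inner_logGrad_self`,
  -- because `α ≤ 2`; it lies between `1` and `e⁴` on `(0, D]`.
  let E : ℝ → ℝ := fun r => Real.exp (4 * r / D)
  have hη : ∀ r ∈ Ioc 0 D, HasDerivAt η (η r * S r / r) r := by
    intro r hr
    have hM0 : M ≠ 0 := by
      rintro rfl; simpa using (h.div_mem hr).1
    refine ((hasDerivAt_logProd (m + 1) (h.div_mem_Ioo hr)).comp r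
      ((hasDerivAt_id r).div_const M)).congr_deriv ?_
    have := hr.1.ne'
    field_simp
    rfl
  have hηp : ∀ r ∈ Ioc 0 D, 0 < η r := fun r hr => h.logProd_pos' (m + 1) hr
  have hηc : ContinuousOn η (Ioc 0 D) := h.continuousOn_logProd (m + 1)
  have hSc : ContinuousOn S (Ioc 0 D) := h.continuousOn_logSum (m + 1)
  have hEc : Continuous E := by fun_prop
  have hηαc : ContinuousOn (fun r => η r ^ α) (Ioc 0 D) := h.continuousOn_logProd_rpow (m + 1) α
  -- The field is `p(|x|) x`, of length `η^α E ξ`, which is the weight on the right-hand side up to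
  -- the bounded factor `E`.
  let p : ℝ → ℝ := fun r => η r ^ α * E r * ξ r / r
  let p' : ℝ → ℝ := fun r => (η r ^ α * E r * (ξ r * (α * S r + 4 * r / D - 1) / r + ξ' r)) / r
  have hp : ∀ r ∈ Ioc 0 D, HasDerivAt p (p' r) r := by
    intro r hr
    have hr0 := hr.1.ne'
    have hE : HasDerivAt E (E r * (4 / D)) r := by
      have := (((hasDerivAt_id r).const_mul 4).div_const D).exp
      simpa using this
    have h1 := ((((hη r hr).rpow_const (p := α) (Or.inl (hηp r hr).ne')).mul hE).mul (hξ r hr)).div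
      (hasDerivAt_id r) hr0
    refine h1.congr_deriv ?_
    have e1 : η r ^ (α - 1) = η r ^ α / η r := Real.rpow_sub_one (hηp r hr).ne' α
    have e2 := (hηp r hr).ne'
    simp only [Pi.mul_apply, id, e1, p']
    field_simp
    ring
  have hpc : ContinuousOn p' (Ioc 0 D) := by
    refine ContinuousOn.div (ContinuousOn.mul (by fun_prop)
      (ContinuousOn.add (ContinuousOn.div (by fun_prop) continuousOn_id ?_) hξ')) continuousOn_id ?_
    · exact fun r hr => hr.1.ne'
    · exact fun r hr => hr.1.ne'
  have hne : ∀ x ∈ tsupport u, x ≠ 0 := fun x hx => (h.hs hx).1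
  have hdiv := integral_divergence_le (θ := 2 * α) (δ := 1 / (2 * D)) m h.hu h.hc h.subset_goodSet
    (by linarith)
    (fun x hx => hasFDerivAt_comp_norm (hne x hx) (hp ‖x‖ (h.norm_mem hx)))
    (ContinuousOn.smul ((h.continuousOn_comp_norm hpc).div continuous_norm.continuousOn
      fun x hx => norm_ne_zero_iff.2 (hne x hx)) (innerSL ℝ).continuous.continuousOn)
    (b := fun _ => 0) (b' := fun _ => 0) (fun x hx => hasFDerivAt_const _ _) continuousOn_const
  refine le_trans ?_ (hdiv.trans ?_)
  · refine integral_mono ?_ ?_ fun x => ?_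
    · refine integrable_mul_of_continuousOn h.hu h.hc (by linarith) ?_
      refine h.continuousOn_comp_norm (g := fun r => η r ^ α * (α * η r * ξ r / r + ξ' r)) ?_
      refine ContinuousOn.mul (by fun_prop) (ContinuousOn.add (ContinuousOn.div (by fun_prop)
        continuousOn_id fun r hr => hr.1.ne') hξ')
    · refine integrable_mul_of_continuousOn h.hu h.hc (by linarith) ?_
      have c1 : ContinuousOn (fun x : EuclideanSpace ℝ (Fin n) => p ‖x‖) (tsupport u) :=
        h.continuousOn_comp_norm fun r hr => (hp r hr).continuousAt.continuousWithinAt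
      have c2 := (h.continuousOn_comp_norm hpc)
      have c3 := (continuousOn_logGrad m M (1 / (2 * D)) ε ν).mono h.subset_goodSet
      refine ContinuousOn.add (ContinuousOn.add (ContinuousOn.add (continuousOn_const.mul c1) ?_) ?_) ?_
      · simp only [smul_apply, innerSL_apply_apply]
        exact ContinuousOn.smul (c2.div continuous_norm.continuousOn
          fun x hx => norm_ne_zero_iff.2 (hne x hx)) (by fun_prop)
      · simpa using continuousOn_const
      · refine continuousOn_const.mul (c3.inner ?_)
        simp only [zero_smul, add_zero]
        exact c1.smul continuousOn_id
    · beta_reduce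
      by_cases hx : x ∈ tsupport u
      · gcongr
        have hr := h.norm_mem hx
        have hr0 := hr.1
        have hL := le_inner_logGrad_self (M := M) h.hn m h.hν h.hε h.hεD (h.hs hx)
        simp only [zero_smul, add_zero, smul_apply, innerSL_apply_apply,
          real_inner_self_eq_norm_sq, smul_eq_mul, inner_smul_right, zero_apply]
        set r := ‖x‖ with hrdef
        have hE1 : 1 ≤ E r := Real.one_le_exp (by positivity)
        have hS : S r = logSum m (r / M) + η r := logSum_succ m _
        have hpp : p' r / r * r ^ 2 = η r ^ α * E r * (ξ r * (α * S r + 4 * r / D - 1) / r + ξ' r) := by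
          simp only [p']; field_simp
        have hηα : 0 < η r ^ α := Real.rpow_pos_of_pos (hηp r hr) α
        have hξr := h0 r hr
        have hξr' := h0' r hr
        have hηr := hηp r hr
        have hp0 : 0 ≤ p r := by simp only [p]; positivity
        calc η r ^ α * (α * η r * ξ r / r + ξ' r)
            ≤ η r ^ α * E r * (α * η r * ξ r / r + ξ' r) := by
              gcongr
              exact le_mul_of_one_le_right hηα.le hE1
          _ ≤ η r ^ α * E r * (α * η r * ξ r / r + ξ' r)
              + p r * (4 * (r / D) - 2 * α * (r / D)) := by
              have : 0 ≤ 4 * (r / D) - 2 * α * (r / D) := by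
                have : 0 ≤ r / D := by positivity
                nlinarith
              have := mul_nonneg hp0 this
              linarith
          _ = n * p r + η r ^ α * E r * (ξ r * (α * S r + 4 * r / D - 1) / r + ξ' r)
              + 2 * α * (p r * (1 - (n : ℝ) / 2 - logSum m (r / M) / 2 - r / D)) := by
              have e : 2 * α * (1 - (n : ℝ) / 2 - logSum m (r / M) / 2 - r / D)
                = -(α * ((n : ℝ) - 2)) - α * logSum m (r / M) - 2 * α * (r / D) := by ring
              have e' : 2 * α * (p r * (1 - (n : ℝ) / 2 - logSum m (r / M) / 2 - r / D))
                = p r * (-(α * ((n : ℝ) - 2)) - α * logSum m (r / M) - 2 * α * (r / D)) := by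
                rw [← e]; ring
              -- The criticality: `n - 1 - α(n-2) = 0` removes the pure powers of `r`, and
              -- `α(S_{m+1} - S_m)` leaves exactly `αη`.
              rw [e', hαn, hS]
              simp only [p]
              field_simp
              ring
          _ ≤ n * p r + p' r / r * r ^ 2
              + 2 * α * (p r * inner ℝ (logGrad m M (1 / (2 * D)) ε ν x) x) := by
              rw [hpp]
              gcongr
      · have hne0 : 2 * α ≠ 0 := by positivity
        simp [image_eq_zero_of_notMem_tsupport hx, hne0]
  · rw [mul_assoc (2 * α) (Real.exp 4), ← integral_const_mul (Real.exp 4)]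
    refine mul_le_mul_of_nonneg_left ?_ (by positivity)
    refine integral_mono ?_ ((integrable_groundGrad_mul m h.hu h.hc h.subset_goodSet
      (by linarith) (h.continuousOn_comp_norm (g := fun r => η r ^ α * ξ r) (by fun_prop))).const_mul _)
      fun x => ?_
    · refine integrable_groundGrad_mul m h.hu h.hc h.subset_goodSet (by linarith) ?_
      have c1 : ContinuousOn (fun x : EuclideanSpace ℝ (Fin n) => p ‖x‖) (tsupport u) :=
        h.continuousOn_comp_norm fun r hr => (hp r hr).continuousAt.continuousWithinAt
      simp only [zero_smul, add_zero]
      exact (c1.smul continuousOn_id).norm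
    · beta_reduce
      by_cases hx : x ∈ tsupport u
      · have hr := h.norm_mem hx
        have hr0 := hr.1
        have hξr := h0 ‖x‖ hr
        have hηr := hηp ‖x‖ hr
        have hE1 : E ‖x‖ ≤ Real.exp 4 := by
          apply Real.exp_le_exp.2
          rw [div_le_iff₀ hD]
          linarith [hr.2]
        have e1 : ‖p ‖x‖ • x + (0 : ℝ) • ν‖ = η ‖x‖ ^ α * E ‖x‖ * ξ ‖x‖ := by
          rw [zero_smul, add_zero, norm_smul, Real.norm_of_nonneg (by positivity)]
          simp only [p]
          field_simp
        rw [e1]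
        calc |u x| ^ (2 * α - 1) * ‖groundGrad m M (1 / (2 * D)) ε ν u x‖
              * (η ‖x‖ ^ α * E ‖x‖ * ξ ‖x‖)
            ≤ |u x| ^ (2 * α - 1) * ‖groundGrad m M (1 / (2 * D)) ε ν u x‖
              * (η ‖x‖ ^ α * Real.exp 4 * ξ ‖x‖) := by gcongr
          _ = _ := by ring
      · simp [groundGrad_eq_zero m M _ ε ν hx]

end CapTest

end WeightedHardy


/-! ### The L¹ Sobolev inequality and gradients of localized powers -/

section Sobolev

variable {n : ℕ}

/-- The `L¹` Gagliardo–Nirenberg–Sobolev inequality with real integrals. -/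
theorem exists_gagliardo_nirenberg (hn : 3 ≤ n) :
    ∃ C : ℝ, 0 ≤ C ∧ ∀ w : EuclideanSpace ℝ (Fin n) → ℝ, ContDiff ℝ 1 w → HasCompactSupport w →
      ∫ x, |w x| ^ ((n : ℝ) / (n - 1)) ≤ C * (∫ x, ‖fderiv ℝ w x‖) ^ ((n : ℝ) / (n - 1)) := by
  have hn' : (3 : ℝ) ≤ n := by exact_mod_cast hn
  set q : ℝ := (n : ℝ) / (n - 1) with hq
  have hq0 : 0 < q := by rw [hq]; apply div_pos <;> linarith
  have hconj : Real.HolderConjugate (Module.finrank ℝ (EuclideanSpace ℝ (Fin n))) q := by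
    rw [finrank_euclideanSpace_fin, Real.holderConjugate_iff]
    refine ⟨by linarith, ?_⟩
    rw [hq]
    have : (n : ℝ) - 1 ≠ 0 := by linarith
    field_simp
    ring
  refine ⟨lintegralPowLePowLIntegralFDerivConst (volume : Measure (EuclideanSpace ℝ (Fin n))) q,
    NNReal.coe_nonneg _, fun w hw hc => ?_⟩
  have h := lintegral_pow_le_pow_lintegral_fderiv
    (volume : Measure (EuclideanSpace ℝ (Fin n))) hw hc hconj
  have i2 : Integrable (fun x => fderiv ℝ w x) :=
    (hw.continuous_fderiv one_ne_zero).integrable_of_hasCompactSupport (hc.fderiv (𝕜 := ℝ))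
  rw [← ofReal_integral_norm_eq_lintegral_enorm i2] at h
  have e1 : ∫ x, |w x| ^ q = (∫⁻ x, ‖w x‖ₑ ^ q).toReal := by
    rw [integral_eq_lintegral_of_nonneg_ae (Filter.Eventually.of_forall fun x => by positivity)
      ((hw.continuous.abs.rpow_const fun _ => Or.inr hq0.le).aestronglyMeasurable)]
    congr 1
    refine lintegral_congr fun x => ?_
    rw [← ofReal_norm, ENNReal.ofReal_rpow_of_nonneg (norm_nonneg _) hq0.le,
      Real.norm_eq_abs]
  rw [e1]
  refine (ENNReal.toReal_mono ?_ h).trans_eq ?_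
  · exact ENNReal.mul_ne_top ENNReal.coe_ne_top
      (ENNReal.rpow_ne_top_of_nonneg hq0.le ENNReal.ofReal_ne_top)
  · rw [ENNReal.toReal_mul, ← ENNReal.toReal_rpow,
      ENNReal.toReal_ofReal (integral_nonneg fun x => norm_nonneg _)]
    rfl

namespace CapTest

variable {D M ε : ℝ} {ν : EuclideanSpace ℝ (Fin n)} {u : EuclideanSpace ℝ (Fin n) → ℝ}

theorem one_lt_two_mul_logExp (h : CapTest D M ε ν u) : 1 < 2 * logExp n := by
  linarith [(logExp_bounds h.hn).1]

theorem integrable_pow_mul_comp (h : CapTest D M ε ν u) {g : ℝ → ℝ}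
    (hg : ContinuousOn g (Ioc 0 D)) :
    Integrable (fun x => |u x| ^ (2 * logExp n) * g ‖x‖) :=
  integrable_mul_of_continuousOn h.hu h.hc (by linarith [h.one_lt_two_mul_logExp])
    (h.continuousOn_comp_norm hg)

theorem integrable_groundGrad_mul_comp (h : CapTest D M ε ν u) (m : ℕ) {g : ℝ → ℝ}
    (hg : ContinuousOn g (Ioc 0 D)) :
    Integrable (fun x => |u x| ^ (2 * logExp n - 1) * ‖groundGrad m M (1 / (2 * D)) ε ν u x‖
      * g ‖x‖) :=
  integrable_groundGrad_mul m h.hu h.hc h.subset_goodSet h.one_lt_two_mul_logExp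
    (h.continuousOn_comp_norm hg)

theorem integrable_div_sphFun (h : CapTest D M ε ν u) {g : ℝ → ℝ}
    (hg : ContinuousOn g (Ioc 0 D)) :
    Integrable (fun x => |u x| ^ (2 * logExp n) * (g ‖x‖ / sphFun ε ν x)) :=
  integrable_mul_of_continuousOn h.hu h.hc (by linarith [h.one_lt_two_mul_logExp])
    ((h.continuousOn_comp_norm hg).div (continuous_sphFun ε ν).continuousOn
      fun _ hx => (h.hs hx).2.2.ne')

theorem continuousOn_of_contDiffOn {χ : ℝ → ℝ} (hχ : ContDiffOn ℝ 1 χ (Ioi 0)) (D : ℝ) :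
    ContinuousOn χ (Ioc 0 D) ∧ ContinuousOn (deriv χ) (Ioc 0 D) ∧
      ∀ r ∈ Ioc 0 D, HasDerivAt χ (deriv χ r) r := by
  refine ⟨hχ.continuousOn.mono fun r hr => hr.1,
    (hχ.continuousOn_deriv_of_isOpen isOpen_Ioi le_rfl).mono fun r hr => hr.1, fun r hr => ?_⟩
  exact ((hχ.contDiffAt (Ioi_mem_nhds hr.1)).differentiableAt one_ne_zero).hasDerivAt

/-- Hardy inequality in the direction `ν`, with a radial cutoff. -/
theorem normal_hardy (h : CapTest D M ε ν u) (m : ℕ) {χ : ℝ → ℝ} (hχ : ContDiffOn ℝ 1 χ (Ioi 0))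
    (h0 : ∀ r > 0, 0 ≤ χ r) (h1 : ∀ r > 0, |deriv χ r| ≤ χ r / r) :
    ∫ x, |u x| ^ (2 * logExp n) * (χ ‖x‖ / sphFun ε ν x) ≤
      (4 * n + 5) * (∫ x, |u x| ^ (2 * logExp n) * (χ ‖x‖ / ‖x‖))
      + 4 * ∫ x, |u x| ^ (2 * logExp n - 1) * ‖groundGrad m M (1 / (2 * D)) ε ν u x‖ * χ ‖x‖ := by
  obtain ⟨hα1, hα2⟩ := logExp_bounds h.hn
  obtain ⟨c1, c2, hd⟩ := continuousOn_of_contDiffOn hχ D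
  set α := logExp n with hα
  have hne : ∀ x ∈ tsupport u, x ≠ 0 := fun x hx => (h.hs hx).1
  -- The field is the constant direction `ν` times the radial cutoff.
  have hdiv := integral_divergence_le (θ := 2 * α) (δ := 1 / (2 * D)) m h.hu h.hc h.subset_goodSet
    (by linarith) (a := fun _ => 0) (a' := fun _ => 0) (fun x hx => hasFDerivAt_const _ _)
    continuousOn_const
    (fun x hx => hasFDerivAt_comp_norm (hne x hx) (hd ‖x‖ (h.norm_mem hx)))
    (ContinuousOn.smul ((h.continuousOn_comp_norm c2).div continuous_norm.continuousOn
      fun x hx => norm_ne_zero_iff.2 (hne x hx)) (innerSL ℝ).continuous.continuousOn)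
  have cr : ContinuousOn (fun r => χ r / r) (Ioc 0 D) :=
    c1.div continuousOn_id fun r hr => hr.1.ne'
  have i1 := h.integrable_div_sphFun c1
  have i2 := h.integrable_pow_mul_comp cr
  have i3 := h.integrable_groundGrad_mul_comp m c1
  have i4 : Integrable fun x => |u x| ^ (2 * α) * (n * (0 : ℝ)
      + (0 : EuclideanSpace ℝ (Fin n) →L[ℝ] ℝ) x
      + ((deriv χ ‖x‖ / ‖x‖) • innerSL ℝ x) ν
      + 2 * α * inner ℝ (logGrad m M (1 / (2 * D)) ε ν x) ((0 : ℝ) • x + χ ‖x‖ • ν)) := by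
    refine integrable_mul_of_continuousOn h.hu h.hc (by linarith) ?_
    have c4 := h.continuousOn_comp_norm c1
    have c3 := (continuousOn_logGrad m M (1 / (2 * D)) ε ν).mono h.subset_goodSet
    refine ContinuousOn.add (ContinuousOn.add ?_ ?_) ?_
    · simpa using continuousOn_const
    · simp only [smul_apply, innerSL_apply_apply]
      exact ContinuousOn.smul ((h.continuousOn_comp_norm c2).div continuous_norm.continuousOn
        fun x hx => norm_ne_zero_iff.2 (hne x hx)) (by fun_prop)
    · refine continuousOn_const.mul (c3.inner ?_)
      simp only [zero_smul, zero_add]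
      exact c4.smul continuousOn_const
  -- Since `2α ≥ 2`, the coefficient `1/2` of `1/P` in `le_inner_logGrad_nu` suffices. The
  -- compensating constant `4n + 5` is `4(n+1)` for the `O(1/|x|)` part, using `2α ≤ 4`, plus `1`
  -- for `χ'`.
  have hle : ∫ x, |u x| ^ (2 * α) * (χ ‖x‖ / sphFun ε ν x) ≤ ∫ x, (|u x| ^ (2 * α) * (n * (0 : ℝ)
      + (0 : EuclideanSpace ℝ (Fin n) →L[ℝ] ℝ) x
      + ((deriv χ ‖x‖ / ‖x‖) • innerSL ℝ x) ν
      + 2 * α * inner ℝ (logGrad m M (1 / (2 * D)) ε ν x) ((0 : ℝ) • x + χ ‖x‖ • ν))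
      + (4 * n + 5) * (|u x| ^ (2 * α) * (χ ‖x‖ / ‖x‖))) := by
    refine integral_mono i1 (i4.add (i2.const_mul _)) fun x => ?_
    beta_reduce
    by_cases hx : x ∈ tsupport u
    · have hr := (h.norm_mem hx).1
      have hL := le_inner_logGrad_nu h.hn m h.hν h.hε h.hεD h.hM (h.hs hx)
      have hP := (h.hs hx).2.2
      have hχ0 := h0 _ hr
      have e : (4 * n + 5) * (|u x| ^ (2 * α) * (χ ‖x‖ / ‖x‖))
        = |u x| ^ (2 * α) * ((4 * n + 5) * (χ ‖x‖ / ‖x‖)) := by ring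
      rw [e, ← mul_add]
      gcongr
      simp only [zero_smul, zero_add, smul_apply, innerSL_apply_apply, smul_eq_mul,
        inner_smul_right, zero_apply, mul_zero]
      have b1 : -(χ ‖x‖ / ‖x‖) ≤ deriv χ ‖x‖ / ‖x‖ * inner ℝ x ν := by
        have : |deriv χ ‖x‖ / ‖x‖ * inner ℝ x ν| ≤ χ ‖x‖ / ‖x‖ := by
          rw [abs_mul, abs_div, abs_norm, real_inner_comm]
          calc |deriv χ ‖x‖| / ‖x‖ * |inner ℝ ν x| ≤ (χ ‖x‖ / ‖x‖) / ‖x‖ * ‖x‖ := by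
                gcongr
                · exact h1 _ hr
                · exact abs_inner_le_norm_of_unit h.hν x
            _ = χ ‖x‖ / ‖x‖ := by field_simp
        exact (abs_le.1 this).1
      have b2 : χ ‖x‖ * (1 / (2 * sphFun ε ν x) - (n + 1) / ‖x‖)
          ≤ χ ‖x‖ * inner ℝ (logGrad m M (1 / (2 * D)) ε ν x) ν := by gcongr
      have b3 : χ ‖x‖ * (1 / (2 * sphFun ε ν x) - (n + 1) / ‖x‖)
          = χ ‖x‖ / sphFun ε ν x / 2 - (n + 1) * (χ ‖x‖ / ‖x‖) := by
        field_simp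
      have b4 : 0 ≤ χ ‖x‖ / sphFun ε ν x := by positivity
      have b5 : 0 ≤ χ ‖x‖ / ‖x‖ := by positivity
      rw [b3] at b2
      have b6 := mul_le_mul_of_nonneg_left b2 (show 0 ≤ 2 * α by linarith)
      have b7 : χ ‖x‖ / sphFun ε ν x ≤ α * (χ ‖x‖ / sphFun ε ν x) :=
        le_mul_of_one_le_left b4 hα1.le
      have b8 : 2 * α * ((n + 1) * (χ ‖x‖ / ‖x‖)) ≤ 4 * ((n + 1) * (χ ‖x‖ / ‖x‖)) := by
        gcongr; linarith
      linarith
    · have hne0 : 2 * α ≠ 0 := by positivity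
      simp [image_eq_zero_of_notMem_tsupport hx, hne0]
  rw [integral_add i4 (i2.const_mul _), integral_const_mul] at hle
  have e2 : ∫ x, |u x| ^ (2 * α - 1) * ‖groundGrad m M (1 / (2 * D)) ε ν u x‖
      * ‖(0 : ℝ) • x + χ ‖x‖ • ν‖ = ∫ x, |u x| ^ (2 * α - 1)
        * ‖groundGrad m M (1 / (2 * D)) ε ν u x‖ * χ ‖x‖ := by
    congr 1
    ext x
    by_cases hx : x ∈ tsupport u
    · rw [zero_smul, zero_add, norm_smul, h.hν, mul_one, Real.norm_of_nonneg
        (h0 _ (h.norm_mem hx).1)]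
    · simp [groundGrad_eq_zero m M _ ε ν hx]
  rw [e2] at hdiv
  have h3 : 2 * α * ∫ x, |u x| ^ (2 * α - 1) * ‖groundGrad m M (1 / (2 * D)) ε ν u x‖ * χ ‖x‖ ≤
      4 * ∫ x, |u x| ^ (2 * α - 1) * ‖groundGrad m M (1 / (2 * D)) ε ν u x‖ * χ ‖x‖ := by
    refine mul_le_mul_of_nonneg_right (by linarith) (integral_nonneg fun x => ?_)
    beta_reduce
    by_cases hx : x ∈ tsupport u
    · have := h0 _ (h.norm_mem hx).1
      positivity
    · simp [groundGrad_eq_zero m M _ ε ν hx]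
  linarith

theorem contDiff_mul_comp_norm (h : CapTest D M ε ν u) {χ : ℝ → ℝ}
    (hχ : ContDiffOn ℝ 1 χ (Ioi 0)) :
    ContDiff ℝ 1 (fun x => |u x| ^ (2 * logExp n) * χ ‖x‖) := by
  rw [contDiff_iff_contDiffAt]
  intro x
  by_cases hx : x ∈ tsupport u
  · refine ContDiffAt.mul (contDiff_abs_rpow h.hu h.one_lt_two_mul_logExp).contDiffAt ?_
    exact (hχ.contDiffAt (Ioi_mem_nhds (h.norm_mem hx).1)).comp x
      (contDiffAt_norm ℝ (h.hs hx).1)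
  · have hne0 : 2 * logExp n ≠ 0 := by linarith [h.one_lt_two_mul_logExp]
    refine (contDiffAt_const (c := (0 : ℝ))).congr_of_eventuallyEq ?_
    filter_upwards [(isClosed_tsupport u).isOpen_compl.mem_nhds hx] with y hy
    simp [image_eq_zero_of_notMem_tsupport hy, hne0]

/-- The gradient of `|u|^{2α} χ` involves `groundGrad`, the cutoff derivative, and `∇φ/φ`. The only
dangerous part is `|u|^{2α} χ/P`, which `normal_hardy` trades for the two terms on the right; its
coefficient `8` and one further copy of `4n + 5` give the factor `9`. -/
theorem integral_norm_fderiv_le (h : CapTest D M ε ν u) (m : ℕ) {χ : ℝ → ℝ}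
    (hχ : ContDiffOn ℝ 1 χ (Ioi 0))
    (h0 : ∀ r > 0, 0 ≤ χ r) (h1 : ∀ r > 0, |deriv χ r| ≤ χ r / r) :
    ∫ x, ‖fderiv ℝ (fun x => |u x| ^ (2 * logExp n) * χ ‖x‖) x‖ ≤
      9 * (4 * n + 5) * ((∫ x, |u x| ^ (2 * logExp n) * (χ ‖x‖ / ‖x‖))
      + ∫ x, |u x| ^ (2 * logExp n - 1) * ‖groundGrad m M (1 / (2 * D)) ε ν u x‖ * χ ‖x‖) := by
  have hN := h.normal_hardy m hχ h0 h1
  obtain ⟨hα1, hα2⟩ := logExp_bounds h.hn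
  obtain ⟨c1, c2, hd⟩ := continuousOn_of_contDiffOn hχ D
  have cr : ContinuousOn (fun r => χ r / r) (Ioc 0 D) :=
    c1.div continuousOn_id fun r hr => hr.1.ne'
  have i1 := h.integrable_div_sphFun c1
  have i2 := h.integrable_pow_mul_comp cr
  have i3 := h.integrable_groundGrad_mul_comp m c1
  have hw := h.contDiff_mul_comp_norm hχ
  set α := logExp n with hα
  have hne0 : 2 * α ≠ 0 := by positivity
  have hwc : HasCompactSupport (fun x => |u x| ^ (2 * α) * χ ‖x‖) :=
    h.hc.mono fun x hx h' => hx (by simp [h', hne0])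
  have i5 : Integrable (fun x => ‖fderiv ℝ (fun x => |u x| ^ (2 * α) * χ ‖x‖) x‖) :=
    ((hw.continuous_fderiv one_ne_zero).integrable_of_hasCompactSupport (hwc.fderiv (𝕜 := ℝ))).norm
  have hpt : ∫ x, ‖fderiv ℝ (fun x => |u x| ^ (2 * α) * χ ‖x‖) x‖ ≤
      ∫ x, (4 * (|u x| ^ (2 * α - 1) * ‖groundGrad m M (1 / (2 * D)) ε ν u x‖ * χ ‖x‖)
        + 8 * (|u x| ^ (2 * α) * (χ ‖x‖ / sphFun ε ν x))
        + (4 * n + 5) * (|u x| ^ (2 * α) * (χ ‖x‖ / ‖x‖))) := by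
    refine integral_mono i5 (((i3.const_mul 4).add (i1.const_mul 8)).add (i2.const_mul _))
      fun x => ?_
    beta_reduce
    by_cases hx : x ∈ tsupport u
    · have hr := (h.norm_mem hx).1
      have hP := (h.hs hx).2.2
      have hχ0 := h0 _ hr
      have hL := norm_logGrad_le h.hn m h.hν h.hε h.hεD h.hM (h.hs hx)
      have hF := (hasFDerivAt_abs_rpow h.hu h.one_lt_two_mul_logExp x).differentiableAt.hasFDerivAt
      have hdw : HasFDerivAt (fun x => |u x| ^ (2 * α) * χ ‖x‖)
          (|u x| ^ (2 * α) • (deriv χ ‖x‖ / ‖x‖) • (innerSL ℝ) x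
            + χ ‖x‖ • fderiv ℝ (fun x => |u x| ^ (2 * α)) x) x :=
        hF.mul (hasFDerivAt_comp_norm (h.hs hx).1 (hd ‖x‖ (h.norm_mem hx)))
      rw [hdw.fderiv]
      refine ContinuousLinearMap.opNorm_le_bound _ (by positivity) fun v => ?_
      have hv := abs_fderiv_abs_rpow_sub_le h.hu h.one_lt_two_mul_logExp m M (1 / (2 * D)) ε ν x v
      simp only [add_apply, smul_apply, smul_eq_mul, innerSL_apply_apply]
      have hLv : |2 * α * |u x| ^ (2 * α) * inner ℝ (logGrad m M (1 / (2 * D)) ε ν x) v|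
          ≤ 4 * |u x| ^ (2 * α) * ((2 / sphFun ε ν x + (n + 1) / ‖x‖) * ‖v‖) := by
        rw [abs_mul, abs_of_nonneg (show 0 ≤ 2 * α * |u x| ^ (2 * α) by positivity)]
        gcongr
        · linarith
        · exact (abs_real_inner_le_norm _ _).trans (by gcongr)
      have hA : |fderiv ℝ (fun x => |u x| ^ (2 * α)) x v| ≤
          4 * (|u x| ^ (2 * α - 1) * ‖groundGrad m M (1 / (2 * D)) ε ν u x‖) * ‖v‖
          + 4 * |u x| ^ (2 * α) * ((2 / sphFun ε ν x + (n + 1) / ‖x‖) * ‖v‖) := by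
        have := abs_sub_abs_le_abs_sub (fderiv ℝ (fun x => |u x| ^ (2 * α)) x v)
          (2 * α * |u x| ^ (2 * α) * inner ℝ (logGrad m M (1 / (2 * D)) ε ν x) v)
        have h4 : 2 * α * (|u x| ^ (2 * α - 1) * ‖groundGrad m M (1 / (2 * D)) ε ν u x‖) * ‖v‖
          ≤ 4 * (|u x| ^ (2 * α - 1) * ‖groundGrad m M (1 / (2 * D)) ε ν u x‖) * ‖v‖ := by
          gcongr
          linarith
        linarith
      have hB : |deriv χ ‖x‖ / ‖x‖ * inner ℝ x v| ≤ χ ‖x‖ / ‖x‖ * ‖v‖ := by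
        rw [abs_mul, abs_div, abs_norm]
        calc |deriv χ ‖x‖| / ‖x‖ * |inner ℝ x v| ≤ (χ ‖x‖ / ‖x‖) / ‖x‖ * (‖x‖ * ‖v‖) := by
              gcongr
              · exact h1 _ hr
              · exact abs_real_inner_le_norm _ _
          _ = χ ‖x‖ / ‖x‖ * ‖v‖ := by field_simp
      rw [Real.norm_eq_abs]
      refine (abs_add_le _ _).trans ?_
      rw [abs_mul (|u x| ^ (2 * α)), abs_mul (χ ‖x‖),
        abs_of_nonneg (show 0 ≤ |u x| ^ (2 * α) by positivity), abs_of_nonneg hχ0]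
      calc |u x| ^ (2 * α) * |deriv χ ‖x‖ / ‖x‖ * inner ℝ x v|
            + χ ‖x‖ * |fderiv ℝ (fun x => |u x| ^ (2 * α)) x v|
          ≤ |u x| ^ (2 * α) * (χ ‖x‖ / ‖x‖ * ‖v‖) + χ ‖x‖ *
            (4 * (|u x| ^ (2 * α - 1) * ‖groundGrad m M (1 / (2 * D)) ε ν u x‖) * ‖v‖
          + 4 * |u x| ^ (2 * α) * ((2 / sphFun ε ν x + (n + 1) / ‖x‖) * ‖v‖)) := by gcongr
        _ = _ := by ring
    · have : fderiv ℝ (fun x => |u x| ^ (2 * α) * χ ‖x‖) x = 0 := by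
        by_contra h'
        have hsub : tsupport (fun x => |u x| ^ (2 * α) * χ ‖x‖) ⊆ tsupport u :=
          closure_mono fun x hx h' => hx (by simp [h', hne0])
        exact hx (hsub (support_fderiv_subset ℝ h'))
      simp [this, groundGrad_eq_zero m M _ ε ν hx, image_eq_zero_of_notMem_tsupport hx, hne0]
  have i6 : Integrable (fun x => 4 * (|u x| ^ (2 * α - 1) * ‖groundGrad m M (1 / (2 * D)) ε ν u x‖
      * χ ‖x‖) + 8 * (|u x| ^ (2 * α) * (χ ‖x‖ / sphFun ε ν x))) :=
    (i3.const_mul 4).add (i1.const_mul 8)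
  rw [integral_add i6 (i2.const_mul _),
    integral_add (i3.const_mul 4) (i1.const_mul 8), integral_const_mul, integral_const_mul,
    integral_const_mul] at hpt
  have hT : 0 ≤ ∫ x, |u x| ^ (2 * α - 1) * ‖groundGrad m M (1 / (2 * D)) ε ν u x‖ * χ ‖x‖ := by
    refine integral_nonneg fun x => ?_
    beta_reduce
    by_cases hx : x ∈ tsupport u
    · have := h0 _ (h.norm_mem hx).1
      positivity
    · simp [groundGrad_eq_zero m M _ ε ν hx]
  have hn0 : (0 : ℝ) ≤ n := by positivity
  nlinarith [mul_nonneg hn0 hT]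

end CapTest

end Sobolev


/-! ### Multiplicatively translated cutoffs -/

section Cutoffs

/-- A smooth bump in the variable `ln r`, centred at `ln s`. -/
noncomputable def logBump (s r : ℝ) : ℝ := s * r / (s + r) ^ 2

theorem logBump_nonneg {s r : ℝ} (hs : 0 < s) (hr : 0 < r) : 0 ≤ logBump s r := by
  unfold logBump; positivity

theorem contDiffOn_logBump {s : ℝ} (hs : 0 < s) : ContDiffOn ℝ 1 (logBump s) (Ioi 0) := by
  unfold logBump
  refine ContDiffOn.div (by fun_prop) (by fun_prop) fun r hr => ?_
  have : 0 < r := hr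
  positivity

theorem hasDerivAt_logBump {s r : ℝ} (hs : 0 < s) (hr : 0 < r) :
    HasDerivAt (logBump s) (s * (s - r) / (s + r) ^ 3) r := by
  have h := ((hasDerivAt_id r).const_mul s).div (((hasDerivAt_id r).const_add s).pow 2)
    (by simp only [id, Pi.pow_apply]; positivity)
  refine h.congr_deriv ?_
  simp only [id, Pi.pow_apply]
  field_simp
  ring

theorem abs_deriv_logBump_le {s r : ℝ} (hs : 0 < s) (hr : 0 < r) :
    |deriv (logBump s) r| ≤ logBump s r / r := by
  rw [(hasDerivAt_logBump hs hr).deriv, abs_div, abs_mul, abs_of_pos hs,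
    abs_of_pos (show 0 < (s + r) ^ 3 by positivity)]
  unfold logBump
  rw [div_div, div_le_div_iff₀ (by positivity) (by positivity)]
  have : |s - r| ≤ s + r := by rw [abs_le]; constructor <;> linarith
  calc s * |s - r| * ((s + r) ^ 2 * r) ≤ s * (s + r) * ((s + r) ^ 2 * r) := by gcongr
    _ = s * r * (s + r) ^ 3 := by ring

/-- For the increasing weight `ξ = √(r/(s+r))`, inserted into `radial_hardy`, one has `logBump s r =
ξ · 2rξ'`. So the term in `ξ'` controls the mass near the sphere of radius `s`. -/
theorem hasDerivAt_sqrt_div {s r : ℝ} (hs : 0 < s) (hr : 0 < r) :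
    HasDerivAt (fun r => √(r / (s + r))) (√(r / (s + r)) * (s / (s + r)) / (2 * r)) r := by
  have h := ((hasDerivAt_id r).div ((hasDerivAt_id r).const_add s) (by simp only [id]; positivity)).sqrt
    (by simp only [id, Pi.div_apply]; positivity)
  refine h.congr_deriv ?_
  simp only [id, Pi.div_apply]
  have h1 : √(r / (s + r)) ≠ 0 := by positivity
  have h2 : √(r / (s + r)) ^ 2 = r / (s + r) := Real.sq_sqrt (by positivity)
  rw [div_eq_div_iff (by positivity) (by positivity)]
  have e : √(r / (s + r)) * (s / (s + r)) * (2 * √(r / (s + r)))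
      = √(r / (s + r)) ^ 2 * (2 * (s / (s + r))) := by ring
  rw [e, h2]
  field_simp
  ring

/-- Each term is at most twice the decrement of `t/(1+t)` when `t` is halved, so the sum telescopes
and the bound is independent of `q` and `K`. -/
theorem sum_geometric_bump_le {q : ℝ} (hq : 0 < q) (K : ℕ) :
    ∑ k ∈ Finset.range K, q / 2 ^ k / (1 + q / 2 ^ k) ^ 2 ≤ 2 := by
  let W : ℕ → ℝ := fun k => q / 2 ^ k / (1 + q / 2 ^ k)
  have h : ∀ k ∈ Finset.range K, q / 2 ^ k / (1 + q / 2 ^ k) ^ 2 ≤ 2 * (W k - W (k + 1)) := by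
    intro k _
    have e : q / 2 ^ (k + 1) = q / 2 ^ k / 2 := by rw [pow_succ]; field_simp
    simp only [W, e]
    have ht : 0 < q / 2 ^ k := by positivity
    generalize q / 2 ^ k = t at *
    have e2 : 2 * (t / (1 + t) - t / 2 / (1 + t / 2)) = t / ((1 + t) * (1 + t / 2)) := by
      field_simp
      ring
    rw [e2, pow_two]
    gcongr
    linarith
  refine (Finset.sum_le_sum h).trans ?_
  rw [← Finset.mul_sum, Finset.sum_range_sub']
  have h1 : W 0 ≤ 1 := by
    simp only [W, pow_zero, div_one]
    rw [div_le_one (by positivity)]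
    linarith
  have h2 : 0 ≤ W K := by simp only [W]; positivity
  linarith

end Cutoffs

/-! ### Comparing logarithmic weights at different radii -/

section Sobolev

variable {n : ℕ}

namespace CapTest

variable {D M ε : ℝ} {ν : EuclideanSpace ℝ (Fin n)} {u : EuclideanSpace ℝ (Fin n) → ℝ}

theorem logProd_mono (h : CapTest D M ε ν u) (k : ℕ) {r s : ℝ} (hr : r ∈ Ioc 0 D)
    (hs : s ∈ Ioc 0 D) (hrs : r ≤ s) : logProd k (r / M) ≤ logProd k (s / M) := by
  have hM0 : 0 < M := lt_of_lt_of_le (mul_pos (by linarith [kappa_spec.1]) h.hD) h.hM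
  exact logProd_le k (h.div_mem hr).1 (by gcongr) (h.div_mem_Ioo hs).2

theorem logProd_rpow_le (h : CapTest D M ε ν u) (k : ℕ) {r s p : ℝ} (hr : r ∈ Ioc 0 D)
    (hs : s ∈ Ioc 0 D) (hrs : r ≤ s) (hp : 0 ≤ p) :
    logProd k (s / M) ^ p ≤ logProd k (r / M) ^ p * (s / r) ^ (p / 4) := by
  have hM0 : 0 < M := lt_of_lt_of_le (mul_pos (by linarith [kappa_spec.1]) h.hD) h.hM
  have h1 := logProd_le_mul_rpow k (h.div_mem hr).1
    (div_le_div_of_nonneg_right hrs hM0.le) (h.div_mem hs).2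
  have h0 := hr.1
  have e : s / M / (r / M) = s / r := by field_simp
  rw [e] at h1
  have hsr : 0 ≤ s / r := div_nonneg hs.1.le h0.le
  calc logProd k (s / M) ^ p ≤ (logProd k (r / M) * (s / r) ^ (1 / 4 : ℝ)) ^ p :=
        Real.rpow_le_rpow (h.logProd_pos' k hs).le h1 hp
    _ = _ := by
        rw [Real.mul_rpow (h.logProd_pos' k hr).le (by positivity), ← Real.rpow_mul hsr]
        congr 2
        ring

/-- For `s ≤ r` this is monotonicity. For `r ≤ s` slow variation costs `(s/r)^{α/4} ≤ (s/r)^{1/2}`,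
which the square root pays back. -/
theorem logProd_rpow_mul_sqrt_le (h : CapTest D M ε ν u) (k : ℕ) {r s : ℝ} (hr : r ∈ Ioc 0 D)
    (hs : s ∈ Ioc 0 D) :
    logProd k (s / M) ^ logExp n * √(r / (s + r)) ≤ logProd k (r / M) ^ logExp n := by
  obtain ⟨hα1, hα2⟩ := logExp_bounds h.hn
  have hr0 := hr.1
  have hs0 := hs.1
  have hηs := h.logProd_pos' k hs
  have hηr := h.logProd_pos' k hr
  rcases le_total s r with hsr | hrs
  · have h1 : √(r / (s + r)) ≤ 1 := Real.sqrt_le_one.2 (by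
      rw [div_le_one (by positivity)]; linarith)
    calc logProd k (s / M) ^ logExp n * √(r / (s + r)) ≤ logProd k (s / M) ^ logExp n * 1 := by
          gcongr
      _ ≤ logProd k (r / M) ^ logExp n := by
          rw [mul_one]
          exact Real.rpow_le_rpow hηs.le (h.logProd_mono k hs hr hsr) (by linarith)
  · have h1 := h.logProd_rpow_le k hr hs hrs (p := logExp n) (by linarith)
    have h2 : (s / r) ^ (logExp n / 4) ≤ √(s / r) := by
      rw [Real.sqrt_eq_rpow]
      exact Real.rpow_le_rpow_of_exponent_le ((one_le_div hr0).2 hrs) (by linarith)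
    have h3 : √(s / r) * √(r / (s + r)) ≤ 1 := by
      rw [← Real.sqrt_mul (by positivity)]
      refine Real.sqrt_le_one.2 ?_
      rw [div_mul_div_cancel₀ hr0.ne', div_le_one (by positivity)]
      linarith
    calc logProd k (s / M) ^ logExp n * √(r / (s + r))
        ≤ logProd k (r / M) ^ logExp n * √(s / r) * √(r / (s + r)) := by
          gcongr
          exact h1.trans (by gcongr)
      _ = logProd k (r / M) ^ logExp n * (√(s / r) * √(r / (s + r))) := by ring
      _ ≤ logProd k (r / M) ^ logExp n := mul_le_of_le_one_right (by positivity) h3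

/-- One factor `ξ` of the bump moves the weight from `s` to `r`; the remaining `2ξ'` is what
`radial_hardy` provides. -/
theorem logProd_rpow_mul_logBump_le (h : CapTest D M ε ν u) (k : ℕ) {r s : ℝ} (hr : r ∈ Ioc 0 D)
    (hs : s ∈ Ioc 0 D) :
    logProd k (s / M) ^ logExp n * (logBump s r / r) ≤
      2 * (logProd k (r / M) ^ logExp n * (√(r / (s + r)) * (s / (s + r)) / (2 * r))) := by
  have hr0 := hr.1
  have hs0 := hs.1
  have e : logBump s r = √(r / (s + r)) * (√(r / (s + r)) * (s / (s + r))) := by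
    rw [← mul_assoc, Real.mul_self_sqrt (by positivity)]
    unfold logBump
    field_simp
  have h1 := h.logProd_rpow_mul_sqrt_le k hr hs
  calc logProd k (s / M) ^ logExp n * (logBump s r / r)
      = logProd k (s / M) ^ logExp n * √(r / (s + r)) * (√(r / (s + r)) * (s / (s + r)) / r) := by
        rw [e]; ring
    _ ≤ logProd k (r / M) ^ logExp n * (√(r / (s + r)) * (s / (s + r)) / r) := by gcongr
    _ = _ := by field_simp

theorem logProd_rpow_mul_logBump_le' (h : CapTest D M ε ν u) (k : ℕ) {r s : ℝ} (hr : r ∈ Ioc 0 D)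
    (hs : s ∈ Ioc 0 D) :
    logProd k (s / M) ^ logExp n * logBump s r ≤ logProd k (r / M) ^ logExp n := by
  have hr0 := hr.1
  have hs0 := hs.1
  have hηr := h.logProd_pos' k hr
  have h1 := h.logProd_rpow_mul_logBump_le k hr hs
  have h2 : √(r / (s + r)) ≤ 1 := Real.sqrt_le_one.2 (by
      rw [div_le_one (by positivity)]; linarith)
  have h3 : s / (s + r) ≤ 1 := by rw [div_le_one (by positivity)]; linarith
  have h4 : logProd k (s / M) ^ logExp n * logBump s r
      = logProd k (s / M) ^ logExp n * (logBump s r / r) * r := by field_simp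
  rw [h4]
  calc logProd k (s / M) ^ logExp n * (logBump s r / r) * r
      ≤ 2 * (logProd k (r / M) ^ logExp n * (√(r / (s + r)) * (s / (s + r)) / (2 * r))) * r := by
        gcongr
    _ = logProd k (r / M) ^ logExp n * (√(r / (s + r)) * (s / (s + r))) := by field_simp
    _ ≤ logProd k (r / M) ^ logExp n * (1 * 1) := by gcongr
    _ = _ := by ring

/-- With `q = (s/r)^{1/4}`, the bump is `q⁴/(1+q⁴)²`. For `q ≥ 1` slow variation costs at most `q³`,
because `α + 1 ≤ 3`, so the bump's decay `q^{-4}` still leaves `1/q`; for `q ≤ 1` monotonicity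
suffices. -/
theorem logProd_rpow_add_one_mul_logBump_le (h : CapTest D M ε ν u) (k : ℕ) {r s : ℝ}
    (hr : r ∈ Ioc 0 D) (hs : s ∈ Ioc 0 D) :
    logProd k (s / M) ^ (logExp n + 1) * logBump s r ≤ 4 * logProd k (r / M) ^ (logExp n + 1)
      * ((s / r) ^ (1 / 4 : ℝ) / (1 + (s / r) ^ (1 / 4 : ℝ)) ^ 2) := by
  obtain ⟨hα1, hα2⟩ := logExp_bounds h.hn
  have hr0 := hr.1
  have hs0 := hs.1
  have hηr := h.logProd_pos' k hr
  have hηs := h.logProd_pos' k hs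
  have hsr : 0 < s / r := by positivity
  set q : ℝ := (s / r) ^ (1 / 4 : ℝ) with hqdef
  have hq : 0 < q := by positivity
  have hq4 : q ^ 4 = s / r := by
    rw [hqdef, ← Real.rpow_natCast, ← Real.rpow_mul hsr.le]; norm_num
  have hb : logBump s r = q ^ 4 / (1 + q ^ 4) ^ 2 := by
    rw [hq4]; unfold logBump; field_simp; ring
  rw [hb]
  rcases le_total s r with hle | hle
  · have hq1 : q ≤ 1 := Real.rpow_le_one hsr.le ((div_le_one hr0).2 hle) (by norm_num)
    have h1 : logProd k (s / M) ^ (logExp n + 1) ≤ logProd k (r / M) ^ (logExp n + 1) :=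
      Real.rpow_le_rpow hηs.le (h.logProd_mono k hs hr hle) (by linarith)
    have h2 : q ^ 4 / (1 + q ^ 4) ^ 2 ≤ 4 * (q / (1 + q) ^ 2) := by
      have a1 : q ^ 4 / (1 + q ^ 4) ^ 2 ≤ q := by
        rw [div_le_iff₀ (by positivity)]
        have : q ^ 4 ≤ q := by
          calc q ^ 4 = q * q ^ 3 := by ring
            _ ≤ q * 1 := by gcongr; exact pow_le_one₀ hq.le hq1
            _ = q := mul_one q
        nlinarith [mul_nonneg hq.le (show 0 ≤ (1 + q ^ 4) ^ 2 - 1 by nlinarith [pow_pos hq 4])]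
      have a2 : q ≤ 4 * (q / (1 + q) ^ 2) := by
        rw [← mul_div_assoc, le_div_iff₀ (by positivity)]
        nlinarith
      exact a1.trans a2
    calc _ ≤ logProd k (r / M) ^ (logExp n + 1) * (4 * (q / (1 + q) ^ 2)) := by gcongr
      _ = _ := by ring
  · have hq1 : 1 ≤ q := Real.one_le_rpow ((one_le_div hr0).2 hle) (by norm_num)
    have h1 := h.logProd_rpow_le k hr hs hle (p := logExp n + 1) (by linarith)
    have h2 : (s / r) ^ ((logExp n + 1) / 4) ≤ q ^ 3 := by
      rw [← hq4, ← Real.rpow_natCast q 4, ← Real.rpow_natCast q 3, ← Real.rpow_mul hq.le]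
      refine Real.rpow_le_rpow_of_exponent_le hq1 ?_
      push_cast
      linarith
    have h3 : q ^ 3 * (q ^ 4 / (1 + q ^ 4) ^ 2) ≤ 4 * (q / (1 + q) ^ 2) := by
      have a1 : q ^ 3 * (q ^ 4 / (1 + q ^ 4) ^ 2) ≤ 1 / q := by
        rw [← mul_div_assoc, div_le_div_iff₀ (by positivity) hq]
        nlinarith [pow_pos hq 4]
      have a2 : 1 / q ≤ 4 * (q / (1 + q) ^ 2) := by
        rw [← mul_div_assoc, div_le_div_iff₀ hq (by positivity)]
        nlinarith
      exact a1.trans a2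
    calc _ ≤ logProd k (r / M) ^ (logExp n + 1) * q ^ 3 * (q ^ 4 / (1 + q ^ 4) ^ 2) := by
          gcongr
          exact h1.trans (by gcongr)
      _ = logProd k (r / M) ^ (logExp n + 1) * (q ^ 3 * (q ^ 4 / (1 + q ^ 4) ^ 2)) := by ring
      _ ≤ logProd k (r / M) ^ (logExp n + 1) * (4 * (q / (1 + q) ^ 2)) := by gcongr
      _ = _ := by ring

/-- The ratio `16 = 2⁴` of the radii makes `(s_j/r)^{1/4}` halve at each step, which is the setting
of `sum_geometric_bump_le`. -/
theorem sum_logBump_le (h : CapTest D M ε ν u) (k : ℕ) {r : ℝ} (hr : r ∈ Ioc 0 D) (K : ℕ) :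
    ∑ j ∈ Finset.range K, logProd k (D / 16 ^ j / M) ^ (logExp n + 1) * logBump (D / 16 ^ j) r
      ≤ 8 * logProd k (r / M) ^ (logExp n + 1) := by
  have hr0 := hr.1
  have hD := h.hD
  have hηr := h.logProd_pos' k hr
  have hs : ∀ j : ℕ, D / 16 ^ j ∈ Ioc 0 D := fun j =>
    ⟨by positivity, div_le_self hD.le (one_le_pow₀ (by norm_num))⟩
  have hq : ∀ j : ℕ, (D / 16 ^ j / r) ^ (1 / 4 : ℝ) = (D / r) ^ (1 / 4 : ℝ) / 2 ^ j := by
    intro j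
    have e : D / 16 ^ j / r = (D / r) / 16 ^ j := by ring
    rw [e, Real.div_rpow (by positivity) (by positivity)]
    congr 1
    rw [show (16 : ℝ) ^ j = (2 ^ j) ^ 4 by rw [← pow_mul, mul_comm, pow_mul]; norm_num,
      ← Real.rpow_natCast _ 4, ← Real.rpow_mul (by positivity)]
    norm_num
  calc _ ≤ ∑ j ∈ Finset.range K, 4 * logProd k (r / M) ^ (logExp n + 1) *
        ((D / r) ^ (1 / 4 : ℝ) / 2 ^ j / (1 + (D / r) ^ (1 / 4 : ℝ) / 2 ^ j) ^ 2) := by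
        refine Finset.sum_le_sum fun j _ => ?_
        rw [← hq]
        exact h.logProd_rpow_add_one_mul_logBump_le k hr (hs j)
    _ ≤ 4 * logProd k (r / M) ^ (logExp n + 1) * 2 := by
        rw [← Finset.mul_sum]
        gcongr
        exact sum_geometric_bump_le (by positivity) K
    _ = _ := by ring

end CapTest

end Sobolev


/-! ### Summation over scales and the weighted Sobolev inequality -/

section Sobolev

variable {n : ℕ}

namespace CapTest

variable {D M ε : ℝ} {ν : EuclideanSpace ℝ (Fin n)} {u : EuclideanSpace ℝ (Fin n) → ℝ}

theorem exists_lt_norm (h : CapTest D M ε ν u) : ∃ δ > 0, ∀ x ∈ tsupport u, δ ≤ ‖x‖ := by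
  have h0 : (0 : EuclideanSpace ℝ (Fin n)) ∈ (tsupport u)ᶜ := fun hx => (h.hs hx).1 rfl
  obtain ⟨δ, hδ, hb⟩ := Metric.isOpen_iff.1 (isClosed_tsupport u).isOpen_compl 0 h0
  refine ⟨δ, hδ, fun x hx => ?_⟩
  by_contra hlt
  exact hb (by simpa using not_le.1 hlt) hx

/-- The support stays away from the origin, so finitely many scales suffice. A point satisfies `r ≤
s ≤ 16r` for some scale `s`, and there the bump is smallest at `s = 16r`, with value `16/17²`. The
condition `r ≤ s` is kept because the weight at `s` must dominate the weight at `r`. -/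
theorem exists_cover (h : CapTest D M ε ν u) : ∃ K : ℕ, ∀ x ∈ tsupport u, ∃ k ∈ Finset.range K,
    ‖x‖ ≤ D / 16 ^ k ∧ 16 / 289 ≤ logBump (D / 16 ^ k) ‖x‖ := by
  obtain ⟨δ, hδ, hx⟩ := h.exists_lt_norm
  obtain ⟨K, hK⟩ := pow_unbounded_of_one_lt (D / δ) (show (1 : ℝ) < 16 by norm_num)
  refine ⟨K, fun x hxs => ?_⟩
  have hr := h.norm_mem hxs
  have hr0 := hr.1
  have hD := h.hD
  obtain ⟨k, hk1, hk2⟩ := exists_nat_pow_near ((one_le_div hr0).2 hr.2)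
    (show (1 : ℝ) < 16 by norm_num)
  have hle : ‖x‖ ≤ D / 16 ^ k := by
    rw [le_div_iff₀ (by positivity)]
    rw [le_div_iff₀ hr0] at hk1
    linarith
  refine ⟨k, Finset.mem_range.2 ?_, hle, ?_⟩
  · have : (16 : ℝ) ^ k < 16 ^ K := by
      refine hk1.trans_lt (lt_of_le_of_lt ?_ hK)
      gcongr
      exact hx x hxs
    exact (pow_lt_pow_iff_right₀ (by norm_num)).1 this
  · have h16 : D / 16 ^ k ≤ 16 * ‖x‖ := by
      rw [div_le_iff₀ (by positivity)]
      rw [div_lt_iff₀ hr0, pow_succ] at hk2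
      linarith
    have hs : 0 < D / 16 ^ k := by positivity
    unfold logBump
    generalize D / 16 ^ k = s at *
    rw [div_le_div_iff₀ (by norm_num) (by positivity)]
    nlinarith [mul_nonneg (sub_nonneg.2 hle) (sub_nonneg.2 h16)]

/-- `∫ η^α |u|^{2α-1} |∇u - u ∇φ/φ|`, where `η = X₁⋯X_{m+1}` and `α = logExp n`. -/
noncomputable def gradMass (D M ε : ℝ) (ν : EuclideanSpace ℝ (Fin n))
    (u : EuclideanSpace ℝ (Fin n) → ℝ) (m : ℕ) : ℝ :=
  ∫ x, |u x| ^ (2 * logExp n - 1) * ‖groundGrad m M (1 / (2 * D)) ε ν u x‖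
    * logProd (m + 1) (‖x‖ / M) ^ logExp n

/-- `radial_hardy` with `ξ = 1`: only the term of size `η/r` remains, hence one more power of `η`
than in `gradMass`. -/
theorem integral_hardy_le (h : CapTest D M ε ν u) (m : ℕ) :
    ∫ x, |u x| ^ (2 * logExp n) * (logProd (m + 1) (‖x‖ / M) ^ (logExp n + 1) / ‖x‖)
      ≤ 4 * Real.exp 4 * gradMass D M ε ν u m := by
  obtain ⟨hα1, hα2⟩ := logExp_bounds h.hn
  have hr := h.radial_hardy m (ξ := fun _ => 1) (ξ' := fun _ => 0)
    (fun r _ => hasDerivAt_const r 1) continuousOn_const (fun _ _ => zero_le_one)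
    fun _ _ => le_rfl
  simp only [mul_one, add_zero] at hr
  have hG : 0 ≤ gradMass D M ε ν u m := by
    refine integral_nonneg fun x => ?_
    beta_reduce
    by_cases hx : x ∈ tsupport u
    · have := h.logProd_pos' (m + 1) (h.norm_mem hx)
      positivity
    · simp [groundGrad_eq_zero m M _ ε ν hx]
  refine le_trans (integral_mono ?_ ?_ fun x => ?_) (hr.trans ?_)
  · exact h.integrable_pow_mul_comp (g := fun r => logProd (m + 1) (r / M) ^ (logExp n + 1) / r)
      ((h.continuousOn_logProd_rpow _ _).div continuousOn_id fun r hr => hr.1.ne')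
  · exact h.integrable_pow_mul_comp (g := fun r => logProd (m + 1) (r / M) ^ logExp n
      * (logExp n * logProd (m + 1) (r / M) / r))
      ((h.continuousOn_logProd_rpow _ _).mul ((continuousOn_const.mul
        (h.continuousOn_logProd _)).div continuousOn_id fun r hr => hr.1.ne'))
  · beta_reduce
    by_cases hx : x ∈ tsupport u
    · have hη := h.logProd_pos' (m + 1) (h.norm_mem hx)
      have hr0 := (h.norm_mem hx).1
      gcongr
      rw [Real.rpow_add_one hη.ne', mul_div_assoc, mul_div_assoc]
      gcongr
      exact le_mul_of_one_le_left (by positivity) hα1.le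
    · simp [image_eq_zero_of_notMem_tsupport hx, show 2 * logExp n ≠ 0 by positivity]
  · rw [show 4 * Real.exp 4 = 2 * 2 * Real.exp 4 by ring]
    exact mul_le_mul_of_nonneg_right (by gcongr) hG

theorem gradMass_nonneg (h : CapTest D M ε ν u) (m : ℕ) : 0 ≤ gradMass D M ε ν u m := by
  refine integral_nonneg fun x => ?_
  beta_reduce
  by_cases hx : x ∈ tsupport u
  · have := h.logProd_pos' (m + 1) (h.norm_mem hx)
    positivity
  · simp [groundGrad_eq_zero m M _ ε ν hx]

theorem integral_mul_mono (h : CapTest D M ε ν u) {f g : ℝ → ℝ} (hf : ContinuousOn f (Ioc 0 D))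
    (hg : ContinuousOn g (Ioc 0 D)) (hfg : ∀ r ∈ Ioc 0 D, f r ≤ g r) :
    ∫ x, |u x| ^ (2 * logExp n) * f ‖x‖ ≤ ∫ x, |u x| ^ (2 * logExp n) * g ‖x‖ := by
  refine integral_mono (h.integrable_pow_mul_comp hf) (h.integrable_pow_mul_comp hg) fun x => ?_
  beta_reduce
  by_cases hx : x ∈ tsupport u
  · gcongr
    exact hfg _ (h.norm_mem hx)
  · have := h.one_lt_two_mul_logExp
    simp [image_eq_zero_of_notMem_tsupport hx, show 2 * logExp n ≠ 0 by positivity]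

theorem integral_groundGrad_mul_mono (h : CapTest D M ε ν u) (m : ℕ) {f g : ℝ → ℝ}
    (hf : ContinuousOn f (Ioc 0 D))
    (hg : ContinuousOn g (Ioc 0 D)) (hfg : ∀ r ∈ Ioc 0 D, f r ≤ g r) :
    ∫ x, |u x| ^ (2 * logExp n - 1) * ‖groundGrad m M (1 / (2 * D)) ε ν u x‖ * f ‖x‖ ≤
      ∫ x, |u x| ^ (2 * logExp n - 1) * ‖groundGrad m M (1 / (2 * D)) ε ν u x‖ * g ‖x‖ := by
  refine integral_mono (h.integrable_groundGrad_mul_comp m hf)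
    (h.integrable_groundGrad_mul_comp m hg) fun x => ?_
  beta_reduce
  by_cases hx : x ∈ tsupport u
  · gcongr
    exact hfg _ (h.norm_mem hx)
  · simp [groundGrad_eq_zero m M _ ε ν hx]

theorem continuousOn_logBump {s : ℝ} (hs : s ∈ Ioc 0 D) : ContinuousOn (logBump s) (Ioc 0 D) :=
  (contDiffOn_logBump hs.1).continuousOn.mono fun _ hr => hr.1

theorem continuousOn_logBump_div {s : ℝ} (hs : s ∈ Ioc 0 D) :
    ContinuousOn (fun r => logBump s r / r) (Ioc 0 D) :=
  (continuousOn_logBump hs).div continuousOn_id fun _ hr => hr.1.ne'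

/-- The weighted `L¹` mass near the sphere of radius `s`. -/
noncomputable def localMass (D M ε : ℝ) (ν : EuclideanSpace ℝ (Fin n))
    (u : EuclideanSpace ℝ (Fin n) → ℝ) (m : ℕ) (s : ℝ) : ℝ :=
  (∫ x, |u x| ^ (2 * logExp n) * (logBump s ‖x‖ / ‖x‖))
    + ∫ x, |u x| ^ (2 * logExp n - 1) * ‖groundGrad m M (1 / (2 * D)) ε ν u x‖ * logBump s ‖x‖

theorem localMass_nonneg (h : CapTest D M ε ν u) (m : ℕ) {s : ℝ} (hs : s ∈ Ioc 0 D) :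
    0 ≤ localMass D M ε ν u m s := by
  refine add_nonneg (integral_nonneg fun x => ?_) (integral_nonneg fun x => ?_)
  · beta_reduce
    by_cases hx : x ∈ tsupport u
    · have := logBump_nonneg hs.1 (h.norm_mem hx).1
      positivity
    · have := h.one_lt_two_mul_logExp
      simp [image_eq_zero_of_notMem_tsupport hx, show 2 * logExp n ≠ 0 by positivity]
  · beta_reduce
    by_cases hx : x ∈ tsupport u
    · have := logBump_nonneg hs.1 (h.norm_mem hx).1
      positivity
    · simp [groundGrad_eq_zero m M _ ε ν hx]

/-- The estimate on a single scale, from `radial_hardy` with `ξ = √(r/(s+r))`. Localization saves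
the extra power of `η` that the global Hardy inequality loses. -/
theorem rpow_mul_localMass_le (h : CapTest D M ε ν u) (m : ℕ) {s : ℝ} (hs : s ∈ Ioc 0 D) :
    logProd (m + 1) (s / M) ^ logExp n * localMass D M ε ν u m s
      ≤ (8 * Real.exp 4 + 1) * gradMass D M ε ν u m := by
  obtain ⟨hα1, hα2⟩ := logExp_bounds h.hn
  have hG := h.gradMass_nonneg m
  let ξ : ℝ → ℝ := fun r => √(r / (s + r))
  let ξ' : ℝ → ℝ := fun r => √(r / (s + r)) * (s / (s + r)) / (2 * r)
  have hξ : ∀ r ∈ Ioc 0 D, HasDerivAt ξ (ξ' r) r := fun r hr => hasDerivAt_sqrt_div hs.1 hr.1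
  have hξc : ContinuousOn ξ (Ioc 0 D) := fun r hr => (hξ r hr).continuousAt.continuousWithinAt
  have hξ'c : ContinuousOn ξ' (Ioc 0 D) := by
    refine ContinuousOn.div (hξc.mul (ContinuousOn.div (by fun_prop) (by fun_prop) fun r hr => ?_))
      (by fun_prop) fun r hr => ?_
    · have := hr.1
      have := hs.1
      positivity
    · have := hr.1
      positivity
  have hη := h.continuousOn_logProd_rpow (m + 1) (logExp n)
  have hr := h.radial_hardy m hξ hξ'c (fun r _ => Real.sqrt_nonneg _) fun r hr => by
    have := hr.1
    have := hs.1
    positivity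
  have h1 : logProd (m + 1) (s / M) ^ logExp n *
      (∫ x, |u x| ^ (2 * logExp n) * (logBump s ‖x‖ / ‖x‖)) ≤
      8 * Real.exp 4 * gradMass D M ε ν u m := by
    rw [← integral_const_mul]
    calc ∫ x, logProd (m + 1) (s / M) ^ logExp n * (|u x| ^ (2 * logExp n) * (logBump s ‖x‖ / ‖x‖))
        = ∫ x, |u x| ^ (2 * logExp n) *
          (logProd (m + 1) (s / M) ^ logExp n * (logBump s ‖x‖ / ‖x‖)) := by
          congr 1; ext x; ring
      _ ≤ ∫ x, |u x| ^ (2 * logExp n) * (2 * (logProd (m + 1) (‖x‖ / M) ^ logExp n *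
        (logExp n * logProd (m + 1) (‖x‖ / M) * ξ ‖x‖ / ‖x‖ + ξ' ‖x‖))) := by
          refine h.integral_mul_mono
            (f := fun r => logProd (m + 1) (s / M) ^ logExp n * (logBump s r / r))
            (g := fun r => 2 * (logProd (m + 1) (r / M) ^ logExp n *
              (logExp n * logProd (m + 1) (r / M) * ξ r / r + ξ' r)))
            (continuousOn_const.mul (continuousOn_logBump_div hs))
            (continuousOn_const.mul (hη.mul ((((continuousOn_const.mul
              (h.continuousOn_logProd _)).mul hξc).div continuousOn_id
              fun r hr => hr.1.ne').add hξ'c))) fun r hr => ?_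
          refine (h.logProd_rpow_mul_logBump_le (m + 1) hr hs).trans ?_
          have hηr := h.logProd_pos' (m + 1) hr
          have hr0 := hr.1
          gcongr
          have : 0 ≤ logExp n * logProd (m + 1) (r / M) * ξ r / r := by
            have := Real.sqrt_nonneg (r / (s + r))
            positivity
          exact le_add_of_nonneg_left this
      _ = 2 * ∫ x, |u x| ^ (2 * logExp n) * (logProd (m + 1) (‖x‖ / M) ^ logExp n *
        (logExp n * logProd (m + 1) (‖x‖ / M) * ξ ‖x‖ / ‖x‖ + ξ' ‖x‖)) := by
          rw [← integral_const_mul]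
          congr 1; ext x; ring
      _ ≤ 2 * (2 * 2 * Real.exp 4 * gradMass D M ε ν u m) := by
          gcongr
          refine hr.trans ?_
          have h2 : (∫ x, |u x| ^ (2 * logExp n - 1)
              * ‖groundGrad m M (1 / (2 * D)) ε ν u x‖ *
              (logProd (m + 1) (‖x‖ / M) ^ logExp n * ξ ‖x‖)) ≤ gradMass D M ε ν u m := by
            refine h.integral_groundGrad_mul_mono m
              (f := fun r => logProd (m + 1) (r / M) ^ logExp n * ξ r) (hη.mul hξc) hη
              fun r hr => ?_
            have hηr := h.logProd_pos' (m + 1) hr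
            refine mul_le_of_le_one_right (by positivity) (Real.sqrt_le_one.2 ?_)
            have := hr.1
            have := hs.1
            rw [div_le_one (by positivity)]
            linarith
          calc _ ≤ 2 * logExp n * Real.exp 4 * gradMass D M ε ν u m := by gcongr
            _ ≤ _ := mul_le_mul_of_nonneg_right (by gcongr) hG
      _ = _ := by ring
  have h2 : logProd (m + 1) (s / M) ^ logExp n *
      (∫ x, |u x| ^ (2 * logExp n - 1) * ‖groundGrad m M (1 / (2 * D)) ε ν u x‖ * logBump s ‖x‖) ≤
      gradMass D M ε ν u m := by
    rw [← integral_const_mul]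
    calc _ = ∫ x, |u x| ^ (2 * logExp n - 1) * ‖groundGrad m M (1 / (2 * D)) ε ν u x‖ *
          (logProd (m + 1) (s / M) ^ logExp n * logBump s ‖x‖) := by
          congr 1; ext x; ring
      _ ≤ _ := h.integral_groundGrad_mul_mono m
          (f := fun r => logProd (m + 1) (s / M) ^ logExp n * logBump s r)
          (continuousOn_const.mul (continuousOn_logBump hs)) hη
          fun r hr => h.logProd_rpow_mul_logBump_le' (m + 1) hr hs
  unfold localMass
  linarith

theorem mem_radii (h : CapTest D M ε ν u) (j : ℕ) : D / 16 ^ j ∈ Ioc 0 D :=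
  ⟨div_pos h.hD (by positivity), div_le_self h.hD.le (one_le_pow₀ (by norm_num))⟩

/-- The estimate over all scales, with the extra power of `η`: the weighted bumps sum to a multiple
of `η^{α+1}`, so the first part reduces to `integral_hardy_le`; in the second part `η ≤ 1` gives
`η^{α+1} ≤ η^α`. -/
theorem sum_localMass_le (h : CapTest D M ε ν u) (m K : ℕ) :
    ∑ j ∈ Finset.range K, logProd (m + 1) (D / 16 ^ j / M) ^ (logExp n + 1)
      * localMass D M ε ν u m (D / 16 ^ j) ≤ 8 * (4 * Real.exp 4 + 1) * gradMass D M ε ν u m := by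
  obtain ⟨hα1, hα2⟩ := logExp_bounds h.hn
  have hs := h.mem_radii
  have hη := h.continuousOn_logProd_rpow (m + 1) (logExp n)
  have hη1 := h.continuousOn_logProd_rpow (m + 1) (logExp n + 1)
  let c : ℕ → ℝ := fun j => logProd (m + 1) (D / 16 ^ j / M) ^ (logExp n + 1)
  have hsumc : ContinuousOn (fun r => ∑ j ∈ Finset.range K, c j * logBump (D / 16 ^ j) r)
      (Ioc 0 D) :=
    continuousOn_finsetSum _ fun j _ => continuousOn_const.mul (continuousOn_logBump (hs j))
  have h1 : ∑ j ∈ Finset.range K, c j *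
      (∫ x, |u x| ^ (2 * logExp n) * (logBump (D / 16 ^ j) ‖x‖ / ‖x‖)) ≤
      8 * (4 * Real.exp 4 * gradMass D M ε ν u m) := by
    simp only [← integral_const_mul]
    rw [← integral_finsetSum _ fun j _ =>
      (h.integrable_pow_mul_comp (continuousOn_logBump_div (hs j))).const_mul _]
    calc _ = ∫ x, |u x| ^ (2 * logExp n) *
          ((∑ j ∈ Finset.range K, c j * logBump (D / 16 ^ j) ‖x‖) / ‖x‖) := by
          congr 1; ext x
          rw [Finset.sum_div, Finset.mul_sum]
          refine Finset.sum_congr rfl fun j _ => by ring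
      _ ≤ ∫ x, |u x| ^ (2 * logExp n) *
          (8 * (logProd (m + 1) (‖x‖ / M) ^ (logExp n + 1) / ‖x‖)) := by
          refine h.integral_mul_mono
            (f := fun r => (∑ j ∈ Finset.range K, c j * logBump (D / 16 ^ j) r) / r)
            (g := fun r => 8 * (logProd (m + 1) (r / M) ^ (logExp n + 1) / r))
            (hsumc.div continuousOn_id fun r hr => hr.1.ne')
            (continuousOn_const.mul (hη1.div continuousOn_id fun r hr => hr.1.ne')) fun r hr => ?_
          have hr0 := hr.1
          rw [← mul_div_assoc]
          gcongr
          exact h.sum_logBump_le (m + 1) hr K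
      _ = 8 * ∫ x, |u x| ^ (2 * logExp n) *
          (logProd (m + 1) (‖x‖ / M) ^ (logExp n + 1) / ‖x‖) := by
          rw [← integral_const_mul]
          congr 1; ext x; ring
      _ ≤ _ := by
          gcongr
          exact h.integral_hardy_le m
  have h2 : ∑ j ∈ Finset.range K, c j *
      (∫ x, |u x| ^ (2 * logExp n - 1) * ‖groundGrad m M (1 / (2 * D)) ε ν u x‖
        * logBump (D / 16 ^ j) ‖x‖) ≤ 8 * gradMass D M ε ν u m := by
    simp only [← integral_const_mul]
    rw [← integral_finsetSum _ fun j _ =>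
      (h.integrable_groundGrad_mul_comp m (continuousOn_logBump (hs j))).const_mul _]
    calc _ = ∫ x, |u x| ^ (2 * logExp n - 1) * ‖groundGrad m M (1 / (2 * D)) ε ν u x‖ *
          (∑ j ∈ Finset.range K, c j * logBump (D / 16 ^ j) ‖x‖) := by
          congr 1; ext x
          rw [Finset.mul_sum]
          refine Finset.sum_congr rfl fun j _ => by ring
      _ ≤ ∫ x, |u x| ^ (2 * logExp n - 1) * ‖groundGrad m M (1 / (2 * D)) ε ν u x‖ *
          (8 * logProd (m + 1) (‖x‖ / M) ^ logExp n) := by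
          refine h.integral_groundGrad_mul_mono m
            (f := fun r => ∑ j ∈ Finset.range K, c j * logBump (D / 16 ^ j) r)
            (g := fun r => 8 * logProd (m + 1) (r / M) ^ logExp n)
            hsumc (continuousOn_const.mul hη) fun r hr => ?_
          refine (h.sum_logBump_le (m + 1) hr K).trans
            (mul_le_mul_of_nonneg_left ?_ (by norm_num))
          exact Real.rpow_le_rpow_of_exponent_ge (h.logProd_pos' _ hr)
            (logProd_le_one _ (h.div_mem_Ioo hr)) (by linarith)
      _ = _ := by
          unfold gradMass
          rw [← integral_const_mul]
          congr 1; ext x; ring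
  unfold localMass
  simp only [mul_add, Finset.sum_add_distrib]
  linarith

/-- The weighted critical integral. -/
noncomputable def critMass (M : ℝ) (u : EuclideanSpace ℝ (Fin n) → ℝ) (m : ℕ) : ℝ :=
  ∫ x, logProd (m + 1) (‖x‖ / M) ^ (2 * logExp n) * |u x| ^ (2 * (n : ℝ) / (n - 2))

end CapTest

theorem logExp_mul (hn : 3 ≤ n) : 2 * logExp n * ((n : ℝ) / (n - 1)) = 2 * n / (n - 2) := by
  have hn' : (3 : ℝ) ≤ n := by exact_mod_cast hn
  have h1 : (n : ℝ) - 1 ≠ 0 := by linarith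
  have h2 : (n : ℝ) - 2 ≠ 0 := by linarith
  unfold logExp
  field_simp

/-- The exponent count: the power `q - 1` of the one-scale estimate and the first power of the
summed estimate combine to the weight `η^{2α}`, with `q = n/(n-1)`. -/
theorem logExp_mul_sub (hn : 3 ≤ n) :
    logExp n * ((n : ℝ) / (n - 1) - 1) + (logExp n + 1) = 2 * logExp n := by
  have hn' : (3 : ℝ) ≤ n := by exact_mod_cast hn
  have h1 : (n : ℝ) - 1 ≠ 0 := by linarith
  have h2 : (n : ℝ) - 2 ≠ 0 := by linarith
  unfold logExp
  field_simp
  ring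

namespace CapTest

/-- The `L¹` Sobolev inequality is applied on each scale to `|u|^{2α}` times a bump, where `2αq` is
the critical exponent. Summing `η(s_j)^{2α} e_j^q` is possible because `q > 1`: the power `q - 1` is
bounded uniformly and the rest is summed. -/
theorem exists_critMass_le_gradMass (hn : 3 ≤ n) :
    ∃ C : ℝ, 0 ≤ C ∧ ∀ (D M ε : ℝ) (ν : EuclideanSpace ℝ (Fin n))
      (u : EuclideanSpace ℝ (Fin n) → ℝ) (m : ℕ), CapTest D M ε ν u →
      critMass M u m ≤ C * gradMass D M ε ν u m ^ ((n : ℝ) / (n - 1)) := by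
  have hn' : (3 : ℝ) ≤ n := by exact_mod_cast hn
  obtain ⟨Cg, hCg, hgns⟩ := exists_gagliardo_nirenberg hn
  obtain ⟨hα1, hα2⟩ := logExp_bounds hn
  have hmul := logExp_mul hn
  have hmul' := logExp_mul_sub hn
  have hcrit : (0 : ℝ) < 2 * n / (n - 2) := by apply div_pos <;> linarith
  have hq1 : 1 < (n : ℝ) / (n - 1) := by rw [lt_div_iff₀ (by linarith)]; linarith
  have hcm : ∀ (D M ε : ℝ) (ν : EuclideanSpace ℝ (Fin n))
      (u : EuclideanSpace ℝ (Fin n) → ℝ) (m : ℕ), critMass M u m =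
      ∫ x, |u x| ^ (2 * (n : ℝ) / (n - 2)) * logProd (m + 1) (‖x‖ / M) ^ (2 * logExp n) := by
    intro D M ε ν u m
    unfold critMass
    congr 1; ext x; ring
  set q : ℝ := (n : ℝ) / (n - 1) with hq
  set α := logExp n with hα
  refine ⟨(289 / 16) ^ q * (Cg * (9 * (4 * n + 5)) ^ q) * ((8 * Real.exp 4 + 1) ^ (q - 1)
    * (8 * (4 * Real.exp 4 + 1))), by positivity, fun D M ε ν u m h => ?_⟩
  have hG := h.gradMass_nonneg m
  obtain ⟨K, hK⟩ := h.exists_cover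
  have hs := h.mem_radii
  let c : ℕ → ℝ := fun j => logProd (m + 1) (D / 16 ^ j / M)
  have hc : ∀ j, 0 < c j := fun j => h.logProd_pos' (m + 1) (hs j)
  let w : ℕ → EuclideanSpace ℝ (Fin n) → ℝ := fun j x =>
    |u x| ^ (2 * α) * logBump (D / 16 ^ j) ‖x‖
  have hw1 : ∀ j, ContDiff ℝ 1 (w j) := fun j =>
    h.contDiff_mul_comp_norm (contDiffOn_logBump (hs j).1)
  have hne0 : 2 * α ≠ 0 := by positivity
  have hw2 : ∀ j, HasCompactSupport (w j) := fun j =>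
    h.hc.mono fun x hx h' => hx (by simp [w, h', hne0])
  have hwi : ∀ j, Integrable (fun x => |w j x| ^ q) := fun j =>
    ((hw1 j).continuous.abs.rpow_const fun _ => Or.inr (by linarith)).integrable_of_hasCompactSupport
      ((hw2 j).mono fun x hx h' => hx (by simp [h', show q ≠ 0 by linarith]))
  have hlocal : ∀ j, c j ^ (2 * α) * ∫ x, |w j x| ^ q ≤ Cg * (9 * (4 * n + 5)) ^ q *
      (((8 * Real.exp 4 + 1) * gradMass D M ε ν u m) ^ (q - 1) *
      (c j ^ (α + 1) * localMass D M ε ν u m (D / 16 ^ j))) := by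
    intro j
    have he := h.localMass_nonneg m (hs j)
    have h1 := h.integral_norm_fderiv_le m (contDiffOn_logBump (hs j).1)
      (fun r hr => logBump_nonneg (hs j).1 hr) fun r hr => abs_deriv_logBump_le (hs j).1 hr
    have h2 := h.rpow_mul_localMass_le m (hs j)
    -- The first factor is bounded by `rpow_mul_localMass_le`, the second is summed by
    -- `sum_localMass_le`. The case of zero mass is separate because of the division in the exponent
    -- law.
    have hsplit : c j ^ (2 * α) * localMass D M ε ν u m (D / 16 ^ j) ^ q =
        (c j ^ α * localMass D M ε ν u m (D / 16 ^ j)) ^ (q - 1) *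
          (c j ^ (α + 1) * localMass D M ε ν u m (D / 16 ^ j)) := by
      rw [Real.mul_rpow (Real.rpow_nonneg (hc j).le _) he, ← Real.rpow_mul (hc j).le, ← hmul',
        Real.rpow_add (hc j)]
      rcases he.eq_or_lt with h0 | h0
      · rw [← h0, Real.zero_rpow (by linarith), Real.zero_rpow (by linarith)]
        ring
      · rw [Real.rpow_sub_one h0.ne']
        field_simp
    calc c j ^ (2 * α) * ∫ x, |w j x| ^ q
        ≤ c j ^ (2 * α) * (Cg * (∫ x, ‖fderiv ℝ (w j) x‖) ^ q) := by
          gcongr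
          · exact Real.rpow_nonneg (hc j).le _
          · exact hgns _ (hw1 j) (hw2 j)
      _ ≤ c j ^ (2 * α) * (Cg * (9 * (4 * n + 5) * localMass D M ε ν u m (D / 16 ^ j)) ^ q) := by
          refine mul_le_mul_of_nonneg_left (mul_le_mul_of_nonneg_left ?_ hCg)
            (Real.rpow_nonneg (hc j).le _)
          exact Real.rpow_le_rpow (integral_nonneg fun x => norm_nonneg _) h1 (by linarith)
      _ = Cg * (9 * (4 * n + 5)) ^ q *
          (c j ^ (2 * α) * localMass D M ε ν u m (D / 16 ^ j) ^ q) := by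
          rw [Real.mul_rpow (by positivity) he]
          ring
      _ ≤ _ := by
          rw [hsplit]
          have := hc j
          gcongr
  -- Every point of the support is seen by one scale with bump at least `16/289` and with a weight
  -- at least as large as its own.
  have hA : critMass M u m ≤ (289 / 16) ^ q * ∑ j ∈ Finset.range K,
      c j ^ (2 * α) * ∫ x, |w j x| ^ q := by
    rw [hcm D M ε ν u m]
    simp only [← integral_const_mul]
    rw [← integral_finsetSum _ fun j _ => (hwi j).const_mul _, ← integral_const_mul]
    refine integral_mono ?_ ((integrable_finsetSum _ fun j _ =>
      (hwi j).const_mul _).const_mul _) fun x => ?_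
    · exact integrable_mul_of_continuousOn h.hu h.hc hcrit
        (h.continuousOn_comp_norm (h.continuousOn_logProd_rpow (m + 1) (2 * α)))
    · beta_reduce
      have hnonneg : ∀ j ∈ Finset.range K, 0 ≤ c j ^ (2 * α) * |w j x| ^ q := fun j _ => by
        have := hc j
        positivity
      by_cases hx : x ∈ tsupport u
      · obtain ⟨k, hk, hxk, hbk⟩ := hK x hx
        have hr := h.norm_mem hx
        refine le_trans ?_ (mul_le_mul_of_nonneg_left (Finset.single_le_sum hnonneg hk)
          (by positivity))
        have hb0 := logBump_nonneg (hs k).1 hr.1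
        have e : |w k x| ^ q = |u x| ^ (2 * (n : ℝ) / (n - 2)) * logBump (D / 16 ^ k) ‖x‖ ^ q := by
          simp only [w]
          rw [abs_of_nonneg (by positivity), Real.mul_rpow (by positivity) hb0,
            ← Real.rpow_mul (abs_nonneg _), hmul]
        have h1 : 1 ≤ (289 / 16 : ℝ) ^ q * logBump (D / 16 ^ k) ‖x‖ ^ q := by
          rw [← Real.mul_rpow (by norm_num) hb0]
          exact Real.one_le_rpow (by linarith) (by linarith)
        have h2 : logProd (m + 1) (‖x‖ / M) ^ (2 * α) ≤ c k ^ (2 * α) :=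
          Real.rpow_le_rpow (h.logProd_pos' _ hr).le (h.logProd_mono _ hr (hs k) hxk) (by linarith)
        rw [e]
        calc |u x| ^ (2 * (n : ℝ) / (n - 2)) * logProd (m + 1) (‖x‖ / M) ^ (2 * α)
            ≤ |u x| ^ (2 * (n : ℝ) / (n - 2)) * c k ^ (2 * α) := by gcongr
          _ ≤ |u x| ^ (2 * (n : ℝ) / (n - 2)) * c k ^ (2 * α)
              * ((289 / 16 : ℝ) ^ q * logBump (D / 16 ^ k) ‖x‖ ^ q) := by
              refine le_mul_of_one_le_right ?_ h1
              have := hc k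
              positivity
          _ = _ := by ring
      · rw [image_eq_zero_of_notMem_tsupport hx, abs_zero, Real.zero_rpow hcrit.ne', zero_mul]
        exact mul_nonneg (by positivity) (Finset.sum_nonneg hnonneg)
  calc critMass M u m ≤ (289 / 16) ^ q * ∑ j ∈ Finset.range K,
        c j ^ (2 * α) * ∫ x, |w j x| ^ q := hA
    _ ≤ (289 / 16) ^ q * ∑ j ∈ Finset.range K, Cg * (9 * (4 * n + 5)) ^ q *
      (((8 * Real.exp 4 + 1) * gradMass D M ε ν u m) ^ (q - 1) *
      (c j ^ (α + 1) * localMass D M ε ν u m (D / 16 ^ j))) := by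
        exact mul_le_mul_of_nonneg_left (Finset.sum_le_sum fun j _ => hlocal j) (by positivity)
    _ = (289 / 16) ^ q * (Cg * (9 * (4 * n + 5)) ^ q *
      (((8 * Real.exp 4 + 1) * gradMass D M ε ν u m) ^ (q - 1) *
      ∑ j ∈ Finset.range K, (c j ^ (α + 1) * localMass D M ε ν u m (D / 16 ^ j)))) := by
        rw [Finset.mul_sum, Finset.mul_sum, Finset.mul_sum, Finset.mul_sum]
    _ ≤ (289 / 16) ^ q * (Cg * (9 * (4 * n + 5)) ^ q *
      (((8 * Real.exp 4 + 1) * gradMass D M ε ν u m) ^ (q - 1) *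
      (8 * (4 * Real.exp 4 + 1) * gradMass D M ε ν u m))) := by
        gcongr
        exact h.sum_localMass_le m K
    _ = _ := by
        rw [Real.mul_rpow (by positivity) hG]
        rcases hG.eq_or_lt with h0 | h0
        · rw [← h0, Real.zero_rpow (show q ≠ 0 by linarith)]
          ring
        · rw [Real.rpow_sub_one h0.ne']
          field_simp

/-- Cauchy–Schwarz between `η^α |u|^{2α-1}` and `groundGrad`, using `2(2α-1) = 2n/(n-2)`. It is read
off from the discriminant of a nonnegative quadratic polynomial. -/
theorem gradMass_sq_le {D M ε : ℝ} {ν : EuclideanSpace ℝ (Fin n)}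
    {u : EuclideanSpace ℝ (Fin n) → ℝ} (h : CapTest D M ε ν u) (m : ℕ) :
    gradMass D M ε ν u m ^ 2 ≤
      critMass M u m * ∫ x, ‖groundGrad m M (1 / (2 * D)) ε ν u x‖ ^ 2 := by
  have hn' : (3 : ℝ) ≤ n := by exact_mod_cast h.hn
  obtain ⟨hα1, hα2⟩ := logExp_bounds h.hn
  have hcrit : (0 : ℝ) < 2 * n / (n - 2) := by apply div_pos <;> linarith
  have hexp : 2 * (2 * logExp n - 1) = 2 * (n : ℝ) / (n - 2) := by
    have h2 : (n : ℝ) - 2 ≠ 0 := by linarith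
    unfold logExp
    field_simp
    ring
  have i1 := (ground_state_identity m (δ := 1 / (2 * D)) h.hν h.hu h.hc h.subset_goodSet).1
  have i2 := h.integrable_groundGrad_mul_comp m (h.continuousOn_logProd_rpow (m + 1) (logExp n))
  have i3 : Integrable (fun x => logProd (m + 1) (‖x‖ / M) ^ (2 * logExp n)
      * |u x| ^ (2 * (n : ℝ) / (n - 2))) := by
    refine (integrable_mul_of_continuousOn h.hu h.hc hcrit
      (h.continuousOn_comp_norm (h.continuousOn_logProd_rpow (m + 1) (2 * logExp n)))).congr
      (Filter.Eventually.of_forall fun x => mul_comm _ _)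
  have hdisc := discrim_le_zero (a := critMass M u m) (b := -2 * gradMass D M ε ν u m)
    (c := ∫ x, ‖groundGrad m M (1 / (2 * D)) ε ν u x‖ ^ 2) fun t => by
      unfold critMass gradMass
      rw [← integral_mul_const, ← integral_const_mul, ← integral_mul_const,
        ← integral_add (i3.mul_const _) ((i2.const_mul _).mul_const _),
        ← integral_add _ i1]
      · refine integral_nonneg fun x => ?_
        change (0 : ℝ) ≤ _
        by_cases hx : x ∈ tsupport u
        · have hη := h.logProd_pos' (m + 1) (h.norm_mem hx)
          have e1 : logProd (m + 1) (‖x‖ / M) ^ (2 * logExp n)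
              = (logProd (m + 1) (‖x‖ / M) ^ logExp n) ^ 2 := by
            rw [← Real.rpow_natCast, ← Real.rpow_mul hη.le, mul_comm]
            norm_num
          have e2 : |u x| ^ (2 * (n : ℝ) / (n - 2)) = (|u x| ^ (2 * logExp n - 1)) ^ 2 := by
            rw [← Real.rpow_natCast, ← Real.rpow_mul (abs_nonneg _), ← hexp]
            congr 1
            push_cast
            ring
          rw [e1, e2]
          nlinarith [sq_nonneg (t * (logProd (m + 1) (‖x‖ / M) ^ logExp n
            * |u x| ^ (2 * logExp n - 1)) - ‖groundGrad m M (1 / (2 * D)) ε ν u x‖)]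
        · simp [groundGrad_eq_zero m M _ ε ν hx, image_eq_zero_of_notMem_tsupport hx,
            Real.zero_rpow hcrit.ne']
      · exact (i3.mul_const _).add ((i2.const_mul _).mul_const _)
  unfold discrim at hdisc
  linarith

/-- The Sobolev inequality for the ground state. -/
theorem exists_sobolev (hn : 3 ≤ n) :
    ∃ C : ℝ, 0 < C ∧ ∀ (D M ε : ℝ) (ν : EuclideanSpace ℝ (Fin n))
      (u : EuclideanSpace ℝ (Fin n) → ℝ) (m : ℕ), CapTest D M ε ν u →
      C * critMass M u m ^ (((n : ℝ) - 2) / n) ≤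
        ∫ x, ‖groundGrad m M (1 / (2 * D)) ε ν u x‖ ^ 2 := by
  have hn' : (3 : ℝ) ≤ n := by exact_mod_cast hn
  obtain ⟨C, hC, hcm⟩ := exists_critMass_le_gradMass hn
  -- `C + 1` replaces `C`, which might be zero.
  refine ⟨(C + 1) ^ (-(2 * ((n : ℝ) - 1) / n)), by positivity, fun D M ε ν u m h => ?_⟩
  have h1 := hcm D M ε ν u m h
  have h2 := h.gradMass_sq_le m
  have hG := h.gradMass_nonneg m
  have hE : 0 ≤ ∫ x, ‖groundGrad m M (1 / (2 * D)) ε ν u x‖ ^ 2 :=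
    integral_nonneg fun x => by positivity
  have hA : 0 ≤ critMass M u m := by
    refine integral_nonneg fun x => ?_
    beta_reduce
    by_cases hx : x ∈ tsupport u
    · have := h.logProd_pos' (m + 1) (h.norm_mem hx)
      positivity
    · have hcrit : (0 : ℝ) < 2 * n / (n - 2) := by apply div_pos <;> linarith
      simp [image_eq_zero_of_notMem_tsupport hx, Real.zero_rpow hcrit.ne']
  generalize ∫ x, ‖groundGrad m M (1 / (2 * D)) ε ν u x‖ ^ 2 = E at *
  generalize gradMass D M ε ν u m = G at *
  generalize critMass M u m = A at *
  have hr : 0 < ((n : ℝ) - 2) / n := by apply div_pos <;> linarith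
  rcases hA.eq_or_lt with h0 | h0
  · rw [← h0, Real.zero_rpow hr.ne', mul_zero]
    exact hE
  have hp : (0 : ℝ) < 2 * (n - 1) / n := by apply div_pos <;> linarith
  -- The power `2(n-1)/n` turns `G^{n/(n-1)}` into `G²`, so Cauchy–Schwarz applies; one factor `A`
  -- then cancels.
  have h3 : A ^ (2 * ((n : ℝ) - 1) / n) ≤ (C + 1) ^ (2 * ((n : ℝ) - 1) / n) * (A * E) := by
    calc A ^ (2 * ((n : ℝ) - 1) / n)
        ≤ ((C + 1) * G ^ ((n : ℝ) / (n - 1))) ^ (2 * ((n : ℝ) - 1) / n) := by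
          refine Real.rpow_le_rpow hA (h1.trans ?_) hp.le
          gcongr
          linarith
      _ = (C + 1) ^ (2 * ((n : ℝ) - 1) / n) * G ^ 2 := by
          rw [Real.mul_rpow (by positivity) (by positivity), ← Real.rpow_mul hG,
            ← Real.rpow_natCast G 2]
          congr 2
          have : (n : ℝ) - 1 ≠ 0 := by linarith
          push_cast
          field_simp
      _ ≤ _ := by gcongr
  have h4 : A ^ (2 * ((n : ℝ) - 1) / n) = A ^ (((n : ℝ) - 2) / n) * A := by
    rw [← Real.rpow_add_one h0.ne']
    congr 1
    field_simp
    ring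
  rw [h4] at h3
  have h5 : A ^ (((n : ℝ) - 2) / n) ≤ (C + 1) ^ (2 * ((n : ℝ) - 1) / n) * E := by
    refine le_of_mul_le_mul_right ?_ h0
    linarith
  rw [Real.rpow_neg (by positivity), inv_mul_le_iff₀ (by positivity)]
  exact h5

end CapTest

end Sobolev


/-! ### The improved Hardy–Sobolev inequality -/

section ImprovedInequality

variable {n : ℕ}

theorem sum_Icc_one_eq_sum_range (f : ℕ → ℝ) (m : ℕ) :
    ∑ i ∈ Finset.Icc 1 m, f i = ∑ i ∈ Finset.range m, f (i + 1) := by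
  induction m with
  | zero => simp
  | succ m ih => rw [Finset.sum_Icc_succ_top (by omega), ih, Finset.sum_range_succ]

theorem hardy_terms_integral (m : ℕ) {M ε : ℝ} {ν : EuclideanSpace ℝ (Fin n)}
    {u : EuclideanSpace ℝ (Fin n) → ℝ} (hu : Continuous u) (hc : HasCompactSupport u)
    (hs : tsupport u ⊆ goodSet M ε ν) :
    Integrable (fun x => u x ^ 2 * (((n : ℝ) ^ 2 / 4
      + 1 / 4 * ∑ i ∈ Finset.range m, logProd (i + 1) (‖x‖ / M) ^ 2) / ‖x‖ ^ 2)) ∧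
    ∫ x, u x ^ 2 * (((n : ℝ) ^ 2 / 4
      + 1 / 4 * ∑ i ∈ Finset.range m, logProd (i + 1) (‖x‖ / M) ^ 2) / ‖x‖ ^ 2) =
    (n : ℝ) ^ 2 / 4 * (∫ x, u x ^ 2 / ‖x‖ ^ 2)
      + 1 / 4 * ∑ i ∈ Finset.Icc 1 m, ∫ x, u x ^ 2 / ‖x‖ ^ 2 * logProd i (‖x‖ / M) ^ 2 := by
  have hu0 : ∀ x ∉ tsupport u, u x = 0 := fun x hx => image_eq_zero_of_notMem_tsupport hx
  have c0 : ContinuousOn (fun x => u x ^ 2 / ‖x‖ ^ 2) (tsupport u) :=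
    ContinuousOn.div (hu.pow 2).continuousOn (continuous_norm.pow 2).continuousOn
      fun x hx => pow_ne_zero _ (norm_ne_zero_iff.2 (hs hx).1)
  have i0 : Integrable (fun x => u x ^ 2 / ‖x‖ ^ 2) :=
    integrable_of_continuousOn_compact hc c0 fun x hx => by simp [hu0 x hx]
  have i1 : ∀ i, Integrable (fun x => u x ^ 2 / ‖x‖ ^ 2 * logProd i (‖x‖ / M) ^ 2) := fun i =>
    integrable_of_continuousOn_compact hc
      (c0.mul (((continuousOn_comp_norm_div (logProd_continuousOn i) M ε ν).mono hs).pow 2))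
      fun x hx => by simp [hu0 x hx]
  have e : (fun x => u x ^ 2 * (((n : ℝ) ^ 2 / 4
      + 1 / 4 * ∑ i ∈ Finset.range m, logProd (i + 1) (‖x‖ / M) ^ 2) / ‖x‖ ^ 2)) = fun x =>
      (n : ℝ) ^ 2 / 4 * (u x ^ 2 / ‖x‖ ^ 2) + 1 / 4 * ∑ i ∈ Finset.range m,
        u x ^ 2 / ‖x‖ ^ 2 * logProd (i + 1) (‖x‖ / M) ^ 2 := by
    ext x
    rw [← Finset.mul_sum]
    ring
  have i2 : Integrable (fun x => ∑ i ∈ Finset.range m,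
        u x ^ 2 / ‖x‖ ^ 2 * logProd (i + 1) (‖x‖ / M) ^ 2) :=
    integrable_finsetSum _ fun i _ => i1 (i + 1)
  rw [e]
  refine ⟨(i0.const_mul _).add (i2.const_mul _), ?_⟩
  rw [integral_add (i0.const_mul _) (i2.const_mul _), integral_const_mul, integral_const_mul,
    integral_finsetSum _ fun i _ => i1 (i + 1), sum_Icc_one_eq_sum_range]

theorem norm_le_supNorm {Ω : Set (EuclideanSpace ℝ (Fin n))} (hb : Bornology.IsBounded Ω)
    {x : EuclideanSpace ℝ (Fin n)} (hx : x ∈ Ω) : ‖x‖ ≤ supNorm Ω := by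
  obtain ⟨R, hR⟩ := hb.exists_norm_le
  exact le_csSup ⟨R, by rintro _ ⟨y, hy, rfl⟩; exact hR y hy⟩ ⟨x, hx, rfl⟩

theorem ne_zero_of_mem_of_frontier {Ω : Set (EuclideanSpace ℝ (Fin n))} (ho : IsOpen Ω)
    (h0 : (0 : EuclideanSpace ℝ (Fin n)) ∈ frontier Ω) {x : EuclideanSpace ℝ (Fin n)}
    (hx : x ∈ Ω) : x ≠ 0 := by
  rintro rfl
  rw [ho.frontier_eq] at h0
  exact h0.2 hx

/-- `2ρ sphFun = |x + ρν|² - ρ²` for `ε = 1/(2ρ)`. The strict sign holds because the open set `Ω`,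
missing the open ball, also misses its closure. -/
theorem sphFun_pos_of_exteriorBall {Ω : Set (EuclideanSpace ℝ (Fin n))} (ho : IsOpen Ω) {ρ : ℝ}
    (hρ : 0 < ρ) {ν : EuclideanSpace ℝ (Fin n)} (hν : ‖ν‖ = 1)
    (hball : ball (-(ρ • ν)) ρ ⊆ (closure Ω)ᶜ) {x : EuclideanSpace ℝ (Fin n)} (hx : x ∈ Ω) :
    0 < sphFun (1 / (2 * ρ)) ν x := by
  have h1 : closedBall (-(ρ • ν)) ρ ⊆ Ωᶜ := by
    rw [← closure_ball _ hρ.ne']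
    exact closure_minimal (hball.trans (compl_subset_compl.2 subset_closure)) ho.isClosed_compl
  have h2 : ρ < ‖x + ρ • ν‖ := by
    by_contra h
    exact h1 (by rw [mem_closedBall, dist_eq_norm, sub_neg_eq_add]; exact not_lt.1 h) hx
  have h3 : ρ ^ 2 < ‖x + ρ • ν‖ ^ 2 := by gcongr
  rw [norm_add_sq_real, inner_smul_right, norm_smul, hν, mul_one, Real.norm_eq_abs, sq_abs,
    real_inner_comm] at h3
  have h4 : sphFun (1 / (2 * ρ)) ν x = (‖x‖ ^ 2 + 2 * (ρ * inner ℝ ν x)) / (2 * ρ) := by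
    unfold sphFun
    field_simp
    ring
  rw [h4]
  apply div_pos <;> linarith

/-- In `ground_state_identity` the potential is bounded below by the Hardy series and the energy by
`exists_sobolev`. On the scale parameter only `M ≥ κD` is needed, which `M = 3κD` satisfies amply.
-/
theorem improved_inequality (hn : 3 ≤ n) : ∃ C > (0 : ℝ),
    ∀ (Ω : Set (EuclideanSpace ℝ (Fin n))) (ρ : ℝ),
      IsOpen Ω → IsConnected Ω → Bornology.IsBounded Ω → 0 ∈ frontier Ω →
      ExteriorBallAtZero Ω ρ → supNorm Ω / (1 / (64 * (n : ℝ) ^ 2)) ≤ ρ →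
      ∀ (m : ℕ) (u : EuclideanSpace ℝ (Fin n) → ℝ), IsTestFunction Ω u →
        (n : ℝ) ^ 2 / 4 * (∫ x in Ω, u x ^ 2 / ‖x‖ ^ 2)
          + 1 / 4 * (∑ i ∈ Finset.Icc 1 m,
              (∫ x in Ω, u x ^ 2 / ‖x‖ ^ 2 * logProd i (‖x‖ / (3 * kappa * supNorm Ω)) ^ 2))
          + C * (∫ x in Ω,
              logProd (m + 1) (‖x‖ / (3 * kappa * supNorm Ω))
                  ^ ((2 * (n : ℝ) - 2) / ((n : ℝ) - 2))
                * |u x| ^ (2 * (n : ℝ) / ((n : ℝ) - 2))) ^ (((n : ℝ) - 2) / (n : ℝ))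
          ≤ (∫ x in Ω, ‖∇ u x‖ ^ 2) := by
  have hn' : (3 : ℝ) ≤ n := by exact_mod_cast hn
  obtain ⟨C, hC, hsob⟩ := CapTest.exists_sobolev hn
  refine ⟨C, hC, ?_⟩
  rintro Ω ρ ho hconn hb h0 ⟨hρ, ν, hν, hball⟩ hρD m u ⟨hu, hc, hs⟩
  obtain ⟨x₀, hx₀⟩ := hconn.nonempty
  have hD : 0 < supNorm Ω := (norm_pos_iff.2 (ne_zero_of_mem_of_frontier ho h0 hx₀)).trans_le
    (norm_le_supNorm hb hx₀)
  have hk := kappa_spec.1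
  have hcap : CapTest (supNorm Ω) (3 * kappa * supNorm Ω) (1 / (2 * ρ)) ν u := by
    refine ⟨hn, hν, by positivity, ?_, hD, ?_, hu.of_le (by exact_mod_cast le_top), hc,
      fun x hx => ⟨ne_zero_of_mem_of_frontier ho h0 (hs hx), norm_le_supNorm hb (hs hx),
        sphFun_pos_of_exteriorBall ho hρ hν hball (hs hx)⟩⟩
    · rw [mul_one_div, div_le_one (by positivity)]
      rw [div_le_iff₀ (by positivity), mul_one_div, le_div_iff₀ (by positivity)] at hρD
      linarith
    · nlinarith [mul_pos (show 0 < kappa by linarith) hD]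
  have hu0 : ∀ x ∉ Ω, u x = 0 := fun x hx => image_eq_zero_of_notMem_tsupport fun h => hx (hs h)
  have hcrit : (2 * (n : ℝ) / (n - 2)) ≠ 0 := by
    have : (n : ℝ) - 2 ≠ 0 := by linarith
    positivity
  have hg0 : ∀ x ∉ Ω, ‖∇ u x‖ ^ 2 = 0 := fun x hx => by
    rw [gradient_eq_zero_of_notMem_tsupport fun h => hx (hs h)]
    simp
  rw [setIntegral_eq_integral_of_forall_compl_eq_zero hg0,
    setIntegral_eq_integral_of_forall_compl_eq_zero fun x hx => by simp [hu0 x hx],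
    setIntegral_eq_integral_of_forall_compl_eq_zero fun x hx => by simp [hu0 x hx, hcrit],
    Finset.sum_congr rfl fun i _ =>
      setIntegral_eq_integral_of_forall_compl_eq_zero fun x hx => by simp [hu0 x hx]]
  have hS := hsob _ _ _ ν u m hcap
  obtain ⟨i1, i2, hid⟩ := ground_state_identity m (δ := 1 / (2 * supNorm Ω)) hν hcap.hu hc
    hcap.subset_goodSet
  obtain ⟨i3, hterms⟩ := hardy_terms_integral m hu.continuous hc hcap.subset_goodSet
  rw [← hterms, hid]
  have hpot : ∫ x, u x ^ 2 * (((n : ℝ) ^ 2 / 4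
      + 1 / 4 * ∑ i ∈ Finset.range m, logProd (i + 1) (‖x‖ / (3 * kappa * supNorm Ω)) ^ 2)
        / ‖x‖ ^ 2) ≤ ∫ x, u x ^ 2 * groundPotential m (3 * kappa * supNorm Ω)
        (1 / (2 * supNorm Ω)) (1 / (2 * ρ)) ν x := by
    refine integral_mono i3 i2 fun x => ?_
    beta_reduce
    by_cases hx : x ∈ tsupport u
    · gcongr
      exact le_groundPotential hn m hν hcap.hε hcap.hεD hcap.hM (hcap.hs hx)
    · simp [image_eq_zero_of_notMem_tsupport hx]
  have hexp : 2 * logExp n = (2 * (n : ℝ) - 2) / (n - 2) := by unfold logExp; ring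
  unfold CapTest.critMass at hS
  rw [hexp] at hS
  linarith

end ImprovedInequality


/-! ### Radial profiles concentrated at one scale of the last logarithm -/

section RadialProfile

theorem exists_iterLog_eq (k : ℕ) : ∀ {τ : ℝ}, τ ∈ Ioo (0 : ℝ) 1 →
    ∃ t ∈ Ioo (0 : ℝ) 1, iterLog k t = τ := by
  induction k with
  | zero => exact fun h => ⟨_, h, rfl⟩
  | succ k ih =>
    intro τ hτ
    obtain ⟨t, ht, rfl⟩ := ih hτ
    have h1 := (one_lt_div ht.1).2 ht.2
    refine ⟨Real.exp (1 - 1 / t), ⟨Real.exp_pos _, by rw [Real.exp_lt_one_iff]; linarith⟩, ?_⟩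
    rw [iterLog_succ]
    congr 1
    simp [logX]

/-- A plateau function: `1` on `[2, 3]` and `0` outside `(1, 4)`, with `|Ψ'| ≤ B`. -/
structure IsPlateau (Ψ : ℝ → ℝ) (B : ℝ) : Prop where
  contDiff : ContDiff ℝ ∞ Ψ
  nonneg : ∀ t, 0 ≤ Ψ t
  le_one : ∀ t, Ψ t ≤ 1
  eq_one : ∀ t ∈ Icc (2 : ℝ) 3, Ψ t = 1
  eq_zero : ∀ t ∉ Ioo (1 : ℝ) 4, Ψ t = 0
  deriv_le : ∀ t, |deriv Ψ t| ≤ B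

theorem exists_bound_of_support_subset_Icc {f : ℝ → ℝ} (hf : Continuous f) {a b : ℝ}
    (h0 : ∀ t ∉ Icc a b, f t = 0) : ∃ B, ∀ t, |f t| ≤ B := by
  obtain ⟨B, hB⟩ := isCompact_Icc.exists_bound_of_continuousOn (s := Icc a b) hf.continuousOn
  refine ⟨max B 0, fun t => ?_⟩
  by_cases ht : t ∈ Icc a b
  · exact (hB t ht).trans (le_max_left _ _)
  · simp [h0 t ht]

theorem exists_isPlateau : ∃ Ψ B, IsPlateau Ψ B := by
  let f : ContDiffBump (5 / 2 : ℝ) := ⟨1 / 2, 3 / 2, by norm_num, by norm_num⟩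
  have hz : ∀ t ∉ Ioo (1 : ℝ) 4, f t = 0 := fun t ht => by
    have h : t ∉ Function.support f := by
      rw [f.support_eq, Real.ball_eq_Ioo]
      convert ht using 2
      simp only [f]
      norm_num
    simpa using h
  have hd0 : ∀ t ∉ Icc (1 : ℝ) 4, deriv f t = 0 := fun t ht => by
    have : f =ᶠ[nhds t] fun _ => 0 := by
      filter_upwards [isClosed_Icc.isOpen_compl.mem_nhds ht] with y hy
      exact hz y fun h => hy (Ioo_subset_Icc_self h)
    rw [this.deriv_eq]
    simp
  obtain ⟨B, hB⟩ := exists_bound_of_support_subset_Icc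
    ((f.contDiff (n := 1)).continuous_deriv le_rfl) hd0
  refine ⟨f, B, f.contDiff, fun t => f.nonneg, fun t => f.le_one, fun t ht => ?_, hz, hB⟩
  apply f.one_of_mem_closedBall
  rw [Real.closedBall_eq_Icc]
  simp only [f]
  constructor <;> linarith [ht.1, ht.2]

/-- The radial factor `r^{-n/2} (X₁⋯X_m)^{-1/2}(r/M)` of the ground state of the half space. -/
noncomputable def radFactor (n m : ℕ) (M r : ℝ) : ℝ :=
  r ^ (-(n : ℝ) / 2) * logProd m (r / M) ^ (-(1 / 2) : ℝ)

theorem radFactor_pos (n m : ℕ) {M r : ℝ} (hr : r ∈ Ioo 0 M) : 0 < radFactor n m M r := by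
  have hM : 0 < M := hr.1.trans hr.2
  have := logProd_pos m (t := r / M) ⟨div_pos hr.1 hM, (div_lt_one hM).2 hr.2⟩
  have := hr.1
  unfold radFactor
  positivity

theorem div_mem_Ioo_of_mem {M r : ℝ} (hr : r ∈ Ioo 0 M) : r / M ∈ Ioo (0 : ℝ) 1 := by
  have hM : 0 < M := hr.1.trans hr.2
  exact ⟨div_pos hr.1 hM, (div_lt_one hM).2 hr.2⟩

theorem radFactor_sq (n m : ℕ) {M r : ℝ} (hr : r ∈ Ioo 0 M) :
    radFactor n m M r ^ 2 = r ^ (-(n : ℝ)) * (logProd m (r / M))⁻¹ := by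
  have h1 := logProd_pos m (div_mem_Ioo_of_mem hr)
  unfold radFactor
  rw [mul_pow, ← Real.rpow_natCast, ← Real.rpow_natCast, ← Real.rpow_mul hr.1.le,
    ← Real.rpow_mul h1.le, ← Real.rpow_neg_one (logProd m (r / M))]
  congr 2
  · push_cast; ring
  · push_cast; ring

theorem hasDerivAt_radFactor (n m : ℕ) {M r : ℝ} (hr : r ∈ Ioo 0 M) :
    HasDerivAt (radFactor n m M) (radLog n m M 0 r * radFactor n m M r / r) r := by
  have h1 := logProd_pos m (div_mem_Ioo_of_mem hr)
  have hr0 := hr.1.ne'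
  have hM : M ≠ 0 := (hr.1.trans hr.2).ne'
  have h2 := (hasDerivAt_logProd m (div_mem_Ioo_of_mem hr)).comp r ((hasDerivAt_id r).div_const M)
  have h := (Real.hasDerivAt_rpow_const (p := -(n : ℝ) / 2) (Or.inl hr0)).mul
    (h2.rpow_const (p := -(1 / 2)) (Or.inl h1.ne'))
  refine h.congr_deriv ?_
  unfold radLog radFactor
  simp only [Function.comp, id]
  rw [Real.rpow_sub_one hr0, Real.rpow_sub_one h1.ne']
  field_simp
  ring

theorem contDiffOn_radFactor (n m : ℕ) (M : ℝ) : ContDiffOn ℝ ∞ (radFactor n m M) (Ioo 0 M) := by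
  unfold radFactor
  refine ContDiffOn.mul (contDiffOn_id.rpow_const_of_ne fun r hr => hr.1.ne') ?_
  refine ContDiffOn.rpow_const_of_ne ((logProd_contDiffOn m).comp (by fun_prop)
    fun r hr => div_mem_Ioo_of_mem hr) fun r hr => (logProd_pos m (div_mem_Ioo_of_mem hr)).ne'

/-- The reciprocal of the last iterated logarithm. -/
noncomputable def lastLog (m : ℕ) (M r : ℝ) : ℝ := 1 / iterLog (m + 1) (r / M)

theorem lastLog_pos (m : ℕ) {M r : ℝ} (hr : r ∈ Ioo 0 M) : 0 < lastLog m M r :=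
  one_div_pos.2 (iterLog_mem _ (div_mem_Ioo_of_mem hr)).1

theorem lastLog_strictAntiOn (m : ℕ) (M : ℝ) : StrictAntiOn (lastLog m M) (Ioo 0 M) := by
  intro r hr r' hr' h
  have hM : 0 < M := hr.1.trans hr.2
  exact one_div_lt_one_div_of_lt (iterLog_mem _ (div_mem_Ioo_of_mem hr)).1
    (iterLog_lt _ (div_pos hr.1 hM) (div_lt_div_of_pos_right h hM) (div_mem_Ioo_of_mem hr').2)

theorem exists_lastLog_eq (m : ℕ) {M : ℝ} (hM : 0 < M) {a : ℝ} (ha : 1 < a) :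
    ∃ r ∈ Ioo 0 M, lastLog m M r = a := by
  obtain ⟨t, ht, h⟩ := exists_iterLog_eq (m + 1) (τ := 1 / a)
    ⟨by positivity, (div_lt_one (by linarith)).2 ha⟩
  refine ⟨t * M, ⟨mul_pos ht.1 hM, by nlinarith [ht.2]⟩, ?_⟩
  unfold lastLog
  rw [mul_div_cancel_right₀ _ hM.ne', h, one_div_one_div]

/-- `1/X_{m+1}` is the natural variable here: the measure `X₁⋯X_m dr/r` becomes Lebesgue measure in
it. -/
theorem hasDerivAt_lastLog (m : ℕ) {M r : ℝ} (hr : r ∈ Ioo 0 M) :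
    HasDerivAt (lastLog m M) (-(logProd m (r / M) / r)) r := by
  have ht := div_mem_Ioo_of_mem hr
  have h0 := (iterLog_mem (m + 1) ht).1
  have hr0 := hr.1.ne'
  have hM : M ≠ 0 := (hr.1.trans hr.2).ne'
  have h1 : HasDerivAt (iterLog (m + 1) ∘ fun x => id x / M) _ r :=
    (hasDerivAt_iterLog (m + 1) ht).comp r ((hasDerivAt_id r).div_const M)
  have h := h1.inv h0.ne'
  have e : lastLog m M = (iterLog (m + 1) ∘ fun x => id x / M)⁻¹ := by
    ext x; simp [lastLog]
  rw [e]
  refine h.congr_deriv ?_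
  simp only [Function.comp, id]
  rw [logProd_succ_last]
  field_simp

theorem contDiffOn_lastLog (m : ℕ) (M : ℝ) : ContDiffOn ℝ ∞ (lastLog m M) (Ioo 0 M) := by
  unfold lastLog
  refine contDiffOn_const.div ((iterLog_contDiffOn (m + 1)).comp (by fun_prop)
    fun r hr => div_mem_Ioo_of_mem hr) fun r hr => (iterLog_mem _ (div_mem_Ioo_of_mem hr)).1.ne'

theorem logProd_succ_inv (m : ℕ) (M r : ℝ) :
    (logProd (m + 1) (r / M))⁻¹ = (logProd m (r / M))⁻¹ * lastLog m M r := by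
  rw [logProd_succ_last, mul_inv, lastLog, one_div]

/-- A compactly supported radial profile on the scale `1 / X_{m+1} ∈ [lam, 4 lam]`. -/
noncomputable def radProfile (n m : ℕ) (M : ℝ) (Ψ : ℝ → ℝ) (lam r : ℝ) : ℝ :=
  if r ∈ Ioo 0 M then radFactor n m M r * Ψ (lastLog m M r / lam) else 0

theorem radProfile_eq_zero (n m : ℕ) {M : ℝ} {Ψ : ℝ → ℝ} {B : ℝ} (hΨ : IsPlateau Ψ B) {lam : ℝ}
    (hlam : 0 < lam) {r : ℝ} (h : lastLog m M r ∉ Ioo lam (4 * lam)) :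
    radProfile n m M Ψ lam r = 0 := by
  unfold radProfile
  split_ifs
  · rw [hΨ.eq_zero, mul_zero]
    intro h'
    exact h ⟨by simpa using (lt_div_iff₀ hlam).1 h'.1, (div_lt_iff₀ hlam).1 h'.2⟩
  · rfl

theorem radProfile_nonneg (n m : ℕ) {M : ℝ} {Ψ : ℝ → ℝ} {B : ℝ} (hΨ : IsPlateau Ψ B) (lam r : ℝ) :
    0 ≤ radProfile n m M Ψ lam r := by
  unfold radProfile
  split_ifs with h
  · exact mul_nonneg (radFactor_pos n m h).le (hΨ.nonneg _)
  · exact le_rfl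

theorem radProfile_of_plateau (n m : ℕ) {M : ℝ} {Ψ : ℝ → ℝ} {B : ℝ} (hΨ : IsPlateau Ψ B)
    {lam : ℝ} (hlam : 0 < lam) {r : ℝ} (hr : r ∈ Ioo 0 M)
    (h : lastLog m M r ∈ Icc (2 * lam) (3 * lam)) :
    radProfile n m M Ψ lam r = radFactor n m M r := by
  rw [radProfile, if_pos hr, hΨ.eq_one, mul_one]
  exact ⟨(le_div_iff₀ hlam).2 h.1, (div_le_iff₀ hlam).2 h.2⟩

theorem radProfile_eventuallyEq (n m : ℕ) {M : ℝ} {Ψ : ℝ → ℝ} (lam : ℝ) {r : ℝ}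
    (hr : r ∈ Ioo 0 M) : radProfile n m M Ψ lam =ᶠ[nhds r]
      fun r => radFactor n m M r * Ψ (lastLog m M r / lam) := by
  filter_upwards [isOpen_Ioo.mem_nhds hr] with y hy
  rw [radProfile, if_pos hy]

theorem radProfile_contDiffAt (n m : ℕ) {M : ℝ} {Ψ : ℝ → ℝ} {B : ℝ} (hΨ : IsPlateau Ψ B)
    {lam : ℝ} {r : ℝ} (hr : r ∈ Ioo 0 M) :
    ContDiffAt ℝ ∞ (radProfile n m M Ψ lam) r := by
  refine ContDiffAt.congr_of_eventuallyEq ?_ (radProfile_eventuallyEq n m lam hr)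
  have hn := isOpen_Ioo.mem_nhds hr
  exact ((contDiffOn_radFactor n m M).contDiffAt hn).mul
    (hΨ.contDiff.contDiffAt.comp r (((contDiffOn_lastLog m M).contDiffAt hn).div_const lam))

/-- On the support of the profile `1 ≤ lastLog/λ`, so a factor `1/λ` is gained at the price of
replacing `1/(X₁⋯X_m)` by `1/(X₁⋯X_{m+1})`. Away from the boundary of the half space no such loss is
affordable, but in the thin cutoff region of the wedge it is. -/
theorem radProfile_sq_le (n m : ℕ) {M : ℝ} {Ψ : ℝ → ℝ} {B : ℝ} (hΨ : IsPlateau Ψ B) {lam : ℝ}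
    (hlam : 0 < lam) {r : ℝ} (hr : r ∈ Ioo 0 M) :
    radProfile n m M Ψ lam r ^ 2 ≤ 1 / lam * (r ^ (-(n : ℝ)) * (logProd (m + 1) (r / M))⁻¹) := by
  have h0 := hr.1
  have hη := logProd_pos m (div_mem_Ioo_of_mem hr)
  have hη' := logProd_pos (m + 1) (div_mem_Ioo_of_mem hr)
  by_cases h : lastLog m M r ∈ Ioo lam (4 * lam)
  · rw [radProfile, if_pos hr, mul_pow, radFactor_sq n m hr, logProd_succ_inv]
    have h1 : Ψ (lastLog m M r / lam) ^ 2 ≤ 1 := pow_le_one₀ (hΨ.nonneg _) (hΨ.le_one _)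
    have h2 : 1 ≤ lastLog m M r / lam := (one_le_div hlam).2 h.1.le
    calc r ^ (-(n : ℝ)) * (logProd m (r / M))⁻¹ * Ψ (lastLog m M r / lam) ^ 2
        ≤ r ^ (-(n : ℝ)) * (logProd m (r / M))⁻¹ * (lastLog m M r / lam) := by
          gcongr
          exact h1.trans h2
      _ = _ := by ring
  · rw [radProfile_eq_zero n m hΨ hlam h]
    rw [zero_pow two_ne_zero]
    positivity

/-- The deviation `r g' - r (ln h)' g` of the radial profile `g` from the ground state `h`. -/
noncomputable def radError (n m : ℕ) (M : ℝ) (Ψ : ℝ → ℝ) (lam r : ℝ) : ℝ :=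
  r * deriv (radProfile n m M Ψ lam) r - radLog n m M 0 r * radProfile n m M Ψ lam r

/-- The radial factor solves `r h' = radLog · h`, so only the derivative of the plateau function
survives. -/
theorem radError_eq (n m : ℕ) {M : ℝ} {Ψ : ℝ → ℝ} {B : ℝ} (hΨ : IsPlateau Ψ B) {lam : ℝ}
    {r : ℝ} (hr : r ∈ Ioo 0 M) :
    radError n m M Ψ lam r =
      -(radFactor n m M r * (deriv Ψ (lastLog m M r / lam) * (logProd m (r / M) / lam))) := by
  have hr0 := hr.1.ne'
  have h1 := (hΨ.contDiff.differentiable (by simp) (lastLog m M r / lam)).hasDerivAt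
  have h2 : HasDerivAt (fun r => radFactor n m M r * Ψ (lastLog m M r / lam)) _ r :=
    (hasDerivAt_radFactor n m hr).mul (h1.comp r ((hasDerivAt_lastLog m hr).div_const lam))
  rw [radError, (radProfile_eventuallyEq n m lam hr).deriv_eq, h2.deriv, radProfile, if_pos hr]
  field_simp
  ring

theorem radError_sq_le (n m : ℕ) {M : ℝ} {Ψ : ℝ → ℝ} {B : ℝ} (hΨ : IsPlateau Ψ B) {lam : ℝ}
    {r : ℝ} (hr : r ∈ Ioo 0 M) :
    radError n m M Ψ lam r ^ 2 ≤ B ^ 2 / lam ^ 2 * (r ^ (-(n : ℝ)) * logProd m (r / M)) := by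
  have h0 := hr.1
  have hη := logProd_pos m (div_mem_Ioo_of_mem hr)
  have hd : deriv Ψ (lastLog m M r / lam) ^ 2 ≤ B ^ 2 := by
    rw [← sq_abs]
    gcongr
    exact hΨ.deriv_le _
  rw [radError_eq n m hΨ hr, neg_sq, mul_pow, mul_pow, radFactor_sq n m hr]
  calc r ^ (-(n : ℝ)) * (logProd m (r / M))⁻¹
        * (deriv Ψ (lastLog m M r / lam) ^ 2 * (logProd m (r / M) / lam) ^ 2)
      ≤ r ^ (-(n : ℝ)) * (logProd m (r / M))⁻¹ * (B ^ 2 * (logProd m (r / M) / lam) ^ 2) := by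
        gcongr
    _ = _ := by field_simp

theorem integral_logProd_div (m : ℕ) {M a b : ℝ} (hab : a ≤ b) (ha : a ∈ Ioo 0 M)
    (hb : b ∈ Ioo 0 M) :
    ∫ r in a..b, logProd m (r / M) / r = lastLog m M a - lastLog m M b := by
  have hsub : uIcc a b ⊆ Ioo 0 M := by
    rw [uIcc_of_le hab]
    exact fun r hr => ⟨ha.1.trans_le hr.1, hr.2.trans_lt hb.2⟩
  have hc : ContinuousOn (fun r => logProd m (r / M) / r) (uIcc a b) :=
    ContinuousOn.div ((logProd_continuousOn m).comp (by fun_prop)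
      fun r hr => div_mem_Ioo_of_mem (hsub hr)) continuousOn_id fun r hr => (hsub hr).1.ne'
  have h := intervalIntegral.integral_eq_sub_of_hasDerivAt (f := fun r => -lastLog m M r)
    (f' := fun r => logProd m (r / M) / r)
    (fun r hr => ((hasDerivAt_lastLog m (hsub hr)).neg).congr_deriv (neg_neg _))
    hc.intervalIntegrable
  rw [h]
  ring

end RadialProfile


/-! ### Polar coordinates in the whole space and in a cone -/

section PolarBounds

variable {n : ℕ}

/-- The open cone of half-aperture `π/3` about `ν`. -/
def openCone (ν : EuclideanSpace ℝ (Fin n)) : Set (EuclideanSpace ℝ (Fin n)) :=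
  {x | ‖x‖ < 2 * inner ℝ ν x}

theorem measurableSet_openCone (ν : EuclideanSpace ℝ (Fin n)) : MeasurableSet (openCone ν) :=
  (isOpen_lt continuous_norm (by fun_prop)).measurableSet

/-- The cone is invariant under dilation, so in polar coordinates the integral factors. The constant
is the measure of the trace on the unit sphere, positive because that trace is open and contains
`ν`. -/
theorem exists_integral_openCone {ν : EuclideanSpace ℝ (Fin n)} (hν : ‖ν‖ = 1) :
    ∃ c > (0 : ℝ), ∀ f : ℝ → ℝ, ∫ x in openCone ν, f ‖x‖ =
      c * ∫ r in Ioi (0 : ℝ), r ^ (n - 1) * f r := by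
  have hdim : Module.finrank ℝ (EuclideanSpace ℝ (Fin n)) = n := by simp
  have : Nontrivial (EuclideanSpace ℝ (Fin n)) := ⟨⟨ν, 0, by rintro rfl; simp at hν⟩⟩
  let μ : Measure (EuclideanSpace ℝ (Fin n)) := volume
  let S : Set (sphere (0 : EuclideanSpace ℝ (Fin n)) 1) := Subtype.val ⁻¹' openCone ν
  have hSo : IsOpen S := (isOpen_lt continuous_norm (by fun_prop)).preimage continuous_subtype_val
  have hSne : S.Nonempty := by
    refine ⟨⟨ν, by simp [hν]⟩, ?_⟩
    simp only [S, openCone, mem_preimage, mem_ofPred_eq, real_inner_self_eq_norm_sq, hν]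
    norm_num
  refine ⟨μ.toSphere.real S, ENNReal.toReal_pos (hSo.measure_ne_zero _ hSne) (by finiteness),
    fun f => ?_⟩
  calc ∫ x in openCone ν, f ‖x‖
      = ∫ x, (openCone ν).indicator (fun x => f ‖x‖) x ∂μ :=
        (integral_indicator (measurableSet_openCone ν)).symm
    _ = ∫ x : ({(0)}ᶜ : Set (EuclideanSpace ℝ (Fin n))),
        (openCone ν).indicator (fun x => f ‖x‖) x.1 ∂(μ.comap (↑)) := by
      rw [integral_subtype_comap (measurableSet_singleton _).compl
        fun x => (openCone ν).indicator (fun x => f ‖x‖) x, restrict_compl_singleton]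
    _ = ∫ p, S.indicator (fun _ => (1 : ℝ)) p.1 * f p.2
        ∂μ.toSphere.prod (.volumeIoiPow (n - 1)) := by
      have h := μ.measurePreserving_homeomorphUnitSphereProd.integral_comp
        (Homeomorph.measurableEmbedding _)
        (fun p => S.indicator (fun _ => (1 : ℝ)) p.1 * f p.2)
      rw [hdim] at h
      rw [← h]
      congr 1
      ext x
      have hx : 0 < ‖x.1‖ := norm_pos_iff.2 x.2
      have hmem : x.1 ∈ openCone ν ↔ (homeomorphUnitSphereProd _ x).1 ∈ S := by
        simp only [S, openCone, mem_preimage, mem_ofPred_eq, homeomorphUnitSphereProd_apply_fst_coe,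
          inner_smul_right, norm_smul, norm_inv, norm_norm]
        rw [inv_mul_cancel₀ hx.ne', mul_left_comm, inv_mul_eq_div, lt_div_iff₀ hx, one_mul]
      by_cases h : x.1 ∈ openCone ν
      · rw [indicator_of_mem h, indicator_of_mem (hmem.1 h)]
        simp
      · rw [indicator_of_notMem h, indicator_of_notMem (fun h' => h (hmem.2 h'))]
        simp
    _ = (∫ s, S.indicator (fun _ => (1 : ℝ)) s ∂μ.toSphere)
        * ∫ r : Ioi (0 : ℝ), f r ∂.volumeIoiPow (n - 1) :=
      integral_prod_mul (S.indicator fun _ => (1 : ℝ)) (fun r : Ioi (0 : ℝ) => f r)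
    _ = _ := by
      rw [integral_indicator_const _ hSo.measurableSet, smul_eq_mul, mul_one]
      congr 1
      simp only [Measure.volumeIoiPow, ENNReal.ofReal]
      rw [integral_withDensity_eq_integral_smul,
        integral_subtype_comap measurableSet_Ioi fun a ↦ Real.toNNReal (a ^ (n - 1)) • f a,
        setIntegral_congr_fun measurableSet_Ioi fun x hx ↦ ?_]
      · rw [NNReal.smul_def, Real.coe_toNNReal _ (pow_nonneg hx.out.le _), smul_eq_mul]
      · exact (measurable_subtype_coe.pow_const _).real_toNNReal

theorem pow_pred_mul_rpow_neg (hn : 1 ≤ n) {r : ℝ} (hr : 0 < r) :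
    r ^ (n - 1) * r ^ (-(n : ℝ)) = 1 / r := by
  rw [← Real.rpow_natCast, ← Real.rpow_add hr, Nat.cast_sub hn, one_div, ← Real.rpow_neg_one]
  congr 1
  push_cast
  ring

/-- Against the weight `r^{-n}` the polar Jacobian leaves `dr/r`, the measure in which the
logarithms integrate explicitly. -/
theorem integral_norm_le_of_le (hn : 1 ≤ n) {f k : ℝ → ℝ} {a b K : ℝ} (ha : 0 < a) (hab : a ≤ b)
    (hf : ∀ r, 0 ≤ f r) (hf0 : ∀ r ∉ Icc a b, f r = 0)
    (hle : ∀ r ∈ Icc a b, f r ≤ K * (r ^ (-(n : ℝ)) * k r)) (hk : ContinuousOn k (Icc a b)) :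
    ∫ x : EuclideanSpace ℝ (Fin n), f ‖x‖ ≤
      n * volume.real (ball (0 : EuclideanSpace ℝ (Fin n)) 1) * (K * ∫ r in a..b, k r / r) := by
  have hdim : Module.finrank ℝ (EuclideanSpace ℝ (Fin n)) = n := by simp
  have : Nontrivial (EuclideanSpace ℝ (Fin n)) :=
    Module.nontrivial_of_finrank_pos (R := ℝ) (by omega)
  rw [integral_fun_norm_addHaar volume f, hdim, nsmul_eq_mul, smul_eq_mul, mul_assoc]
  gcongr
  have hc : ContinuousOn (fun r => K * (k r / r)) (Icc a b) :=
    continuousOn_const.mul (hk.div continuousOn_id fun r hr => (ha.trans_le hr.1).ne')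
  have hsub : Icc a b ∩ Ioi 0 = Icc a b :=
    inter_eq_left.2 fun r hr => ha.trans_le hr.1
  have hint : Integrable ((Icc a b).indicator fun r => K * (k r / r))
      (volume.restrict (Ioi 0)) := by
    refine Integrable.restrict ?_
    rw [integrable_indicator_iff measurableSet_Icc]
    exact hc.integrableOn_Icc
  calc ∫ r in Ioi (0 : ℝ), r ^ (n - 1) • f r
      ≤ ∫ r in Ioi (0 : ℝ), (Icc a b).indicator (fun r => K * (k r / r)) r := by
        refine integral_mono_of_nonneg ?_ hint ?_
        · filter_upwards [ae_restrict_mem measurableSet_Ioi] with r hr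
          exact mul_nonneg (pow_nonneg (le_of_lt hr) _) (hf r)
        · filter_upwards [ae_restrict_mem measurableSet_Ioi] with r hr
          have hr : 0 < r := hr
          by_cases h : r ∈ Icc a b
          · rw [indicator_of_mem h, smul_eq_mul]
            calc r ^ (n - 1) * f r ≤ r ^ (n - 1) * (K * (r ^ (-(n : ℝ)) * k r)) := by
                  gcongr
                  exact hle r h
              _ = K * (r ^ (n - 1) * r ^ (-(n : ℝ)) * k r) := by ring
              _ = _ := by rw [pow_pred_mul_rpow_neg hn hr]; ring
          · rw [indicator_of_notMem h, hf0 r h, smul_zero]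
    _ = K * ∫ r in a..b, k r / r := by
        rw [integral_indicator measurableSet_Icc, Measure.restrict_restrict measurableSet_Icc, hsub,
          integral_Icc_eq_integral_Ioc, ← intervalIntegral.integral_of_le hab,
          intervalIntegral.integral_const_mul]

theorem exists_le_integral_of_le (hn : 1 ≤ n) {ν : EuclideanSpace ℝ (Fin n)} (hν : ‖ν‖ = 1) :
    ∃ c > (0 : ℝ), ∀ (F : EuclideanSpace ℝ (Fin n) → ℝ) (k : ℝ → ℝ) (a b K : ℝ), 0 < a → a ≤ b →
      (∀ x, 0 ≤ F x) → Integrable F → ContinuousOn k (Icc a b) →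
      (∀ x ∈ openCone ν, ‖x‖ ∈ Icc a b → K * (‖x‖ ^ (-(n : ℝ)) * k ‖x‖) ≤ F x) →
      c * (K * ∫ r in a..b, k r / r) ≤ ∫ x, F x := by
  obtain ⟨c, hc, hcone⟩ := exists_integral_openCone hν
  refine ⟨c, hc, fun F k a b K ha hab hF hi hk hle => ?_⟩
  have hsub : Icc a b ∩ Ioi 0 = Icc a b :=
    inter_eq_left.2 fun r hr => ha.trans_le hr.1
  let f : ℝ → ℝ := (Icc a b).indicator fun r => K * (r ^ (-(n : ℝ)) * k r)
  have hf : ContinuousOn (fun r : ℝ => K * (r ^ (-(n : ℝ)) * k r)) (Icc a b) :=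
    continuousOn_const.mul ((continuousOn_id.rpow_const fun r hr =>
      Or.inl (ha.trans_le hr.1).ne').mul hk)
  have e : ∫ r in Ioi (0 : ℝ), r ^ (n - 1) * f r = K * ∫ r in a..b, k r / r := by
    rw [← intervalIntegral.integral_const_mul, intervalIntegral.integral_of_le hab,
      ← integral_Icc_eq_integral_Ioc, ← hsub, ← Measure.restrict_restrict measurableSet_Icc,
      ← integral_indicator measurableSet_Icc]
    refine setIntegral_congr_fun measurableSet_Ioi fun r hr => ?_
    have hr : 0 < r := hr
    by_cases h : r ∈ Icc a b
    · simp only [f]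
      rw [indicator_of_mem h, indicator_of_mem h,
        show r ^ (n - 1) * (K * (r ^ (-(n : ℝ)) * k r))
          = K * (r ^ (n - 1) * r ^ (-(n : ℝ)) * k r) by ring, pow_pred_mul_rpow_neg hn hr]
      ring
    · simp only [f]
      rw [indicator_of_notMem h, indicator_of_notMem h, mul_zero]
  have hfi : IntegrableOn (fun x : EuclideanSpace ℝ (Fin n) => f ‖x‖) (openCone ν) := by
    have hcomp : IsCompact {x : EuclideanSpace ℝ (Fin n) | ‖x‖ ∈ Icc a b} := by
      refine (isCompact_closedBall (0 : EuclideanSpace ℝ (Fin n)) b).of_isClosed_subset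
        (isClosed_Icc.preimage continuous_norm) fun x hx => ?_
      simpa using hx.2
    have h1 : IntegrableOn (fun x : EuclideanSpace ℝ (Fin n) => K * (‖x‖ ^ (-(n : ℝ)) * k ‖x‖))
        {x | ‖x‖ ∈ Icc a b} :=
      (hf.comp continuous_norm.continuousOn fun x hx => hx).integrableOn_compact hcomp
    refine Integrable.integrableOn ?_
    exact (integrable_indicator_iff hcomp.measurableSet).2 h1
  rw [← e, ← hcone]
  calc ∫ x in openCone ν, f ‖x‖ ≤ ∫ x in openCone ν, F x := by
        refine setIntegral_mono_on hfi hi.integrableOn (measurableSet_openCone ν) fun x hx => ?_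
        by_cases h : ‖x‖ ∈ Icc a b
        · simp only [f]
          rw [indicator_of_mem h]
          exact hle x hx h
        · simp only [f]
          rw [indicator_of_notMem h]
          exact hF x
    _ ≤ ∫ x, F x := setIntegral_le_integral hi (Filter.Eventually.of_forall hF)

end PolarBounds


/-! ### The cutoff adapted to an interior ball -/

section WedgeCutoff

variable {n : ℕ}

/-- A smooth monotone step: `0` on `(-∞, 1]`, `1` on `[2, ∞)`, with `β' ≤ B`. -/
structure IsStep (β : ℝ → ℝ) (B : ℝ) : Prop where
  contDiff : ContDiff ℝ ∞ β
  nonneg : ∀ t, 0 ≤ β t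
  le_one : ∀ t, β t ≤ 1
  eq_zero : ∀ t ≤ 1, β t = 0
  eq_one : ∀ t, 2 ≤ t → β t = 1
  deriv_nonneg : ∀ t, 0 ≤ deriv β t
  deriv_le : ∀ t, deriv β t ≤ B
  deriv_eq_zero : ∀ t ∉ Icc (1 : ℝ) 2, deriv β t = 0

theorem exists_isStep : ∃ β B, IsStep β B := by
  have hc : ContDiff ℝ ∞ fun t : ℝ => Real.smoothTransition (t - 1) :=
    Real.smoothTransition.contDiff.comp (by fun_prop)
  have h0 : ∀ t ≤ (1 : ℝ), Real.smoothTransition (t - 1) = 0 := fun t ht =>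
    Real.smoothTransition.zero_of_nonpos (by linarith)
  have h1 : ∀ t, (2 : ℝ) ≤ t → Real.smoothTransition (t - 1) = 1 := fun t ht =>
    Real.smoothTransition.one_of_one_le (by linarith)
  have hd0 : ∀ t ∉ Icc (1 : ℝ) 2, deriv (fun t : ℝ => Real.smoothTransition (t - 1)) t = 0 := by
    intro t ht
    rcases lt_or_ge t 1 with h | h
    · have : (fun t : ℝ => Real.smoothTransition (t - 1)) =ᶠ[nhds t] fun _ => 0 := by
        filter_upwards [Iio_mem_nhds h] with y hy
        exact h0 y (le_of_lt hy)
      rw [this.deriv_eq]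
      simp
    · have h' : 2 < t := by
        by_contra h'
        exact ht ⟨h, not_lt.1 h'⟩
      have : (fun t : ℝ => Real.smoothTransition (t - 1)) =ᶠ[nhds t] fun _ => 1 := by
        filter_upwards [Ioi_mem_nhds h'] with y hy
        exact h1 y (le_of_lt hy)
      rw [this.deriv_eq]
      simp
  obtain ⟨B, hB⟩ := exists_bound_of_support_subset_Icc
    ((hc.of_le (m := 1) (by exact_mod_cast le_top)).continuous_deriv le_rfl) hd0
  refine ⟨fun t => Real.smoothTransition (t - 1), B, hc, fun t => Real.smoothTransition.nonneg _,
    fun t => Real.smoothTransition.le_one _, h0, h1, fun t => ?_,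
    fun t => (le_abs_self _).trans (hB t), hd0⟩
  refine Monotone.deriv_nonneg fun s t hst => ?_
  exact Real.smoothTransition.monotone (by linarith)

/-- The ratio `R ⟨ν, x⟩ / |x|²`, which is at least `1/2` in the ball `B_R(R ν)`. -/
noncomputable def wedgeRatio (R : ℝ) (ν x : EuclideanSpace ℝ (Fin n)) : ℝ :=
  R * inner ℝ ν x / ‖x‖ ^ 2

/-- The part of the annulus `a ≤ |x| ≤ b` in the ball where `wedgeRatio` is at least `1`. -/
def wedgeSet (R a b : ℝ) (ν : EuclideanSpace ℝ (Fin n)) : Set (EuclideanSpace ℝ (Fin n)) :=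
  {x | ‖x‖ ∈ Icc a b ∧ ‖x‖ ^ 2 ≤ R * inner ℝ ν x}

theorem isCompact_wedgeSet (R a b : ℝ) (ν : EuclideanSpace ℝ (Fin n)) :
    IsCompact (wedgeSet R a b ν) := by
  refine (isCompact_closedBall (0 : EuclideanSpace ℝ (Fin n)) b).of_isClosed_subset
    ((isClosed_Icc.preimage continuous_norm).inter (isClosed_le
      (f := fun x : EuclideanSpace ℝ (Fin n) => ‖x‖ ^ 2) (g := fun x => R * inner ℝ ν x)
      (by fun_prop) (by fun_prop)))
    fun x hx => ?_
  simpa using hx.1.2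

theorem wedgeSet_subset_goodSet {R a b M : ℝ} (hR : 0 < R) (ha : 0 < a) (hb : b < M)
    (ν : EuclideanSpace ℝ (Fin n)) : wedgeSet R a b ν ⊆ goodSet M 0 ν := by
  intro x hx
  have h0 : 0 < ‖x‖ := ha.trans_le hx.1.1
  refine ⟨norm_pos_iff.1 h0, hx.1.2.trans_lt hb, ?_, ?_⟩
  · have h1 : 0 < R * inner ℝ ν x := lt_of_lt_of_le (by positivity) hx.2
    simpa [sphFun] using (mul_pos_iff_of_pos_left hR).1 h1
  · simp [sphDen]

/-- `|x - Rν|² = |x|² - 2R⟨ν, x⟩ + R² ≤ R² - |x|²`. Requiring the ratio to be at least `1` rather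
than `1/2` keeps the set strictly inside, so that a compact support fits. -/
theorem wedgeSet_subset_ball {R a b : ℝ} (hR : 0 < R) (ha : 0 < a)
    {ν : EuclideanSpace ℝ (Fin n)} (hν : ‖ν‖ = 1) : wedgeSet R a b ν ⊆ ball (R • ν) R := by
  intro x hx
  have h0 : 0 < ‖x‖ := ha.trans_le hx.1.1
  rw [mem_ball, dist_eq_norm]
  refine lt_of_pow_lt_pow_left₀ 2 hR.le ?_
  rw [norm_sub_sq_real, inner_smul_right, norm_smul, hν, mul_one, Real.norm_eq_abs, sq_abs,
    real_inner_comm]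
  nlinarith [hx.2, pow_pos h0 2]

theorem wedge_eq_zero {β : ℝ → ℝ} {B : ℝ} (hβ : IsStep β B) {R a b : ℝ} (ha : 0 < a) {k : ℝ → ℝ}
    (hk : ∀ r ∉ Icc a b, k r = 0) {ν x : EuclideanSpace ℝ (Fin n)} (hx : x ∉ wedgeSet R a b ν) :
    β (wedgeRatio R ν x) * k ‖x‖ = 0 := by
  by_cases h : ‖x‖ ∈ Icc a b
  · rw [hβ.eq_zero, zero_mul]
    have h0 : 0 < ‖x‖ := ha.trans_le h.1
    rw [wedgeRatio, div_le_one (by positivity)]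
    by_contra h'
    exact hx ⟨h, (not_le.1 h').le⟩
  · rw [hk _ h, mul_zero]

theorem tsupport_subset_of_eq_zero {f : EuclideanSpace ℝ (Fin n) → ℝ}
    {K : Set (EuclideanSpace ℝ (Fin n))} (hK : IsCompact K) (hf : ∀ x ∉ K, f x = 0) :
    tsupport f ⊆ K :=
  closure_minimal (fun x hx => by_contra fun h => hx (hf x h)) hK.isClosed

theorem contDiffAt_wedgeRatio (R : ℝ) (ν : EuclideanSpace ℝ (Fin n))
    {x : EuclideanSpace ℝ (Fin n)} (hx : x ≠ 0) : ContDiffAt ℝ ∞ (wedgeRatio R ν) x := by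
  unfold wedgeRatio
  refine ContDiffAt.div ?_ (contDiff_norm_sq ℝ).contDiffAt (by simpa using hx)
  exact contDiffAt_const.mul (contDiffAt_const.inner ℝ contDiffAt_id)

theorem contDiff_wedge {β : ℝ → ℝ} {B : ℝ} (hβ : IsStep β B) (R : ℝ) {a b M : ℝ} (ha : 0 < a)
    (hb : b < M) {k : ℝ → ℝ} (hk : ∀ r ∉ Icc a b, k r = 0)
    (hkd : ∀ r ∈ Ioo 0 M, ContDiffAt ℝ ∞ k r) (ν : EuclideanSpace ℝ (Fin n)) :
    ContDiff ℝ ∞ fun x => β (wedgeRatio R ν x) * k ‖x‖ := by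
  rw [contDiff_iff_contDiffAt]
  intro x
  by_cases h : ‖x‖ ∈ Icc a b
  · have h0 : 0 < ‖x‖ := ha.trans_le h.1
    have hx := norm_pos_iff.1 h0
    exact (hβ.contDiff.contDiffAt.comp x (contDiffAt_wedgeRatio R ν hx)).mul
      ((hkd _ ⟨h0, h.2.trans_lt hb⟩).comp x (contDiffAt_norm ℝ hx))
  · refine (contDiffAt_const (c := (0 : ℝ))).congr_of_eventuallyEq ?_
    filter_upwards [continuous_norm.continuousAt.preimage_mem_nhds
      (isClosed_Icc.isOpen_compl.mem_nhds h)] with y hy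
    rw [hk _ hy, mul_zero]

theorem hasFDerivAt_wedgeRatio (R : ℝ) (ν : EuclideanSpace ℝ (Fin n))
    {x : EuclideanSpace ℝ (Fin n)} (hx : x ≠ 0) :
    HasFDerivAt (wedgeRatio R ν) ((R / ‖x‖ ^ 2) • innerSL ℝ ν
      - (2 * R * inner ℝ ν x / ‖x‖ ^ 4) • innerSL ℝ x) x := by
  have h0 := norm_ne_zero_iff.2 hx
  have h1 : HasFDerivAt (fun y : EuclideanSpace ℝ (Fin n) => R * inner ℝ ν y)
      (R • innerSL ℝ ν) x := ((innerSL ℝ ν).hasFDerivAt (x := x)).const_mul R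
  have h2 : HasFDerivAt (fun y : EuclideanSpace ℝ (Fin n) => 1 / ‖y‖ ^ 2)
      ((-1 / (‖x‖ ^ 2) ^ 2) • (2 • innerSL ℝ x)) x :=
    hasFDerivAt_const_div (hasStrictFDerivAt_norm_sq x).hasFDerivAt (pow_ne_zero 2 h0)
  have h := h1.mul h2
  have e : wedgeRatio R ν = (fun y : EuclideanSpace ℝ (Fin n) => R * inner ℝ ν y)
      * fun y => 1 / ‖y‖ ^ 2 := by
    ext y; simp [wedgeRatio, div_eq_mul_inv]
  rw [e]
  refine h.congr_fderiv ?_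
  ext v
  simp
  field_simp
  ring

theorem hasFDerivAt_wedge {β : ℝ → ℝ} {B : ℝ} (hβ : IsStep β B) (R : ℝ)
    (ν : EuclideanSpace ℝ (Fin n)) {x : EuclideanSpace ℝ (Fin n)} (hx : x ≠ 0) {k : ℝ → ℝ} {k' : ℝ}
    (hk : HasDerivAt k k' ‖x‖) :
    HasFDerivAt (fun x => β (wedgeRatio R ν x) * k ‖x‖)
      (β (wedgeRatio R ν x) • ((k' / ‖x‖) • innerSL ℝ x)
        + k ‖x‖ • (deriv β (wedgeRatio R ν x) • ((R / ‖x‖ ^ 2) • innerSL ℝ ν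
            - (2 * R * inner ℝ ν x / ‖x‖ ^ 4) • innerSL ℝ x))) x :=
  ((hβ.contDiff.differentiable (by simp) _).hasDerivAt.comp_hasFDerivAt x
    (hasFDerivAt_wedgeRatio R ν hx)).mul (hasFDerivAt_comp_norm hx hk)

/-- The gradient loss caused by the cutoff `β` is controlled by the flux of `Φ` along `ν`. -/
theorem wedge_flux_le {β : ℝ → ℝ} {B : ℝ} (hβ : IsStep β B) {R : ℝ} (hR : 0 < R) {a b M : ℝ}
    (ha : 0 < a) (hbM : b < M) (hbR : b ≤ R / 4) {Φ : ℝ → ℝ} (hΦ0 : ∀ r, 0 ≤ Φ r)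
    (hΦ : ∀ r ∉ Icc a b, Φ r = 0) (hΦd : ∀ r ∈ Ioo 0 M, ContDiffAt ℝ ∞ Φ r)
    {ν : EuclideanSpace ℝ (Fin n)} (hν : ‖ν‖ = 1) :
    R / 2 * ∫ x, deriv β (wedgeRatio R ν x) * (Φ ‖x‖ / ‖x‖ ^ 2)
      ≤ ∫ x : EuclideanSpace ℝ (Fin n), |deriv Φ ‖x‖| := by
  let F : EuclideanSpace ℝ (Fin n) → ℝ := fun x => β (wedgeRatio R ν x) * Φ ‖x‖
  have hF : ContDiff ℝ ∞ F := contDiff_wedge hβ R ha hbM hΦ hΦd ν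
  have hFs := tsupport_subset_of_eq_zero (isCompact_wedgeSet R a b ν)
    fun x hx => wedge_eq_zero hβ ha hΦ (ν := ν) (R := R) hx
  have hFc : HasCompactSupport F :=
    (isCompact_wedgeSet R a b ν).of_isClosed_subset (isClosed_tsupport _) hFs
  have hF1 : ContDiff ℝ 1 F := hF.of_le (by exact_mod_cast le_top)
  -- The integral of the `ν`-derivative of `β Φ` vanishes. That derivative contains `β'` with a
  -- positive coefficient, so the transition layer is estimated without computing its volume.
  have hdiv := integral_divergence_eq_zero (a := fun _ => 0) (b := fun _ => 1) (a' := fun _ => 0)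
    (b' := fun _ => 0) ν hF1 hFc (fun x _ => hasFDerivAt_const _ _) continuousOn_const
    (fun x _ => hasFDerivAt_const _ _) continuousOn_const
  simp only [mul_zero, zero_apply, add_zero, zero_mul, one_mul, zero_add] at hdiv
  have hΦd0 : ∀ r ∉ Icc a b, deriv Φ r = 0 := fun r hr => by
    have : Φ =ᶠ[nhds r] fun _ => 0 := by
      filter_upwards [isClosed_Icc.isOpen_compl.mem_nhds hr] with y hy
      exact hΦ y hy
    rw [this.deriv_eq]
    simp
  have hcomp : IsCompact {x : EuclideanSpace ℝ (Fin n) | ‖x‖ ∈ Icc a b} := by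
    refine (isCompact_closedBall (0 : EuclideanSpace ℝ (Fin n)) b).of_isClosed_subset
      (isClosed_Icc.preimage continuous_norm) fun x hx => ?_
    simpa using hx.2
  have hmem : ∀ r ∈ Icc a b, r ∈ Ioo 0 M := fun r hr => ⟨ha.trans_le hr.1, hr.2.trans_lt hbM⟩
  have hcd : ContinuousOn (fun x : EuclideanSpace ℝ (Fin n) => deriv Φ ‖x‖)
      {x | ‖x‖ ∈ Icc a b} := by
    have h : ContinuousOn (deriv Φ) (Ioo 0 M) :=
      ContDiffOn.continuousOn_deriv_of_isOpen (n := ∞)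
        (fun r hr => (hΦd r hr).contDiffWithinAt) isOpen_Ioo (by simp)
    exact h.comp continuous_norm.continuousOn fun x hx => hmem _ hx
  have iΦ : Integrable fun x : EuclideanSpace ℝ (Fin n) => |deriv Φ ‖x‖| :=
    integrable_of_continuousOn_compact hcomp hcd.abs fun x hx => by simp [hΦd0 _ hx]
  have iF : Integrable fun x => fderiv ℝ F x ν :=
    integrable_of_continuousOn_compact hFc
      ((hF1.continuous_fderiv one_ne_zero).clm_apply continuous_const).continuousOn fun x hx => by
        have : fderiv ℝ F x = 0 := by
          by_contra h
          exact hx (support_fderiv_subset ℝ h)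
        simp [this]
  have hne : ∀ x : EuclideanSpace ℝ (Fin n), ‖x‖ ∈ Icc a b → x ≠ 0 := fun x hx =>
    norm_pos_iff.1 (ha.trans_le hx.1)
  have iW : Integrable fun x => deriv β (wedgeRatio R ν x) * (Φ ‖x‖ / ‖x‖ ^ 2) := by
    refine integrable_of_continuousOn_compact hcomp ?_ fun x hx => by simp [hΦ _ hx]
    refine ContinuousOn.mul ?_ (ContinuousOn.div ?_ (by fun_prop) fun x hx =>
      pow_ne_zero _ (norm_ne_zero_iff.2 (hne x hx)))
    · exact (hβ.contDiff.continuous_deriv (by simp)).comp_continuousOn fun x hx =>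
        (contDiffAt_wedgeRatio R ν (hne x hx)).continuousAt.continuousWithinAt
    · exact ContinuousOn.comp (t := Ioo 0 M) (fun r hr =>
        (hΦd r hr).continuousAt.continuousWithinAt) continuous_norm.continuousOn
        fun x hx => hmem _ hx
  rw [← integral_const_mul]
  have hle : ∀ x, R / 2 * (deriv β (wedgeRatio R ν x) * (Φ ‖x‖ / ‖x‖ ^ 2))
      ≤ fderiv ℝ F x ν + |deriv Φ ‖x‖| := by
    intro x
    by_cases hx : ‖x‖ ∈ Icc a b
    · have hx0 := hne x hx
      have hr : 0 < ‖x‖ := norm_pos_iff.2 hx0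
      have hk := ((hΦd _ (hmem _ hx)).differentiableAt (by simp)).hasDerivAt
      have hy : |inner ℝ ν x| ≤ ‖x‖ := abs_inner_le_norm_of_unit hν x
      rw [(hasFDerivAt_wedge hβ R ν hx0 hk).fderiv]
      simp only [add_apply, sub_apply, smul_apply, innerSL_apply_apply, smul_eq_mul,
        real_inner_self_eq_norm_sq, hν]
      rw [real_inner_comm ν x]
      have h1 : -|deriv Φ ‖x‖| ≤ β (wedgeRatio R ν x) * (deriv Φ ‖x‖ / ‖x‖ * inner ℝ ν x) := by
        refine neg_le_of_abs_le ?_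
        rw [abs_mul, abs_mul, abs_div, abs_norm, abs_of_nonneg (hβ.nonneg _)]
        calc β (wedgeRatio R ν x) * (|deriv Φ ‖x‖| / ‖x‖ * |inner ℝ ν x|)
            ≤ 1 * (|deriv Φ ‖x‖| / ‖x‖ * ‖x‖) := by
              gcongr
              exact hβ.le_one _
          _ = _ := by field_simp
      have h2 : R / 2 * (deriv β (wedgeRatio R ν x) * (Φ ‖x‖ / ‖x‖ ^ 2))
          ≤ Φ ‖x‖ * (deriv β (wedgeRatio R ν x) * (R / ‖x‖ ^ 2 * 1 ^ 2
            - 2 * R * inner ℝ ν x / ‖x‖ ^ 4 * inner ℝ ν x)) := by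
        by_cases hτ : wedgeRatio R ν x ∈ Icc 1 2
        · have h3 : R * inner ℝ ν x ≤ 2 * ‖x‖ ^ 2 := by
            have := hτ.2
            rwa [wedgeRatio, div_le_iff₀ (by positivity)] at this
          have h4 : 0 ≤ R * inner ℝ ν x := by
            have := hτ.1
            rw [wedgeRatio, le_div_iff₀ (by positivity), one_mul] at this
            exact le_trans (by positivity) this
          have h5 : (R * inner ℝ ν x) ^ 2 ≤ (2 * ‖x‖ ^ 2) ^ 2 := by gcongr
          have h6 : ‖x‖ ^ 2 ≤ (R / 4) ^ 2 := by
            have := hx.2.trans hbR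
            gcongr
          -- A lower bound for the derivative of `wedgeRatio` in direction `ν`. In the layer `R⟨ν,
          -- x⟩ ≤ 2r²`, so the negative term is at most `8/R`, and `r ≤ R/4` makes this at most half
          -- of `R/r²`.
          have h7 : R / (2 * ‖x‖ ^ 2) ≤ R / ‖x‖ ^ 2 * 1 ^ 2
              - 2 * R * inner ℝ ν x / ‖x‖ ^ 4 * inner ℝ ν x := by
            have e : R / ‖x‖ ^ 2 * 1 ^ 2 - 2 * R * inner ℝ ν x / ‖x‖ ^ 4 * inner ℝ ν x
                - R / (2 * ‖x‖ ^ 2)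
                = (R ^ 2 * ‖x‖ ^ 2 - 4 * (R * inner ℝ ν x) ^ 2) / (2 * R * ‖x‖ ^ 4) := by
              field_simp
              ring
            rw [← sub_nonneg, e]
            apply div_nonneg _ (by positivity)
            nlinarith [pow_pos hr 2]
          calc R / 2 * (deriv β (wedgeRatio R ν x) * (Φ ‖x‖ / ‖x‖ ^ 2))
              = Φ ‖x‖ * (deriv β (wedgeRatio R ν x) * (R / (2 * ‖x‖ ^ 2))) := by
                field_simp
            _ ≤ _ := by
                have := hΦ0 ‖x‖
                have := hβ.deriv_nonneg (wedgeRatio R ν x)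
                gcongr
        · simp [hβ.deriv_eq_zero _ hτ]
      linarith
    · have : fderiv ℝ F x = 0 := by
        by_contra h
        exact hx (hFs (support_fderiv_subset ℝ h)).1
      rw [this, hΦ _ hx]
      simp
  calc ∫ x, R / 2 * (deriv β (wedgeRatio R ν x) * (Φ ‖x‖ / ‖x‖ ^ 2))
      ≤ ∫ x, (fderiv ℝ F x ν + |deriv Φ ‖x‖|) :=
        integral_mono (iW.const_mul _) (iF.add iΦ) hle
    _ = _ := by rw [integral_add iF iΦ, hdiv, zero_add]

end WedgeCutoff


/-! ### Energy of the concentrating test functions -/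

section ConcentratingFunction

variable {n m : ℕ} {M R r₁ lam B B' : ℝ} {Ψ β : ℝ → ℝ} {ν : EuclideanSpace ℝ (Fin n)}

/-- Test function concentrating at the origin: the cut off half space ground state. -/
noncomputable def wedgeFun (n m : ℕ) (M R lam : ℝ) (Ψ β : ℝ → ℝ) (ν x : EuclideanSpace ℝ (Fin n)) :
    ℝ :=
  β (wedgeRatio R ν x) * radProfile n m M Ψ lam ‖x‖ * inner ℝ ν x

/-- Admissible parameters of `wedgeFun`. -/
structure WedgeData (n m : ℕ) (M R r₁ lam B B' : ℝ) (Ψ β : ℝ → ℝ)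
    (ν : EuclideanSpace ℝ (Fin n)) : Prop where
  hn : 3 ≤ n
  hν : ‖ν‖ = 1
  hM : 0 < M
  hR : 0 < R
  hr₁ : 0 < r₁
  hr₁R : r₁ ≤ R / 4
  hr₁M : r₁ / M ≤ 1 / kappa
  hΨ : IsPlateau Ψ B
  hβ : IsStep β B'
  hlam1 : 1 < lam
  hlam : lastLog m M r₁ ≤ lam

namespace WedgeData

theorem r₁_mem (h : WedgeData n m M R r₁ lam B B' Ψ β ν) : r₁ ∈ Ioo 0 M :=
  ⟨h.hr₁, (div_lt_one h.hM).1 (h.hr₁M.trans_lt one_div_kappa_mem.2)⟩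

theorem exists_radius (h : WedgeData n m M R r₁ lam B B' Ψ β ν) {c : ℝ} (hc : 1 ≤ c) :
    ∃ r ∈ Ioc 0 r₁, r ∈ Ioo 0 M ∧ lastLog m M r = c * lam := by
  have h1 := h.hlam1
  obtain ⟨r, hr, he⟩ := exists_lastLog_eq m h.hM (a := c * lam) (by nlinarith)
  refine ⟨r, ⟨hr.1, ?_⟩, hr, he⟩
  by_contra hlt
  have := lastLog_strictAntiOn m M h.r₁_mem hr (not_le.1 hlt)
  nlinarith [h.hlam]

/-- `lastLog` decreases, so the inner radius carries the larger value `dλ`. The condition `lastLog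
r₁ ≤ λ` keeps all these annuli inside the fixed radius `r₁`. -/
theorem exists_annulus (h : WedgeData n m M R r₁ lam B B' Ψ β ν) {c d : ℝ} (hc : 1 ≤ c)
    (hcd : c ≤ d) : ∃ a b, 0 < a ∧ a ≤ b ∧ b ≤ r₁ ∧ lastLog m M a = d * lam ∧
      lastLog m M b = c * lam ∧
      ∀ r ∈ Ioo 0 M, r ∈ Icc a b ↔ lastLog m M r ∈ Icc (c * lam) (d * lam) := by
  obtain ⟨b, hb, hbM, heb⟩ := h.exists_radius hc
  obtain ⟨a, ha, haM, hea⟩ := h.exists_radius (hc.trans hcd)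
  have hanti := lastLog_strictAntiOn m M
  have hlam := h.hlam1
  refine ⟨a, b, ha.1, ?_, hb.2, hea, heb, fun r hr => ?_⟩
  · rw [← hanti.le_iff_ge hbM haM, hea, heb]
    gcongr
  · rw [mem_Icc, mem_Icc, ← heb, ← hea, hanti.le_iff_ge hbM hr, hanti.le_iff_ge hr haM, and_comm]

theorem radProfile_eq_zero_of_annulus (h : WedgeData n m M R r₁ lam B B' Ψ β ν) {a b : ℝ}
    (hab : ∀ r ∈ Ioo 0 M, r ∈ Icc a b ↔ lastLog m M r ∈ Icc (1 * lam) (4 * lam)) :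
    ∀ r ∉ Icc a b, radProfile n m M Ψ lam r = 0 := by
  intro r hr
  by_cases hrM : r ∈ Ioo 0 M
  · refine radProfile_eq_zero n m h.hΨ (by linarith [h.hlam1]) fun h' => hr ((hab r hrM).2 ?_)
    exact ⟨by linarith [h'.1], h'.2.le⟩
  · rw [radProfile, if_neg hrM]

theorem contDiff_and_tsupport (h : WedgeData n m M R r₁ lam B B' Ψ β ν) :
    ContDiff ℝ ∞ (wedgeFun n m M R lam Ψ β ν) ∧ ∃ a b, 0 < a ∧ a ≤ b ∧ b ≤ r₁ ∧
      tsupport (wedgeFun n m M R lam Ψ β ν) ⊆ wedgeSet R a b ν := by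
  obtain ⟨a, b, ha, hle, hb, -, -, hab⟩ := h.exists_annulus le_rfl (show (1 : ℝ) ≤ 4 by norm_num)
  have h0 := h.radProfile_eq_zero_of_annulus hab
  refine ⟨(contDiff_wedge h.hβ R ha (hb.trans_lt h.r₁_mem.2) h0
    (fun r hr => radProfile_contDiffAt n m h.hΨ hr) ν).mul (contDiff_const.inner ℝ contDiff_id),
    a, b, ha, hle, hb, tsupport_subset_of_eq_zero (isCompact_wedgeSet R a b ν) fun x hx => ?_⟩
  rw [wedgeFun, wedge_eq_zero h.hβ ha h0 hx, zero_mul]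

theorem tsupport_subset_goodSet (h : WedgeData n m M R r₁ lam B B' Ψ β ν) :
    tsupport (wedgeFun n m M R lam Ψ β ν) ⊆ goodSet M 0 ν := by
  obtain ⟨-, a, b, ha, -, hb, hs⟩ := h.contDiff_and_tsupport
  exact hs.trans (wedgeSet_subset_goodSet h.hR ha (hb.trans_lt h.r₁_mem.2) ν)

theorem hasCompactSupport (h : WedgeData n m M R r₁ lam B B' Ψ β ν) :
    HasCompactSupport (wedgeFun n m M R lam Ψ β ν) := by
  obtain ⟨-, a, b, -, -, -, hs⟩ := h.contDiff_and_tsupport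
  exact (isCompact_wedgeSet R a b ν).of_isClosed_subset (isClosed_tsupport _) hs

theorem isTestFunction (h : WedgeData n m M R r₁ lam B B' Ψ β ν)
    {Ω : Set (EuclideanSpace ℝ (Fin n))} (hball : ball (R • ν) R ⊆ Ω) :
    IsTestFunction Ω (wedgeFun n m M R lam Ψ β ν) := by
  obtain ⟨hu, a, b, ha, -, -, hs⟩ := h.contDiff_and_tsupport
  exact ⟨hu, h.hasCompactSupport, (hs.trans (wedgeSet_subset_ball h.hR ha h.hν)).trans hball⟩

/-- Relative to the half space ground state `⟨ν, x⟩ h(r)` the linear factor contributes nothing;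
what remains comes from the radial truncation and from the wedge cutoff. -/
theorem groundGrad_eq (h : WedgeData n m M R r₁ lam B B' Ψ β ν)
    {x : EuclideanSpace ℝ (Fin n)} (hx : x ∈ goodSet M 0 ν) :
    groundGrad m M 0 0 ν (wedgeFun n m M R lam Ψ β ν) x =
      (β (wedgeRatio R ν x) * inner ℝ ν x * radError n m M Ψ lam ‖x‖ / ‖x‖ ^ 2) • x
      + (deriv β (wedgeRatio R ν x) * inner ℝ ν x * radProfile n m M Ψ lam ‖x‖) •
        ((R / ‖x‖ ^ 2) • ν - (2 * R * inner ℝ ν x / ‖x‖ ^ 4) • x) := by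
  have hr := norm_pos_iff.2 hx.1
  have hy : 0 < inner ℝ ν x := by simpa [sphFun] using hx.2.2.1
  have hk := ((radProfile_contDiffAt n m (lam := lam) h.hΨ ⟨hr, hx.2.1⟩).differentiableAt
    (by simp)).hasDerivAt
  have hd : HasFDerivAt (wedgeFun n m M R lam Ψ β ν) _ x :=
    (hasFDerivAt_wedge h.hβ R ν hx.1 hk).mul ((innerSL ℝ ν).hasFDerivAt (x := x))
  refine ext_inner_right ℝ fun w => ?_
  rw [groundGrad, inner_sub_left, inner_gradient, hd.fderiv]
  simp only [logGrad, coefX, coefNu, radError, wedgeFun, sphFun, add_apply, sub_apply, smul_apply,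
    innerSL_apply_apply, smul_eq_mul, inner_add_left, inner_sub_left, real_inner_smul_left]
  generalize deriv (radProfile n m M Ψ lam) ‖x‖ = g'
  generalize radProfile n m M Ψ lam ‖x‖ = g
  field_simp
  ring

/-- In the layer where `β' ≠ 0` one has `⟨ν, x⟩ ≤ 2r²/R`, which cancels the size `3R/r²` of the
gradient of the ratio and leaves `6`. Then `(a + b)² ≤ 2a² + 2b²` and `β'² ≤ B' β'`; one power of
`β'` is retained for `wedge_flux_le`. -/
theorem norm_groundGrad_sq_le (h : WedgeData n m M R r₁ lam B B' Ψ β ν)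
    {x : EuclideanSpace ℝ (Fin n)} (hx : x ∈ goodSet M 0 ν) :
    ‖groundGrad m M 0 0 ν (wedgeFun n m M R lam Ψ β ν) x‖ ^ 2 ≤
      2 * radError n m M Ψ lam ‖x‖ ^ 2
      + 72 * B' * (deriv β (wedgeRatio R ν x) * radProfile n m M Ψ lam ‖x‖ ^ 2) := by
  have hr := norm_pos_iff.2 hx.1
  have hy : 0 < inner ℝ ν x := by simpa [sphFun] using hx.2.2.1
  have hyr : inner ℝ ν x ≤ ‖x‖ := (le_abs_self _).trans (abs_inner_le_norm_of_unit h.hν x)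
  have hR := h.hR
  have hg := radProfile_nonneg n m (M := M) h.hΨ lam ‖x‖
  have hβ' := h.hβ.deriv_nonneg (wedgeRatio R ν x)
  have h1 : ‖(β (wedgeRatio R ν x) * inner ℝ ν x * radError n m M Ψ lam ‖x‖ / ‖x‖ ^ 2) • x‖
      ≤ |radError n m M Ψ lam ‖x‖| := by
    rw [norm_smul, Real.norm_eq_abs, abs_div, abs_mul, abs_mul, abs_of_nonneg (h.hβ.nonneg _),
      abs_of_pos hy, abs_of_pos (pow_pos hr 2)]
    calc β (wedgeRatio R ν x) * inner ℝ ν x * |radError n m M Ψ lam ‖x‖| / ‖x‖ ^ 2 * ‖x‖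
        ≤ 1 * ‖x‖ * |radError n m M Ψ lam ‖x‖| / ‖x‖ ^ 2 * ‖x‖ := by
          gcongr
          exact h.hβ.le_one _
      _ = _ := by field_simp
  have h2 : ‖(R / ‖x‖ ^ 2) • ν - (2 * R * inner ℝ ν x / ‖x‖ ^ 4) • x‖ ≤ 3 * R / ‖x‖ ^ 2 := by
    refine (norm_sub_le _ _).trans ?_
    rw [norm_smul, norm_smul, h.hν, Real.norm_of_nonneg (by positivity),
      Real.norm_of_nonneg (by positivity)]
    calc R / ‖x‖ ^ 2 * 1 + 2 * R * inner ℝ ν x / ‖x‖ ^ 4 * ‖x‖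
        ≤ R / ‖x‖ ^ 2 * 1 + 2 * R * ‖x‖ / ‖x‖ ^ 4 * ‖x‖ := by gcongr
      _ = _ := by field_simp; ring
  have h3 : ‖(deriv β (wedgeRatio R ν x) * inner ℝ ν x * radProfile n m M Ψ lam ‖x‖) •
        ((R / ‖x‖ ^ 2) • ν - (2 * R * inner ℝ ν x / ‖x‖ ^ 4) • x)‖
      ≤ 6 * (deriv β (wedgeRatio R ν x) * radProfile n m M Ψ lam ‖x‖) := by
    by_cases hτ : wedgeRatio R ν x ∈ Icc 1 2
    · have h4 : R * inner ℝ ν x ≤ 2 * ‖x‖ ^ 2 := by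
        have := hτ.2
        rwa [wedgeRatio, div_le_iff₀ (by positivity)] at this
      rw [norm_smul, Real.norm_of_nonneg (by positivity)]
      calc deriv β (wedgeRatio R ν x) * inner ℝ ν x * radProfile n m M Ψ lam ‖x‖
            * ‖(R / ‖x‖ ^ 2) • ν - (2 * R * inner ℝ ν x / ‖x‖ ^ 4) • x‖
          ≤ deriv β (wedgeRatio R ν x) * inner ℝ ν x * radProfile n m M Ψ lam ‖x‖
            * (3 * R / ‖x‖ ^ 2) := by gcongr
        _ = deriv β (wedgeRatio R ν x) * radProfile n m M Ψ lam ‖x‖ * 3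
            * (R * inner ℝ ν x) / ‖x‖ ^ 2 := by ring
        _ ≤ deriv β (wedgeRatio R ν x) * radProfile n m M Ψ lam ‖x‖ * 3
            * (2 * ‖x‖ ^ 2) / ‖x‖ ^ 2 := by gcongr
        _ = _ := by field_simp; ring
    · simp [h.hβ.deriv_eq_zero _ hτ]
  rw [h.groundGrad_eq hx]
  set e := radError n m M Ψ lam ‖x‖
  set g := radProfile n m M Ψ lam ‖x‖
  set b := deriv β (wedgeRatio R ν x)
  have h5 := (norm_add_le _ _).trans (add_le_add h1 h3)
  refine (pow_le_pow_left₀ (norm_nonneg _) h5 2).trans ?_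
  have h6 : b * (b * g ^ 2) ≤ B' * (b * g ^ 2) := by
    gcongr
    exact h.hβ.deriv_le _
  nlinarith [sq_nonneg (|e| - 6 * (b * g)), sq_abs e]

theorem radError_eq_zero_of_annulus (h : WedgeData n m M R r₁ lam B B' Ψ β ν) {a b : ℝ}
    (hab : ∀ r ∈ Ioo 0 M, r ∈ Icc a b ↔ lastLog m M r ∈ Icc (1 * lam) (4 * lam)) :
    ∀ r ∉ Icc a b, radError n m M Ψ lam r = 0 := by
  intro r hr
  have h0 := h.radProfile_eq_zero_of_annulus hab
  have : radProfile n m M Ψ lam =ᶠ[nhds r] fun _ => 0 := by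
    filter_upwards [isClosed_Icc.isOpen_compl.mem_nhds hr] with y hy
    exact h0 y hy
  rw [radError, this.deriv_eq, h0 r hr]
  simp

/-- The integrand is of order `λ^{-2} r^{-n} X₁⋯X_m`, and the integral of `X₁⋯X_m dr/r` over the
annulus is `4λ - λ`. -/
theorem integral_radError_sq_le (h : WedgeData n m M R r₁ lam B B' Ψ β ν) :
    ∫ x : EuclideanSpace ℝ (Fin n), radError n m M Ψ lam ‖x‖ ^ 2 ≤
      n * volume.real (ball (0 : EuclideanSpace ℝ (Fin n)) 1) * (3 * B ^ 2) / lam := by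
  obtain ⟨a, b, ha, hle, hb, hea, heb, hab⟩ :=
    h.exists_annulus le_rfl (show (1 : ℝ) ≤ 4 by norm_num)
  have hbM := hb.trans_lt h.r₁_mem.2
  have hlam := h.hlam1
  have hmem : ∀ r ∈ Icc a b, r ∈ Ioo 0 M := fun r hr => ⟨ha.trans_le hr.1, hr.2.trans_lt hbM⟩
  have h1 := integral_norm_le_of_le (n := n) (f := fun r => radError n m M Ψ lam r ^ 2)
    (k := fun r => logProd m (r / M)) (K := B ^ 2 / lam ^ 2) (by linarith [h.hn]) ha hle
    (fun r => sq_nonneg _)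
    (fun r hr => by simp [h.radError_eq_zero_of_annulus hab r hr])
    (fun r hr => radError_sq_le n m h.hΨ (hmem r hr))
    ((logProd_continuousOn m).comp (by fun_prop) fun r hr => div_mem_Ioo_of_mem (hmem r hr))
  refine h1.trans (le_of_eq ?_)
  rw [integral_logProd_div m hle (hmem a ⟨le_rfl, hle⟩) (hmem b ⟨hle, le_rfl⟩), hea, heb]
  field_simp
  ring

theorem abs_radLog_le (h : WedgeData n m M R r₁ lam B B' Ψ β ν) {r : ℝ} (h0 : 0 < r)
    (hr : r ≤ r₁) : |radLog n m M 0 r| ≤ n := by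
  have hn : (3 : ℝ) ≤ n := by exact_mod_cast h.hn
  have h2 : r / M ≤ 1 / kappa := (div_le_div_of_nonneg_right hr h.hM.le).trans h.hr₁M
  have h1 := logSum_le_quarter m (div_pos h0 h.hM) h2
  have h3 := logSum_nonneg m (t := r / M)
    ⟨div_pos h0 h.hM, h2.trans_lt one_div_kappa_mem.2⟩
  rw [radLog, abs_le]
  constructor <;> linarith

/-- Besides the factor `1/λ`, the square `r²` in the flux gives a spare power of `r`. It outweighs
`1/(X₁⋯X_{m+1})`, which by slow variation is at most a constant times `r^{-1/4}`. -/
theorem abs_deriv_flux_le (h : WedgeData n m M R r₁ lam B B' Ψ β ν) {r : ℝ} (h0 : 0 < r)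
    (hr : r ≤ r₁) :
    |deriv (fun r => r ^ 2 * radProfile n m M Ψ lam r ^ 2) r| ≤
      (2 * n + 3 + B ^ 2) / lam * (logProd (m + 1) (r₁ / M))⁻¹ * r₁ ^ (1 / 4 : ℝ)
        * (r ^ (-(n : ℝ)) * (r * r ^ (-(1 / 4) : ℝ))) := by
  have hrM : r ∈ Ioo 0 M := ⟨h0, hr.trans_lt h.r₁_mem.2⟩
  have hlam := h.hlam1
  have hd := ((radProfile_contDiffAt n m (lam := lam) h.hΨ hrM).differentiableAt
    (by simp)).hasDerivAt
  have hη := logProd_pos (m + 1) (div_mem_Ioo_of_mem hrM)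
  have hη₁ := logProd_pos (m + 1) (div_mem_Ioo_of_mem h.r₁_mem)
  have hinv : (logProd (m + 1) (r / M))⁻¹ ≤
      (logProd (m + 1) (r₁ / M))⁻¹ * (r₁ ^ (1 / 4 : ℝ) * r ^ (-(1 / 4) : ℝ)) := by
    have h1 := logProd_le_mul_rpow (m + 1) (div_pos h0 h.hM)
      (div_le_div_of_nonneg_right hr h.hM.le) h.hr₁M
    rw [div_div_div_cancel_right₀ h.hM.ne', Real.div_rpow h.hr₁.le h0.le] at h1
    rw [Real.rpow_neg h0.le, inv_mul_eq_div, le_div_iff₀ hη₁, inv_mul_le_iff₀ hη]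
    exact h1
  have hη1 : logProd m (r / M) ≤ (logProd (m + 1) (r / M))⁻¹ :=
    (logProd_le_one m (div_mem_Ioo_of_mem hrM)).trans
      ((one_le_inv₀ hη).2 (logProd_le_one _ (div_mem_Ioo_of_mem hrM)))
  have hg := radProfile_sq_le n m h.hΨ (lam := lam) (by linarith) hrM
  have he := radError_sq_le n m h.hΨ (lam := lam) hrM
  have he' : radError n m M Ψ lam r ^ 2 ≤
      B ^ 2 / lam * (r ^ (-(n : ℝ)) * (logProd (m + 1) (r / M))⁻¹) := by
    have := logProd_pos m (div_mem_Ioo_of_mem hrM)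
    refine he.trans ?_
    gcongr
    nlinarith
  have hl := h.abs_radLog_le h0 hr
  have hflux : HasDerivAt (fun r => r ^ 2 * radProfile n m M Ψ lam r ^ 2) _ r :=
    (hasDerivAt_pow 2 r).mul (hd.pow 2)
  rw [hflux.deriv]
  have e0 : radError n m M Ψ lam r = r * deriv (radProfile n m M Ψ lam) r
    - radLog n m M 0 r * radProfile n m M Ψ lam r := rfl
  generalize deriv (radProfile n m M Ψ lam) r = g' at *
  generalize radProfile n m M Ψ lam r = g at *
  generalize radLog n m M 0 r = l at *
  generalize radError n m M Ψ lam r = e at *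
  have e1 : ((2 : ℕ) : ℝ) * r ^ (2 - 1) * g ^ 2 + r ^ 2 * (((2 : ℕ) : ℝ) * g ^ (2 - 1) * g')
      = r * ((2 + 2 * l) * g ^ 2 + 2 * g * e) := by
    rw [e0]
    push_cast
    ring
  have e2 : |(2 + 2 * l) * g ^ 2 + 2 * g * e| ≤ (2 * n + 3) * g ^ 2 + e ^ 2 := by
    rw [abs_le] at hl ⊢
    constructor <;> nlinarith [sq_nonneg (g + e), sq_nonneg (g - e), sq_nonneg g]
  refine (le_of_eq (congrArg abs e1)).trans ?_
  rw [abs_mul, abs_of_pos h0]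
  have hrn : 0 < r ^ (-(n : ℝ)) := by positivity
  calc r * |(2 + 2 * l) * g ^ 2 + 2 * g * e|
      ≤ r * ((2 * n + 3) * (1 / lam * (r ^ (-(n : ℝ)) * (logProd (m + 1) (r / M))⁻¹))
        + B ^ 2 / lam * (r ^ (-(n : ℝ)) * (logProd (m + 1) (r / M))⁻¹)) := by
        gcongr
        refine e2.trans ?_
        gcongr
    _ = r * ((2 * n + 3 + B ^ 2) / lam * (r ^ (-(n : ℝ)) * (logProd (m + 1) (r / M))⁻¹)) := by
        ring
    _ ≤ r * ((2 * n + 3 + B ^ 2) / lam * (r ^ (-(n : ℝ)) * ((logProd (m + 1) (r₁ / M))⁻¹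
        * (r₁ ^ (1 / 4 : ℝ) * r ^ (-(1 / 4) : ℝ))))) := by
        gcongr
    _ = _ := by ring

/-- `wedge_flux_le` with `Φ = r² g²`, where `g` is the profile. By `abs_deriv_flux_le` the radial
integral reduces to that of `r^{-1/4}`, which converges at the origin, so the bound is `O(1/λ)`. -/
theorem integral_cutoff_le (h : WedgeData n m M R r₁ lam B B' Ψ β ν) :
    R / 2 * ∫ x, deriv β (wedgeRatio R ν x) * radProfile n m M Ψ lam ‖x‖ ^ 2 ≤
      n * volume.real (ball (0 : EuclideanSpace ℝ (Fin n)) 1)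
        * ((2 * n + 3 + B ^ 2) * (logProd (m + 1) (r₁ / M))⁻¹ * r₁ ^ (1 / 4 : ℝ)
          * (r₁ ^ (3 / 4 : ℝ) / (3 / 4))) / lam := by
  obtain ⟨a, b, ha, hle, hb, hea, heb, hab⟩ :=
    h.exists_annulus le_rfl (show (1 : ℝ) ≤ 4 by norm_num)
  have hbM := hb.trans_lt h.r₁_mem.2
  have hlam := h.hlam1
  have hη₁ := logProd_pos (m + 1) (div_mem_Ioo_of_mem h.r₁_mem)
  have h0 := h.radProfile_eq_zero_of_annulus hab
  have hmem : ∀ r ∈ Icc a b, r ∈ Ioo 0 M := fun r hr => ⟨ha.trans_le hr.1, hr.2.trans_lt hbM⟩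
  let Φ : ℝ → ℝ := fun r => r ^ 2 * radProfile n m M Ψ lam r ^ 2
  have hΦ : ∀ r ∉ Icc a b, Φ r = 0 := fun r hr => by simp [Φ, h0 r hr]
  have hflux := wedge_flux_le h.hβ h.hR ha hbM (hb.trans h.hr₁R) (Φ := Φ)
    (fun r => by positivity) hΦ (fun r hr => (contDiffAt_id.pow 2).mul
      ((radProfile_contDiffAt n m h.hΨ hr).pow 2)) h.hν
  have e : ∀ x : EuclideanSpace ℝ (Fin n), deriv β (wedgeRatio R ν x) * (Φ ‖x‖ / ‖x‖ ^ 2)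
      = deriv β (wedgeRatio R ν x) * radProfile n m M Ψ lam ‖x‖ ^ 2 := fun x => by
    by_cases hx : ‖x‖ ∈ Icc a b
    · have := ha.trans_le hx.1
      simp only [Φ]
      field_simp
    · simp [Φ, h0 _ hx]
  simp only [e] at hflux
  refine hflux.trans ?_
  have h1 := integral_norm_le_of_le (n := n) (f := fun r => |deriv Φ r|)
    (k := fun r => r * r ^ (-(1 / 4) : ℝ)) (by linarith [h.hn]) ha hle (fun r => abs_nonneg _)
    (fun r hr => by
      have : Φ =ᶠ[nhds r] fun _ => 0 := by
        filter_upwards [isClosed_Icc.isOpen_compl.mem_nhds hr] with y hy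
        exact hΦ y hy
      rw [this.deriv_eq]
      simp)
    (fun r hr => h.abs_deriv_flux_le (ha.trans_le hr.1) (hr.2.trans hb))
    (continuousOn_id.mul (continuousOn_id.rpow_const fun r hr => Or.inl (ha.trans_le hr.1).ne'))
  refine h1.trans ?_
  have h2 : ∫ r in a..b, r * r ^ (-(1 / 4) : ℝ) / r ≤ r₁ ^ (3 / 4 : ℝ) / (3 / 4) := by
    have h3 : ∫ r in a..b, r * r ^ (-(1 / 4) : ℝ) / r = ∫ r in a..b, r ^ (-(1 / 4) : ℝ) := by
      refine intervalIntegral.integral_congr fun r hr => ?_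
      rw [uIcc_of_le hle] at hr
      have := ha.trans_le hr.1
      field_simp
    rw [h3, integral_rpow (Or.inl (by norm_num))]
    norm_num
    have : b ^ (3 / 4 : ℝ) ≤ r₁ ^ (3 / 4 : ℝ) :=
      Real.rpow_le_rpow (ha.le.trans hle) hb (by norm_num)
    have : 0 ≤ a ^ (3 / 4 : ℝ) := by positivity
    linarith
  have hr₁ := h.hr₁
  calc _ ≤ n * volume.real (ball (0 : EuclideanSpace ℝ (Fin n)) 1)
        * ((2 * n + 3 + B ^ 2) / lam * (logProd (m + 1) (r₁ / M))⁻¹ * r₁ ^ (1 / 4 : ℝ)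
          * (r₁ ^ (3 / 4 : ℝ) / (3 / 4))) := by gcongr
    _ = _ := by ring

end WedgeData

end ConcentratingFunction


/-! ### Lower bound for the critical integral and sharpness of the exponents -/

section Sharpness

variable {n m : ℕ} {M R r₁ lam B B' : ℝ} {Ψ β : ℝ → ℝ} {ν : EuclideanSpace ℝ (Fin n)}

theorem integrable_of_continuousOn_annulus {f : EuclideanSpace ℝ (Fin n) → ℝ} {a b : ℝ}
    (hc : ContinuousOn f {x | ‖x‖ ∈ Icc a b}) (h0 : ∀ x, ‖x‖ ∉ Icc a b → f x = 0) :
    Integrable f := by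
  refine integrable_of_continuousOn_compact ?_ hc h0
  refine (isCompact_closedBall (0 : EuclideanSpace ℝ (Fin n)) b).of_isClosed_subset
    (isClosed_Icc.preimage continuous_norm) fun x hx => ?_
  simpa using hx.2

namespace WedgeData

theorem continuousOn_radError (h : WedgeData n m M R r₁ lam B B' Ψ β ν) :
    ContinuousOn (radError n m M Ψ lam) (Ioo 0 M) := by
  have h1 : ContDiffOn ℝ ∞ (radProfile n m M Ψ lam) (Ioo 0 M) := fun r hr =>
    (radProfile_contDiffAt n m h.hΨ hr).contDiffWithinAt
  have h2 := h1.continuousOn_deriv_of_isOpen isOpen_Ioo (by simp)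
  have h3 : ContinuousOn (fun r => logSum m (r / M)) (Ioo 0 M) :=
    (logSum_continuousOn m).comp (by fun_prop) fun r hr => div_mem_Ioo_of_mem hr
  have h4 := h1.continuousOn
  unfold radError radLog
  fun_prop

/-- The energy of the test function relative to the ground state is `O(1 / lam)`. -/
theorem integral_groundGrad_sq_le (h : WedgeData n m M R r₁ lam B B' Ψ β ν) :
    ∫ x, ‖groundGrad m M 0 0 ν (wedgeFun n m M R lam Ψ β ν) x‖ ^ 2 ≤
      (2 * (n * volume.real (ball (0 : EuclideanSpace ℝ (Fin n)) 1) * (3 * B ^ 2))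
        + 72 * B' * (2 / R * (n * volume.real (ball (0 : EuclideanSpace ℝ (Fin n)) 1)
        * ((2 * n + 3 + B ^ 2) * (logProd (m + 1) (r₁ / M))⁻¹ * r₁ ^ (1 / 4 : ℝ)
          * (r₁ ^ (3 / 4 : ℝ) / (3 / 4)))))) / lam := by
  obtain ⟨a, b, ha, hle, hb, -, -, hab⟩ :=
    h.exists_annulus le_rfl (show (1 : ℝ) ≤ 4 by norm_num)
  have hbM := hb.trans_lt h.r₁_mem.2
  have hmem : ∀ x : EuclideanSpace ℝ (Fin n), ‖x‖ ∈ Icc a b → ‖x‖ ∈ Ioo 0 M := fun x hx =>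
    ⟨ha.trans_le hx.1, hx.2.trans_lt hbM⟩
  have hB' : 0 ≤ B' := (h.hβ.deriv_nonneg 0).trans (h.hβ.deriv_le 0)
  have hR := h.hR
  have i1 : Integrable fun x : EuclideanSpace ℝ (Fin n) => radError n m M Ψ lam ‖x‖ ^ 2 :=
    integrable_of_continuousOn_annulus
      ((h.continuousOn_radError.comp continuous_norm.continuousOn hmem).pow 2)
      fun x hx => by simp [h.radError_eq_zero_of_annulus hab _ hx]
  have i2 : Integrable fun x => deriv β (wedgeRatio R ν x) * radProfile n m M Ψ lam ‖x‖ ^ 2 := by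
    refine integrable_of_continuousOn_annulus (a := a) (b := b) (ContinuousOn.mul ?_ ?_)
      fun x hx => by simp [h.radProfile_eq_zero_of_annulus hab _ hx]
    · exact (h.hβ.contDiff.continuous_deriv (by simp)).comp_continuousOn fun x hx =>
        (contDiffAt_wedgeRatio R ν
          (norm_pos_iff.1 (hmem x hx).1)).continuousAt.continuousWithinAt
    · have h1 : ContinuousOn (radProfile n m M Ψ lam) (Ioo 0 M) := fun r hr =>
        (radProfile_contDiffAt n m h.hΨ hr).continuousAt.continuousWithinAt
      exact (h1.comp continuous_norm.continuousOn hmem).pow 2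
  have h1 := h.integral_radError_sq_le
  have h2 := h.integral_cutoff_le
  have h3 : ∫ x, ‖groundGrad m M 0 0 ν (wedgeFun n m M R lam Ψ β ν) x‖ ^ 2 ≤
      ∫ x, (2 * radError n m M Ψ lam ‖x‖ ^ 2
      + 72 * B' * (deriv β (wedgeRatio R ν x) * radProfile n m M Ψ lam ‖x‖ ^ 2)) := by
    refine integral_mono_of_nonneg (Filter.Eventually.of_forall fun x => by positivity)
      ((i1.const_mul 2).add (i2.const_mul _)) (Filter.Eventually.of_forall fun x => ?_)
    by_cases hx : x ∈ tsupport (wedgeFun n m M R lam Ψ β ν)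
    · exact h.norm_groundGrad_sq_le (h.tsupport_subset_goodSet hx)
    · have := h.hβ.deriv_nonneg (wedgeRatio R ν x)
      simp only [groundGrad_eq_zero m M 0 0 ν hx]
      rw [norm_zero, zero_pow two_ne_zero]
      positivity
  rw [integral_add (i1.const_mul 2) (i2.const_mul _), integral_const_mul, integral_const_mul] at h3
  refine h3.trans ?_
  set W := ∫ x, deriv β (wedgeRatio R ν x) * radProfile n m M Ψ lam ‖x‖ ^ 2
  rw [div_mul_eq_mul_div, div_le_iff₀ two_pos] at h2
  have h4 : W ≤ 2 / R * (n * volume.real (ball (0 : EuclideanSpace ℝ (Fin n)) 1)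
        * ((2 * n + 3 + B ^ 2) * (logProd (m + 1) (r₁ / M))⁻¹ * r₁ ^ (1 / 4 : ℝ)
          * (r₁ ^ (3 / 4 : ℝ) / (3 / 4)))) / lam := by
    rw [div_mul_eq_mul_div, div_div, mul_comm R lam, ← div_div, le_div_iff₀ hR, mul_comm]
    exact h2.trans_eq (by ring)
  calc _ ≤ 2 * (n * volume.real (ball (0 : EuclideanSpace ℝ (Fin n)) 1) * (3 * B ^ 2) / lam)
        + 72 * B' * (2 / R * (n * volume.real (ball (0 : EuclideanSpace ℝ (Fin n)) 1)
        * ((2 * n + 3 + B ^ 2) * (logProd (m + 1) (r₁ / M))⁻¹ * r₁ ^ (1 / 4 : ℝ)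
          * (r₁ ^ (3 / 4 : ℝ) / (3 / 4)))) / lam) := by gcongr
    _ = _ := by ring

end WedgeData

/-- Lowering exponents only enlarges the product, since all logarithms are below `1`. At the index
`j` the gain is at least the one computed with `X_{m+1}`, because `X_{j+1} ≤ X_{m+1}` for the
zero-based `j`. -/
theorem prod_iterLog_rpow_ge {p : Fin (m + 1) → ℝ} {γ t : ℝ} (hp : ∀ i, p i ≤ γ)
    (j : Fin (m + 1)) (ht : t ∈ Ioo (0 : ℝ) 1) :
    logProd (m + 1) t ^ γ * (1 / iterLog (m + 1) t) ^ (γ - p j) ≤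
      ∏ i : Fin (m + 1), iterLog ((i : ℕ) + 1) t ^ p i := by
  have hpos : ∀ k, 0 < iterLog k t := fun k => (iterLog_mem k ht).1
  have e : ∏ i : Fin (m + 1), iterLog ((i : ℕ) + 1) t ^ p i =
      logProd (m + 1) t ^ γ * ∏ i : Fin (m + 1), iterLog ((i : ℕ) + 1) t ^ (p i - γ) := by
    rw [logProd, Finset.prod_range, ← Real.finsetProd_rpow _ _ fun i _ => (hpos _).le,
      ← Finset.prod_mul_distrib]
    refine Finset.prod_congr rfl fun i _ => ?_
    rw [← Real.rpow_add (hpos _)]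
    congr 1
    ring
  rw [e]
  have := logProd_pos (m + 1) ht
  gcongr
  calc (1 / iterLog (m + 1) t) ^ (γ - p j) = iterLog (m + 1) t ^ (p j - γ) := by
        rw [one_div, Real.inv_rpow (hpos _).le, ← Real.rpow_neg (hpos _).le, neg_sub]
    _ ≤ iterLog ((j : ℕ) + 1) t ^ (p j - γ) :=
        Real.rpow_le_rpow_of_nonpos (hpos _) (iterLog_mono_index (by omega) ht)
          (by linarith [hp j])
    _ = ∏ i : Fin (m + 1), if i = j then iterLog ((j : ℕ) + 1) t ^ (p j - γ) else 1 := by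
        rw [Finset.prod_ite_eq' Finset.univ j, if_pos (Finset.mem_univ j)]
    _ ≤ ∏ i : Fin (m + 1), iterLog ((i : ℕ) + 1) t ^ (p i - γ) := by
        refine Finset.prod_le_prod (fun i _ => ?_) fun i _ => ?_
        · split_ifs
          · exact (Real.rpow_pos_of_pos (hpos _) _).le
          · exact zero_le_one
        · split_ifs with hij
          · rw [hij]
          · exact Real.one_le_rpow_of_pos_of_le_one_of_nonpos (hpos _) (iterLog_mem _ ht).2.le
              (by linarith [hp i])

namespace WedgeData

/-- In the cone the ratio is at least `R/(2r) ≥ 2`, so the wedge cutoff is inactive there, and on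
the plateau so is the radial one. -/
theorem wedgeFun_ge (h : WedgeData n m M R r₁ lam B B' Ψ β ν) {x : EuclideanSpace ℝ (Fin n)}
    (hx : x ∈ openCone ν) (h0 : 0 < ‖x‖) (hr : ‖x‖ ≤ r₁)
    (hL : lastLog m M ‖x‖ ∈ Icc (2 * lam) (3 * lam)) :
    1 / 2 * (‖x‖ * radFactor n m M ‖x‖) ≤ wedgeFun n m M R lam Ψ β ν x := by
  have hx : ‖x‖ < 2 * inner ℝ ν x := hx
  have hrM : ‖x‖ ∈ Ioo 0 M := ⟨h0, hr.trans_lt h.r₁_mem.2⟩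
  have hf := radFactor_pos n m hrM
  have hR := h.hR
  have hτ : 2 ≤ wedgeRatio R ν x := by
    have := h.hr₁R
    rw [wedgeRatio, le_div_iff₀ (by positivity)]
    nlinarith
  rw [wedgeFun, h.hβ.eq_one _ hτ, radProfile_of_plateau n m h.hΨ (by linarith [h.hlam1]) hrM hL]
  nlinarith

/-- The critical power of `r h(r)` is `r^{-n} (X₁⋯X_m)^{-n/(n-2)}`. As `γ = (2n-2)/(n-2)` equals
`n/(n-2) + 1`, the weight leaves exactly one factor `X₁⋯X_m`; the last logarithm contributes
`λ^{-γ}` and the lowered exponent `λ^{γ - p_j}`. -/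
theorem mass_integrand_ge (h : WedgeData n m M R r₁ lam B B' Ψ β ν) {p : Fin (m + 1) → ℝ}
    (hp : ∀ i, p i ≤ (2 * (n : ℝ) - 2) / ((n : ℝ) - 2)) (j : Fin (m + 1))
    {x : EuclideanSpace ℝ (Fin n)} (hx : x ∈ openCone ν) (h0 : 0 < ‖x‖) (hr : ‖x‖ ≤ r₁)
    (hL : lastLog m M ‖x‖ ∈ Icc (2 * lam) (3 * lam)) :
    (1 / 2) ^ (2 * (n : ℝ) / (n - 2)) * 3 ^ (-((2 * (n : ℝ) - 2) / ((n : ℝ) - 2)))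
        * lam ^ (-p j) * (‖x‖ ^ (-(n : ℝ)) * logProd m (‖x‖ / M)) ≤
      (∏ i : Fin (m + 1), iterLog ((i : ℕ) + 1) (‖x‖ / M) ^ p i)
        * |wedgeFun n m M R lam Ψ β ν x| ^ (2 * (n : ℝ) / (n - 2)) := by
  have hn : (3 : ℝ) ≤ n := by exact_mod_cast h.hn
  have hn2 : 0 < (n : ℝ) - 2 := by linarith
  have hlam := h.hlam1
  have hrM : ‖x‖ ∈ Ioo 0 M := ⟨h0, hr.trans_lt h.r₁_mem.2⟩
  have ht := div_mem_Ioo_of_mem hrM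
  have hη := logProd_pos m ht
  have hX := (iterLog_mem (m + 1) ht).1
  have hf := radFactor_pos n m hrM
  have hγ : (2 * (n : ℝ) - 2) / (n - 2) = n / (n - 2) + 1 := by field_simp; ring
  have hq : 2 * (n : ℝ) / (n - 2) = 2 * (n / (n - 2)) := by ring
  set γ := (2 * (n : ℝ) - 2) / (n - 2)
  set q := 2 * (n : ℝ) / (n - 2)
  have hq0 : 0 ≤ q := by positivity
  have hu : (1 / 2) ^ q * (‖x‖ ^ (-(n : ℝ)) * logProd m (‖x‖ / M) ^ (-((n : ℝ) / (n - 2)))) ≤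
      |wedgeFun n m M R lam Ψ β ν x| ^ q := by
    have e : ‖x‖ ^ (-(n : ℝ)) * logProd m (‖x‖ / M) ^ (-((n : ℝ) / (n - 2)))
        = (‖x‖ * radFactor n m M ‖x‖) ^ q := by
      rw [hq, Real.rpow_mul (by positivity), Real.rpow_two, mul_pow, radFactor_sq n m hrM,
        ← Real.rpow_two, ← mul_assoc, ← Real.rpow_add h0, Real.mul_rpow (by positivity)
        (by positivity), ← Real.rpow_mul h0.le, Real.inv_rpow hη.le, ← Real.rpow_neg hη.le]
      congr 2
      field_simp
      ring
    rw [e, ← Real.mul_rpow (by norm_num) (by positivity)]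
    exact Real.rpow_le_rpow (by positivity)
      ((h.wedgeFun_ge hx h0 hr hL).trans (le_abs_self _)) hq0
  have hprod := prod_iterLog_rpow_ge hp j ht
  have hLpos := lastLog_pos m hrM
  have hL1 : lam ^ (γ - p j) ≤ lastLog m M ‖x‖ ^ (γ - p j) :=
    Real.rpow_le_rpow (by linarith) (by linarith [hL.1]) (by linarith [hp j])
  have hγ0 : 0 ≤ γ := by rw [hγ]; positivity
  have hL2 : (3 * lam) ^ (-γ) ≤ lastLog m M ‖x‖ ^ (-γ) :=
    Real.rpow_le_rpow_of_nonpos hLpos hL.2 (by linarith)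
  have e1 : logProd (m + 1) (‖x‖ / M) ^ γ
      = logProd m (‖x‖ / M) ^ γ * lastLog m M ‖x‖ ^ (-γ) := by
    rw [logProd_succ_last, Real.mul_rpow hη.le hX.le, lastLog, one_div, Real.inv_rpow hX.le,
      ← Real.rpow_neg hX.le, neg_neg]
  have e2 : logProd m (‖x‖ / M)
      = logProd m (‖x‖ / M) ^ γ * logProd m (‖x‖ / M) ^ (-((n : ℝ) / (n - 2))) := by
    rw [← Real.rpow_add hη, hγ]
    simp
  have hl0 : 0 < lam := by linarith
  calc (1 / 2) ^ q * 3 ^ (-γ) * lam ^ (-p j) * (‖x‖ ^ (-(n : ℝ)) * logProd m (‖x‖ / M))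
      = (logProd m (‖x‖ / M) ^ γ * (3 * lam) ^ (-γ) * lam ^ (γ - p j))
        * ((1 / 2) ^ q * (‖x‖ ^ (-(n : ℝ)) * logProd m (‖x‖ / M) ^ (-((n : ℝ) / (n - 2))))) := by
        nth_rewrite 1 [e2]
        rw [Real.mul_rpow (by norm_num) hl0.le, show -p j = -γ + (γ - p j) by ring,
          Real.rpow_add hl0]
        ring
    _ ≤ (logProd m (‖x‖ / M) ^ γ * lastLog m M ‖x‖ ^ (-γ) * lastLog m M ‖x‖ ^ (γ - p j))
        * |wedgeFun n m M R lam Ψ β ν x| ^ q := by gcongr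
    _ ≤ _ := by
        rw [← e1]
        gcongr
        exact hprod

/-- Integrating over the plateau `[2λ, 3λ]` gives `λ^{1 - p_j}`. The power `(n-2)/n` brings the
exponent into the stated form because `(γ - 1)(n-2)/n = 1`. -/
theorem exists_mass_ge (hn : 3 ≤ n) (hν : ‖ν‖ = 1) {p : Fin (m + 1) → ℝ}
    (hp : ∀ i, p i ≤ (2 * (n : ℝ) - 2) / ((n : ℝ) - 2)) (j : Fin (m + 1)) :
    ∃ c > (0 : ℝ), ∀ {M R r₁ lam B B' : ℝ} {Ψ β : ℝ → ℝ},
      WedgeData n m M R r₁ lam B B' Ψ β ν →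
      c * lam ^ (((2 * (n : ℝ) - 2) / ((n : ℝ) - 2) - p j) * (((n : ℝ) - 2) / n) - 1) ≤
        (∫ x, (∏ i : Fin (m + 1), iterLog ((i : ℕ) + 1) (‖x‖ / M) ^ p i)
          * |wedgeFun n m M R lam Ψ β ν x| ^ (2 * (n : ℝ) / (n - 2))) ^ (((n : ℝ) - 2) / n) := by
  obtain ⟨c, hc, hint⟩ := exists_le_integral_of_le (n := n) (by omega) hν
  have hn' : (3 : ℝ) ≤ n := by exact_mod_cast hn
  have hn2 : 0 < (n : ℝ) - 2 := by linarith
  refine ⟨(c * ((1 / 2) ^ (2 * (n : ℝ) / (n - 2)) * 3 ^ (-((2 * (n : ℝ) - 2) / ((n : ℝ) - 2)))))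
    ^ (((n : ℝ) - 2) / n), by positivity, fun {M R r₁ lam B B' Ψ β} h => ?_⟩
  have hlam : 0 < lam := by linarith [h.hlam1]
  obtain ⟨a, b, ha, hle, hb, hea, heb, hab⟩ :=
    h.exists_annulus (c := 2) (d := 3) (by norm_num) (by norm_num)
  have hbM := hb.trans_lt h.r₁_mem.2
  have hmem : ∀ r ∈ Icc a b, r ∈ Ioo 0 M := fun r hr => ⟨ha.trans_le hr.1, hr.2.trans_lt hbM⟩
  have hgood := h.tsupport_subset_goodSet
  have hcrit : 2 * (n : ℝ) / (n - 2) ≠ 0 := by positivity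
  have hu0 : ∀ x ∉ tsupport (wedgeFun n m M R lam Ψ β ν),
      |wedgeFun n m M R lam Ψ β ν x| ^ (2 * (n : ℝ) / (n - 2)) = 0 := fun x hx => by
    rw [image_eq_zero_of_notMem_tsupport hx, abs_zero, Real.zero_rpow hcrit]
  have hpos : ∀ x ∈ goodSet M 0 ν, ∀ k, 0 < iterLog k (‖x‖ / M) := fun x hx k =>
    (iterLog_mem k (goodSet_div_mem hx)).1
  have hge := hint (fun x => (∏ i : Fin (m + 1), iterLog ((i : ℕ) + 1) (‖x‖ / M) ^ p i)
      * |wedgeFun n m M R lam Ψ β ν x| ^ (2 * (n : ℝ) / (n - 2))) (fun r => logProd m (r / M)) a b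
    ((1 / 2) ^ (2 * (n : ℝ) / (n - 2)) * 3 ^ (-((2 * (n : ℝ) - 2) / ((n : ℝ) - 2)))
        * lam ^ (-p j)) ha hle
    (fun x => by
      by_cases hx : x ∈ tsupport (wedgeFun n m M R lam Ψ β ν)
      · exact mul_nonneg (Finset.prod_nonneg fun i _ => Real.rpow_nonneg
          (hpos x (hgood hx) _).le _) (by positivity)
      · rw [hu0 x hx, mul_zero])
    (integrable_of_continuousOn_compact h.hasCompactSupport
      (ContinuousOn.mul (continuousOn_finsetProd _ fun i _ => ContinuousOn.rpow_const
        ((continuousOn_comp_norm_div (iterLog_continuousOn _) M 0 ν).mono hgood)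
        fun x hx => Or.inl (hpos x (hgood hx) _).ne')
        (h.contDiff_and_tsupport.1.continuous.abs.rpow_const
          fun _ => Or.inr (by positivity)).continuousOn)
      fun x hx => by rw [hu0 x hx, mul_zero])
    ((logProd_continuousOn m).comp (by fun_prop) fun r hr => div_mem_Ioo_of_mem (hmem r hr))
    (fun x hx hr => h.mass_integrand_ge hp j hx (ha.trans_le hr.1) (hr.2.trans hb)
      ((hab _ (hmem _ hr)).1 hr))
  rw [integral_logProd_div m hle (hmem a ⟨le_rfl, hle⟩) (hmem b ⟨hle, le_rfl⟩), hea, heb] at hge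
  refine le_trans (le_of_eq ?_) (Real.rpow_le_rpow (by
    rw [show 3 * lam - 2 * lam = lam by ring]; positivity) hge (by positivity))
  rw [show c * ((1 / 2) ^ (2 * (n : ℝ) / (n - 2)) * 3 ^ (-((2 * (n : ℝ) - 2) / ((n : ℝ) - 2)))
        * lam ^ (-p j) * (3 * lam - 2 * lam))
      = c * ((1 / 2) ^ (2 * (n : ℝ) / (n - 2)) * 3 ^ (-((2 * (n : ℝ) - 2) / ((n : ℝ) - 2))))
        * (lam ^ (-p j) * lam ^ (1 : ℝ)) by rw [Real.rpow_one]; ring,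
    ← Real.rpow_add hlam,
    Real.mul_rpow (y := lam ^ (-p j + 1)) (by positivity) (by positivity), ← Real.rpow_mul hlam.le]
  congr 2
  field_simp
  ring

end WedgeData

/-- With `ε = δ = 0` the potential is exactly the Hardy series, so the two sides differ by the
energy `O(1/λ)` against `c c' λ^{s-1}` with `s > 0`. Only the interior ball is used, and any `M > 0`
is allowed. -/
theorem exponents_sharp (hn : 3 ≤ n) {Ω : Set (EuclideanSpace ℝ (Fin n))}
    (hΩ : InteriorBallAtZero Ω) (hM : 0 < M) {p : Fin (m + 1) → ℝ}
    (hp : ∀ i, p i ≤ (2 * (n : ℝ) - 2) / ((n : ℝ) - 2))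
    (hlt : ∃ i, p i < (2 * (n : ℝ) - 2) / ((n : ℝ) - 2)) {c : ℝ} (hc : 0 < c) :
    ∃ u : EuclideanSpace ℝ (Fin n) → ℝ, IsTestFunction Ω u ∧
      (∫ x in Ω, ‖∇ u x‖ ^ 2) <
        (n : ℝ) ^ 2 / 4 * (∫ x in Ω, u x ^ 2 / ‖x‖ ^ 2)
          + 1 / 4 * (∑ i ∈ Finset.Icc 1 m, (∫ x in Ω, u x ^ 2 / ‖x‖ ^ 2
              * logProd i (‖x‖ / M) ^ 2))
          + c * (∫ x in Ω, (∏ i : Fin (m + 1), iterLog ((i : ℕ) + 1) (‖x‖ / M) ^ p i)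
              * |u x| ^ (2 * (n : ℝ) / ((n : ℝ) - 2))) ^ (((n : ℝ) - 2) / (n : ℝ)) := by
  obtain ⟨R, hR, ν, hν, hball⟩ := hΩ
  obtain ⟨j, hj⟩ := hlt
  obtain ⟨Ψ, B, hΨ⟩ := exists_isPlateau
  obtain ⟨β, B', hβ⟩ := exists_isStep
  obtain ⟨c', hc', hmass⟩ := WedgeData.exists_mass_ge hn hν hp j
  have hn' : (3 : ℝ) ≤ n := by exact_mod_cast hn
  have hn2 : 0 < (n : ℝ) - 2 := by linarith
  have hk := kappa_spec.1
  let r₁ := min (R / 4) (M / kappa)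
  let s := ((2 * (n : ℝ) - 2) / ((n : ℝ) - 2) - p j) * (((n : ℝ) - 2) / n)
  have hs : 0 < s := mul_pos (by linarith) (by positivity)
  -- The energy constant depends on the fixed radius `r₁` but not on `λ`, so `λ` may be chosen
  -- afterwards.
  let E := 2 * (n * volume.real (ball (0 : EuclideanSpace ℝ (Fin n)) 1) * (3 * B ^ 2))
        + 72 * B' * (2 / R * (n * volume.real (ball (0 : EuclideanSpace ℝ (Fin n)) 1)
        * ((2 * n + 3 + B ^ 2) * (logProd (m + 1) (r₁ / M))⁻¹ * r₁ ^ (1 / 4 : ℝ)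
          * (r₁ ^ (3 / 4 : ℝ) / (3 / 4)))))
  obtain ⟨lam, hl1, hl2, hl3⟩ := ((Filter.eventually_gt_atTop (1 : ℝ)).and
    ((Filter.eventually_ge_atTop (lastLog m M r₁)).and
      ((tendsto_rpow_atTop hs).eventually_gt_atTop (E / (c * c'))))).exists
  have h : WedgeData n m M R r₁ lam B B' Ψ β ν :=
    { hn := hn, hν := hν, hM := hM, hR := hR, hr₁ := lt_min (by positivity) (by positivity),
      hr₁R := min_le_left _ _, hΨ := hΨ, hβ := hβ, hlam1 := hl1, hlam := hl2
      hr₁M := by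
        rw [div_le_iff₀ hM, one_div_mul_eq_div]
        exact min_le_right _ _ }
  have hu := h.isTestFunction hball
  refine ⟨wedgeFun n m M R lam Ψ β ν, hu, ?_⟩
  set u := wedgeFun n m M R lam Ψ β ν
  have hu0 : ∀ x ∉ Ω, u x = 0 := fun x hx =>
    image_eq_zero_of_notMem_tsupport fun h => hx (hu.2.2 h)
  have hcrit : (2 * (n : ℝ) / (n - 2)) ≠ 0 := by positivity
  have hg0 : ∀ x ∉ Ω, ‖∇ u x‖ ^ 2 = 0 := fun x hx => by
    rw [gradient_eq_zero_of_notMem_tsupport fun h => hx (hu.2.2 h)]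
    simp
  rw [setIntegral_eq_integral_of_forall_compl_eq_zero hg0,
    setIntegral_eq_integral_of_forall_compl_eq_zero fun x hx => by simp [hu0 x hx],
    setIntegral_eq_integral_of_forall_compl_eq_zero fun x hx => by simp [hu0 x hx, hcrit],
    Finset.sum_congr rfl fun i _ =>
      setIntegral_eq_integral_of_forall_compl_eq_zero fun x hx => by simp [hu0 x hx]]
  obtain ⟨-, -, hid⟩ := ground_state_identity m (δ := 0) hν
    (hu.1.of_le (by exact_mod_cast le_top)) hu.2.1 h.tsupport_subset_goodSet
  obtain ⟨-, hterms⟩ := hardy_terms_integral m hu.1.continuous hu.2.1 h.tsupport_subset_goodSet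
  have hpot : ∀ x, groundPotential m M 0 0 ν x = ((n : ℝ) ^ 2 / 4
      + 1 / 4 * ∑ i ∈ Finset.range m, logProd (i + 1) (‖x‖ / M) ^ 2) / ‖x‖ ^ 2 := fun x => by
    simp [groundPotential]
  simp only [hpot] at hid
  rw [hid, hterms, add_comm]
  gcongr
  have hl0 : 0 < lam := by linarith
  calc ∫ x, ‖groundGrad m M 0 0 ν u x‖ ^ 2 ≤ E / lam := h.integral_groundGrad_sq_le
    _ < c * (c' * lam ^ (s - 1)) := by
        rw [div_lt_iff₀ (by positivity)] at hl3
        rw [Real.rpow_sub_one hl0.ne', ← mul_div_assoc, ← mul_div_assoc]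
        gcongr
        linarith
    _ ≤ _ := by
        gcongr
        exact hmass h

end Sharpness

/-! ### The main theorem -/

theorem theorem1p4 (n : ℕ) (hn : 3 ≤ n) :
    ∃ σ > (0 : ℝ), ∃ C > (0 : ℝ),
      ∀ (Ω : Set (EuclideanSpace ℝ (Fin n))) (ρ : ℝ),
        IsOpen Ω → IsConnected Ω → Bornology.IsBounded Ω → 0 ∈ frontier Ω →
        ExteriorBallAtZero Ω ρ → supNorm Ω / σ ≤ ρ →
        -- the improved inequality
        (∀ (m : ℕ) (u : EuclideanSpace ℝ (Fin n) → ℝ), IsTestFunction Ω u →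
          (n : ℝ) ^ 2 / 4 * (∫ x in Ω, u x ^ 2 / ‖x‖ ^ 2)
            + 1 / 4 * (∑ i ∈ Finset.Icc 1 m,
                (∫ x in Ω, u x ^ 2 / ‖x‖ ^ 2 * logProd i (‖x‖ / (3 * kappa * supNorm Ω)) ^ 2))
            + C * (∫ x in Ω,
                logProd (m + 1) (‖x‖ / (3 * kappa * supNorm Ω))
                    ^ ((2 * (n : ℝ) - 2) / ((n : ℝ) - 2))
                  * |u x| ^ (2 * (n : ℝ) / ((n : ℝ) - 2))) ^ (((n : ℝ) - 2) / (n : ℝ))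
            ≤ (∫ x in Ω, ‖∇ u x‖ ^ 2)) ∧
        -- sharpness of the exponents of `X₁, …, X_{m+1}`: lowering any of them destroys the
        -- inequality, whatever the constant `c > 0`
        (InteriorBallAtZero Ω →
          ∀ (m : ℕ) (p : Fin (m + 1) → ℝ),
            (∀ i, p i ≤ (2 * (n : ℝ) - 2) / ((n : ℝ) - 2)) →
            (∃ i, p i < (2 * (n : ℝ) - 2) / ((n : ℝ) - 2)) →
            ∀ c > (0 : ℝ), ∃ u : EuclideanSpace ℝ (Fin n) → ℝ, IsTestFunction Ω u ∧
              (∫ x in Ω, ‖∇ u x‖ ^ 2) <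
                (n : ℝ) ^ 2 / 4 * (∫ x in Ω, u x ^ 2 / ‖x‖ ^ 2)
                  + 1 / 4 * (∑ i ∈ Finset.Icc 1 m,
                      (∫ x in Ω, u x ^ 2 / ‖x‖ ^ 2
                        * logProd i (‖x‖ / (3 * kappa * supNorm Ω)) ^ 2))
                  + c * (∫ x in Ω,
                      (∏ i : Fin (m + 1),
                          iterLog ((i : ℕ) + 1) (‖x‖ / (3 * kappa * supNorm Ω)) ^ p i)
                        * |u x| ^ (2 * (n : ℝ) / ((n : ℝ) - 2))) ^ (((n : ℝ) - 2) / (n : ℝ))) := by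
  have hn' : (3 : ℝ) ≤ n := by exact_mod_cast hn
  obtain ⟨C, hC, h⟩ := improved_inequality hn
  -- With `ε = 1/(2ρ)`, this value of `σ` makes `D/σ ≤ ρ` the smallness condition `128 n² D ε ≤ 1`
  -- of the pointwise bounds.
  refine ⟨1 / (64 * (n : ℝ) ^ 2), by positivity, C, hC, ?_⟩
  intro Ω ρ ho hconn hb h0 hext hρ
  refine ⟨h Ω ρ ho hconn hb h0 hext hρ, fun hint m p hp hlt c hc => ?_⟩
  obtain ⟨x₀, hx₀⟩ := hconn.nonempty
  have hD : 0 < supNorm Ω := (norm_pos_iff.2 (ne_zero_of_mem_of_frontier ho h0 hx₀)).trans_le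
    (norm_le_supNorm hb hx₀)
  have hk := kappa_spec.1
  exact exponents_sharp hn hint (by positivity) hp hlt hc
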